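/- Throughout, a surface-knot diagram $D$ is given by a closed connected oriented smooth surface $F$, smoothly embedded in $\mathbb{R}^4$, whose projection $F\to\mathbb{R}^3$ along the 4th coordinate (the height) is generic: every point of the image is a regular point, a transverse double point, a triple point in general position, or a branch point (Whitney umbrella). A set $L$ of oriented immersed curves on $D$ is a finite family of oriented closed smooth immersed curves on $F$ which intersect themselves and one another transversely and only in double points, miss the triple and branch points of $D$, and are transverse to the double point curves of $D$. The sheets of $(D,L)$ are the connected components of the surface obtained by cutting $F$ along the lower preimages of the double point curves and along the curves of $L$. Each disk of $D$ carries the normal direction $\vec n$ with $(\vec v_1,\vec v_2,\vec n)$ positive in $\mathbb{R}^3$, where $(\vec v_1,\vec v_2)$ is the orientation of $F$; each curve of $L$ with direction $\vec v$ carries the normal direction $\vec n$ in $F$ with $(\vec v,\vec n)$ positive in $F$. Let $R=(R,*)$ be a rack (each map $\bullet * a$ is bijective and $(a*b)*c=(a*c)*(b*c)$), and let $\iota:R\to R$ be its kink map, the bijection characterized by $\iota(a)*a=a$. A rack coloring of $(D,L)$ is a map $c$ from the set of sheets of $(D,L)$ to $R$ such that - $c(x_k)=c(x_i)*c(x_j)$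 whenever, along a double point curve of $D$, $x_j$ is the over-sheet and $x_i,x_k$ are the under-sheets, and the normal direction of $x_j$ points from $x_i$ to $x_k$; - $c(x_j)=\iota(c(x_i))$ whenever $x_i,x_j$ are the two sheets along an arc of $L$ and the normal direction of the arc points from $x_i$ to $x_j$. Let $\mathrm{Col}_R(D,L)$ be the set of rack colorings of $(D,L)$. **Proposition 4.2.** Let $L_1$ and $L_2$ be two sets of oriented immersed curves on a surface-knot diagram $D$ that are homologous, i.e. represent the same class in $H_1(F;\mathbb{Z})$. Then for every rack $R$ there is a bijection between $\mathrm{Col}_R(D,L_1)$ and $\mathrm{Col}_R(D,L_2)$. Moreover, let $-L_1$ be $L_1$ with all orientations reversed. For every sheet $y_0$ of $(D,(-L_1)\cup L_2)$ there is a map $N$ from the set of sheets of $(D,(-L_1)\cup L_2)$ to $\mathbb{Z}$ with $N(y_0)=0$, which increases by $1$ when an arc of $(-L_1)\cup L_2$ is crossed, away from multiple points of $(-L_1)\cup L_2$, in its normal direction, and which takes the same value on the two under-sheets along each double point curve of $D$, and there is a bijection $\Phi:\mathrm{Col}_R(D,L_1)\to\mathrm{Col}_R(D,L_2)$ such that $$\Phi(c)(x_2)=\iota^{N(y)}(c(x_1))$$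 for every $c\in\mathrm{Col}_R(D,L_1)$ and all sheets $x_1$ of $(D,L_1)$, $x_2$ of $(D,L_2)$ and $y$ of $(D,(-L_1)\cup L_2)$ with $y\subseteq x_1\cap x_2$. -/

import Mathlib

open scoped Manifold ContDiff Topology Quandles

noncomputable section

namespace SurfaceKnot

/-! ### Racks and the kink map

A rack `(R, *)` with right operation `*` is Mathlib's `Rack R`, with `a * b := b ◃ a`: the map
`* a` is bijective, and `(a * b) * c = (a * c) * (b * c)`. -/

/-- The operation `a * b` of a rack, written as a right action. -/
def rackOp {R : Type*} [Rack R] (a b : R) : R := b ◃ a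

/-- The kink map `ι : R → R`, as a permutation of `R`; its integer powers `ι ^ n` are the powers
in the group `Equiv.Perm R`. It is characterized by `ι a * a = a`, see `kink_unique`. -/
def kink (R : Type*) [Rack R] : Equiv.Perm R := (Rack.selfApplyEquiv R).symm

theorem kink_spec {R : Type*} [Rack R] (a : R) : rackOp (kink R a) a = a :=
  Rack.right_inv a a

theorem kink_unique {R : Type*} [Rack R] (a b : R) (h : rackOp b a = a) : b = kink R a :=
  (Rack.left_inv a).injective (h.trans (kink_spec a).symm)

/-! ### Euclidean spaces and the projection -/

/-- Euclidean space of dimension `n`. -/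
abbrev E (n : ℕ) : Type := EuclideanSpace ℝ (Fin n)

/-- The projection of 4-space to 3-space that drops the fourth coordinate. -/
def proj (v : E 4) : E 3 := !₂[v 0, v 1, v 2]

/-- Determinant of `n` vectors of Euclidean `n`-space, with respect to the standard basis. -/
def stdDet {n : ℕ} (v : Fin n → E n) : ℝ := (EuclideanSpace.basisFun (Fin n) ℝ).toBasis.det v

/-! ### Oriented smooth surfaces -/

section Surface

variable (F : Type) [TopologicalSpace F] [ChartedSpace (E 2) F]

/-- An orientation of a smooth surface, given by an oriented atlas: a family of smooth charts
covering the surface whose transition maps have positive Jacobian determinant. -/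
structure SurfaceOrientation where
  charts : Set (OpenPartialHomeomorph F (E 2))
  charts_subset : charts ⊆ IsManifold.maximalAtlas (𝓡 2) ∞ F
  cover : ∀ x, ∃ φ ∈ charts, x ∈ φ.source
  compatible : ∀ φ ∈ charts, ∀ ψ ∈ charts, ∀ x ∈ φ.source ∩ ψ.source,
    0 < (fderiv ℝ (φ.symm.trans ψ) (φ x)).det

variable {F}

/-- The pair `(v, w)` of tangent vectors at `x` is a positively oriented basis of the tangent
plane. By compatibility of the charts the choice of `φ` does not matter. -/
def SurfaceOrientation.IsPositive (o : SurfaceOrientation F) (x : F)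
    (v w : TangentSpace (𝓡 2) x) : Prop :=
  ∃ φ ∈ o.charts, x ∈ φ.source ∧
    0 < stdDet ![(mfderiv (𝓡 2) (𝓡 2) φ x v : E 2), (mfderiv (𝓡 2) (𝓡 2) φ x w : E 2)]

/-- The curve `β` passes through `x` at time `t`, with velocity vector `v`. -/
def HasVelocityAt (β : ℝ → F) (t : ℝ) (x : F) (v : TangentSpace (𝓡 2) x) : Prop :=
  β t = x ∧ HasMFDerivAt 𝓘(ℝ, ℝ) (𝓡 2) β t
    (ContinuousLinearMap.toSpanSingleton ℝ (v : E 2))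

/-- The set `S` is entered when one leaves the point `x` in the direction `v`. -/
def IsEnteredAt (S : Set F) (x : F) (v : TangentSpace (𝓡 2) x) : Prop :=
  ∃ β : ℝ → F, HasVelocityAt β 0 x v ∧ ∀ᶠ t in 𝓝[>] (0 : ℝ), β t ∈ S

/-! ### Generic maps to 3-space -/

/-- The tangent plane at `f x` of the image under `f` of a neighbourhood of `x`. -/
def tangentImage (f : F → E 3) (x : F) : Submodule ℝ (E 3) :=
  LinearMap.range (mfderiv (𝓡 2) (𝓡 3) f x : E 2 →L[ℝ] E 3).toLinearMap

/-- The differential of `f` at `x` is injective. -/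
def IsImmersiveAt (f : F → E 3) (x : F) : Prop :=
  Function.Injective (mfderiv (𝓡 2) (𝓡 3) f x)

/-- `f x` is a regular point of the image of `f`. -/
def IsRegularPoint (f : F → E 3) (x : F) : Prop :=
  f ⁻¹' {f x} = {x} ∧ IsImmersiveAt f x

/-- `f x = f x'` is a double point of the image of `f`: exactly two disks meet there,
transversely. -/
def IsDoublePair (f : F → E 3) (x x' : F) : Prop :=
  x ≠ x' ∧ f ⁻¹' {f x} = {x, x'} ∧ IsImmersiveAt f x ∧ IsImmersiveAt f x' ∧
    tangentImage f x ⊔ tangentImage f x' = ⊤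

/-- `f x` is a double point of the image of `f`. -/
def IsDoublePoint (f : F → E 3) (x : F) : Prop := ∃ x', IsDoublePair f x x'

/-- `f x` is a triple point of the image of `f`: exactly three disks meet there, with tangent
planes in general position. -/
def IsTriplePoint (f : F → E 3) (x : F) : Prop :=
  ∃ x' x'', x ≠ x' ∧ x ≠ x'' ∧ x' ≠ x'' ∧ f ⁻¹' {f x} = {x, x', x''} ∧
    IsImmersiveAt f x ∧ IsImmersiveAt f x' ∧ IsImmersiveAt f x'' ∧
    tangentImage f x ⊓ tangentImage f x' ⊓ tangentImage f x'' = ⊥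

/-- `f x` is a branch point of the image of `f`: only `x` is mapped there, and in suitable smooth
coordinates around `x` and `f x` the map is the Whitney umbrella `(s, t) ↦ (s, t², s t)`. -/
def IsBranchPoint (f : F → E 3) (x : F) : Prop :=
  f ⁻¹' {f x} = {x} ∧
  ∃ φ ∈ IsManifold.maximalAtlas (𝓡 2) ∞ F, ∃ ψ ∈ IsManifold.maximalAtlas (𝓡 3) ∞ (E 3),
    x ∈ φ.source ∧ f x ∈ ψ.source ∧ φ x = 0 ∧ ψ (f x) = 0 ∧
    ∀ᶠ y in 𝓝 x, ψ (f y) = !₂[φ y 0, (φ y 1) ^ 2, φ y 0 * φ y 1]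

/-! ### Surface-knot diagrams -/

variable (F)

/-- A diagram of a surface-knot: an oriented surface `F`, smoothly embedded in 4-space so that the
projection to 3-space is generic, with the height information given by the fourth coordinate. The
surface `F` is assumed to be closed and connected where diagrams are used. -/
structure Diagram where
  orientation : SurfaceOrientation F
  knot : F → E 4
  isSmoothEmbedding : Manifold.IsSmoothEmbedding (𝓡 2) (𝓡 4) ∞ knot
  generic : ∀ x, IsRegularPoint (proj ∘ knot) x ∨ IsDoublePoint (proj ∘ knot) x ∨
    IsTriplePoint (proj ∘ knot) x ∨ IsBranchPoint (proj ∘ knot) x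

variable {F}

namespace Diagram

variable (D : Diagram F)

/-- The projection of the surface to 3-space. -/
def map : F → E 3 := proj ∘ D.knot

/-- The height of a point of the surface: the coordinate dropped by the projection. -/
def height (x : F) : ℝ := D.knot x 3

/-- The points of the surface that lie below another point with the same projection. -/
def lowerDecker : Set F := {x | ∃ x', D.map x' = D.map x ∧ D.height x < D.height x'}

/-- The vector `w` of 3-space, based at the image of `a`, points to the side of the disk of the
diagram around `a` to which its normal direction `n` points; here `n` is determined by:
`(v₁, v₂, n)` is a positive basis of 3-space if `(v₁, v₂)` is a positive basis of the
tangent plane at `a`. -/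
def PointsAlongNormal (a : F) (w : E 3) : Prop :=
  ∃ v₁ v₂ : TangentSpace (𝓡 2) a, D.orientation.IsPositive a v₁ v₂ ∧
    0 < stdDet ![(mfderiv (𝓡 2) (𝓡 3) D.map a v₁ : E 3), (mfderiv (𝓡 2) (𝓡 3) D.map a v₂ : E 3), w]

end Diagram

/-! ### Oriented immersed curves -/

variable (F)

/-- A finite family of oriented immersed closed curves on `F`: each is a smooth 1-periodic map from
the line with nowhere vanishing derivative, oriented by increasing parameter. -/
structure Curves where
  ι : Type
  [fintype : Fintype ι]
  curve : ι → ℝ → F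
  periodic : ∀ i, Function.Periodic (curve i) 1
  smooth : ∀ i, ContMDiff 𝓘(ℝ, ℝ) (𝓡 2) ∞ (curve i)
  immersed : ∀ i t, mfderiv 𝓘(ℝ, ℝ) (𝓡 2) (curve i) t ≠ 0

attribute [instance] Curves.fintype

variable {F}

namespace Curves

/-- The set of all points on the curves. -/
def support (L : Curves F) : Set F := ⋃ i, Set.range (L.curve i)

/-- Two parameters that describe the same point of the same (abstract) circle. -/
def SameParam (L : Curves F) (p q : L.ι × ℝ) : Prop :=
  p.1 = q.1 ∧ ∃ k : ℤ, q.2 = p.2 + k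

/-- The point of the surface at the parameter `p`. -/
def point (L : Curves F) (p : L.ι × ℝ) : F := L.curve p.1 p.2

/-- The same curves with the opposite orientations. -/
def reverse (L : Curves F) : Curves F where
  ι := L.ι
  curve i t := L.curve i (-t)
  periodic i t := by
    have h := L.periodic i (-(t + 1))
    simp only [neg_add_rev, neg_add_cancel_comm] at h ⊢
    exact h.symm
  smooth i := (L.smooth i).comp contDiff_neg.contMDiff
  immersed i t h := by
    have h1 : MDifferentiableAt 𝓘(ℝ, ℝ) (𝓡 2) (fun s => L.curve i (-s)) t :=
      ((L.smooth i).comp contDiff_neg.contMDiff).mdifferentiableAt (by simp)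
    have h3 : MDifferentiableAt 𝓘(ℝ, ℝ) 𝓘(ℝ, ℝ) (fun s : ℝ => -s) (-t) :=
      (contDiff_neg (𝕜 := ℝ) (F := ℝ) (n := 1)).contMDiff.mdifferentiableAt one_ne_zero
    have h2 : (fun s => L.curve i (-s)) ∘ (fun s : ℝ => -s) = L.curve i := by
      funext s; simp
    have h1' : MDifferentiableAt 𝓘(ℝ, ℝ) (𝓡 2) (fun s => L.curve i (-s)) (-(-t)) := by
      rwa [neg_neg]
    have hc := mfderiv_comp (-t) h1' h3
    rw [h2] at hc
    apply L.immersed i (-t)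
    rw [hc]
    have h' : mfderiv 𝓘(ℝ, ℝ) (𝓡 2) (fun s => L.curve i (-s)) (-(-t)) = 0 := by
      rw [neg_neg]; exact h
    rw [h']
    exact ContinuousLinearMap.zero_comp _

/-- The union of two families of curves. -/
def union (L₁ L₂ : Curves F) : Curves F where
  ι := L₁.ι ⊕ L₂.ι
  curve := Sum.elim L₁.curve L₂.curve
  periodic i := by
    cases i
    · exact L₁.periodic _
    · exact L₂.periodic _
  smooth i := by cases i <;> simp [L₁.smooth, L₂.smooth]
  immersed i t := by
    cases i
    · exact L₁.immersed _ t
    · exact L₂.immersed _ t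

/-- The standing assumptions on a set of oriented immersed curves on a diagram: the curves intersect
themselves and each other transversely, in double points only; they miss the triple points and
the branch points of the diagram, and they cross its double point curves transversely. -/
structure IsOn (L : Curves F) (D : Diagram F) : Prop where
  transverse : ∀ p q : L.ι × ℝ, ¬ L.SameParam p q → ∀ (x : F) (v w : TangentSpace (𝓡 2) x),
    HasVelocityAt (L.curve p.1) p.2 x v → HasVelocityAt (L.curve q.1) q.2 x w →
    LinearIndependent ℝ ![v, w]
  double : ∀ p q r : L.ι × ℝ, L.point p = L.point q → L.point p = L.point r →
    L.SameParam p q ∨ L.SameParam p r ∨ L.SameParam q r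
  misses : ∀ x ∈ L.support, IsRegularPoint D.map x ∨ IsDoublePoint D.map x
  transverse_double : ∀ (p : L.ι × ℝ) (x : F) (v : TangentSpace (𝓡 2) x),
    HasVelocityAt (L.curve p.1) p.2 x v → ∀ x', IsDoublePair D.map x x' →
    (mfderiv (𝓡 2) (𝓡 3) D.map x v : E 3) ∉ tangentImage D.map x'

/-! ### Homologous families of curves -/

variable (F) in
/-- The singular simplicial set of the surface; `(sing F).chainComplex ℤ` is the singular chain
complex. -/
abbrev sing : SSet.{0} := TopCat.toSSet.obj (TopCat.of F)

/-- A closed curve, run through once, as a singular 1-simplex. -/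
def simplex (L : Curves F) (i : L.ι) : C(stdSimplex ℝ (Fin 2), F) where
  toFun y := L.curve i (y.1 1)
  continuous_toFun := (L.smooth i).continuous.comp ((continuous_apply 1).comp continuous_subtype_val)

/-- The singular 1-cycle with integer coefficients carried by a family of oriented closed curves.
Elements of an abelian group are written as homomorphisms from `ℤ` to it. -/
def cycle (L : Curves F) :
    ModuleCat.of ℤ ℤ ⟶ ((sing F).chainComplex (ModuleCat.of ℤ ℤ)).X 1 :=
  ∑ i, (sing F).ιChainComplex (n := 1)
    ((TopCat.toSSetObjEquiv (TopCat.of F) (.op (.mk 1))).symm (L.simplex i))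

open CategoryTheory in
/-- The families `L₁` and `L₂` are homologous: the difference of their singular 1-cycles is the
boundary of a singular 2-chain, so that they represent the same class in `H₁(F; ℤ)`. -/
def Homologous (L₁ L₂ : Curves F) : Prop :=
  ∃ c : ModuleCat.of ℤ ℤ ⟶ ((sing F).chainComplex (ModuleCat.of ℤ ℤ)).X 2,
    c ≫ ((sing F).chainComplex (ModuleCat.of ℤ ℤ)).d 2 1 = L₂.cycle - L₁.cycle

end Curves

/-! ### Sheets -/

section Sheets

variable (D : Diagram F) (L : Curves F)

/-- The surface cut open: the complement of the curves of `L` and of the lower preimages of the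
double point curves (with the branch points at their ends). -/
def cutSurface : Set F := (closure D.lowerDecker ∪ L.support)ᶜ

/-- The sheets of `(D, L)`: the connected components of the surface cut open. -/
def Sheet : Type := {S : Set F // ∃ x ∈ cutSurface D L, S = connectedComponentIn (cutSurface D L) x}

variable {D L}

/-- There is an arc of a double point curve along which `xⱼ` is the over-sheet and `xᵢ`, `xₖ` are
under-sheets, such that the normal direction of `xⱼ` points from `xᵢ` to `xₖ`. Here `a` is the
upper and `b` the lower preimage of a double point. -/
def MeetAtDoubleCurve (xi xj xk : Sheet D L) : Prop :=
  ∃ a b : F, IsDoublePair D.map a b ∧ D.height b < D.height a ∧ a ∈ xj.1 ∧ b ∉ L.support ∧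
    ∃ v : TangentSpace (𝓡 2) b, D.PointsAlongNormal a (mfderiv (𝓡 2) (𝓡 3) D.map b v : E 3) ∧
      IsEnteredAt xi.1 b (-v) ∧ IsEnteredAt xk.1 b v

/-- There is an arc of `L` with the sheets `xᵢ` and `xⱼ` on its sides, whose normal direction `n`
points from `xᵢ` to `xⱼ`; `n` is determined by: `(v, n)` is positive, where `v` is the orientation
of the curve. The point `x` of the arc is neither a multiple point of `L` nor on the lower
preimage of a double point curve. -/
def MeetAtCurve (xi xj : Sheet D L) : Prop :=
  ∃ (p : L.ι × ℝ) (x : F) (v n : TangentSpace (𝓡 2) x),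
    HasVelocityAt (L.curve p.1) p.2 x v ∧ (∀ q, L.point q = x → L.SameParam p q) ∧
    x ∉ closure D.lowerDecker ∧ D.orientation.IsPositive x v n ∧
    IsEnteredAt xi.1 x (-n) ∧ IsEnteredAt xj.1 x n

variable (D L)

/-- The set `Col_R(D, L)` of rack colorings of `(D, L)` with immersed curves. -/
structure Coloring (R : Type*) [Rack R] where
  color : Sheet D L → R
  double_curve : ∀ xi xj xk, MeetAtDoubleCurve xi xj xk →
    color xk = rackOp (color xi) (color xj)
  curve : ∀ xi xj, MeetAtCurve xi xj → color xj = kink R (color xi)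

variable {D L}

/-- An Alexander-type numbering of the sheets of `(D, L)`: it increases by `1` when a curve of `L` is
crossed in its normal direction, and it is the same on the two under-sheets along a double
point curve. -/
structure IsNumbering (N : Sheet D L → ℤ) : Prop where
  curve : ∀ xi xj, MeetAtCurve xi xj → N xj = N xi + 1
  double_curve : ∀ xi xj xk, MeetAtDoubleCurve xi xj xk → N xk = N xi

end Sheets

end Surface

end SurfaceKnot

end

open scoped Manifold ContDiff Topology Quandles

noncomputable section

namespace SurfaceKnot

/-! ### Continuous logarithms and winding numbers -/

/-! Crossing an arc of curves changes a color by a power of the kink map `ι`. If `N` counts the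
crossings with `L₂` minus those with `L₁` along a path from a base point, then replacing the color
`c` by `ι^N(c)` removes the jumps along `L₁` and creates those along `L₂`. Two things must be shown:
that `N` does not depend on the path, which is where homology enters, and that the new colors still
satisfy the relation at double point curves.

Path independence is proved with winding numbers instead of intersection theory. The variation of a
logarithm of a nowhere vanishing function is a singular 1-cocycle (`d_logCochain`), so homologous
families have equal total winding number under every continuous map to `ℂ \ {0}`
(`Curves.Homologous.deg_eq`). For points `y₀`, `y` off the curves, take a function `h` with one
simple zero at `y` and one simple pole at `y₀`, built by multiplying local dipoles `(z - a) / (z -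
b)` that are cut off to `1` outside a disk. The potential at `y` is the total winding number of `h`
along `(-L₁) ∪ L₂`. The quotient of two choices of `h` has order zero everywhere and agrees on the
curves with a nowhere vanishing continuous function, so this number is well defined
(`IsDipole.deg_eq`, `exists_potential`). Within a disk the potential changes by the winding number
of one dipole, the crossing number. It is `0` if the segment between the points misses the curves
and `1` across one simple arc in its normal direction
(`Curves.IsSimpleAt.eventually_crossing_eq_one`).

For colorings, `Coloring.color_sheetOf` shows that in a disk away from the lower decker set colors
change by `ι` to the crossing number. Multiple points are isolated and a punctured disk is
connected, so they impose no further condition. Hence `ι^N(c)` is well defined on sheets of the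
other family (`Coloring.kink_zpow_eq_of_mem`). The double point relation survives because `a *
ι^n(b) = a * b` and `ι^n(a) * b = ι^n(a * b)`, while `N` agrees on the two under-sheets. A meeting
point given for one family may lie on the other family, so it is first moved along the double point
curve (`MeetAtDoubleCurve.exists_common_points`). Transfer by `-N` is the inverse. -/

/-- A contraction run backwards is a homotopy in `ℂ \ {0}` from a constant map to `g`; it lifts
through the covering `exp`, starting at a constant logarithm. -/
theorem exists_log {A : Type*} [TopologicalSpace A] [ContractibleSpace A] (g : A → ℂ)
    (hg : Continuous g) (h0 : ∀ a, g a ≠ 0) :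
    ∃ H : A → ℂ, Continuous H ∧ ∀ a, Complex.exp (H a) = g a := by
  obtain ⟨a₀, ⟨ht⟩⟩ := id_nullhomotopic A
  let g' : C(A, {z : ℂ // z ≠ 0}) := ⟨fun a => ⟨g a, h0 a⟩, by fun_prop⟩
  let K : C(unitInterval × A, {z : ℂ // z ≠ 0}) := g'.comp ht.symm.toContinuousMap
  let f : C(A, ℂ) := .const A (Complex.log (g a₀))
  have hK : ∀ a, K (0, a) = ⟨Complex.exp (f a), Complex.exp_ne_zero _⟩ := by
    intro a
    apply Subtype.ext
    simp [K, f, g', Complex.exp_log (h0 a₀)]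
  refine ⟨fun a => Complex.isCoveringMap_exp.liftHomotopy K f hK (1, a), by fun_prop, fun a => ?_⟩
  have := congrFun (Complex.isCoveringMap_exp.liftHomotopy_lifts K f hK) (1, a)
  have h2 := congrArg Subtype.val this
  simpa [K, g'] using h2

/-- The difference of two logarithms of the same function, divided by `2πi`, is continuous with
values in a discrete set, hence constant on a connected set. -/
theorem log_sub_const {A : Type*} [TopologicalSpace A] {S : Set A} (hS : IsPreconnected S)
    {H H' : A → ℂ} (hc : ContinuousOn H S) (hc' : ContinuousOn H' S)
    (he : ∀ a ∈ S, Complex.exp (H a) = Complex.exp (H' a)) {a b : A} (ha : a ∈ S) (hb : b ∈ S) :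
    H a - H' a = H b - H' b := by
  have hexp : ∀ a ∈ S, ∃ n : ℤ, H a - H' a = n * (2 * Real.pi * Complex.I) := by
    intro a ha
    obtain ⟨n, hn⟩ := Complex.exp_eq_exp_iff_exists_int.1 (he a ha)
    exact ⟨n, by rw [hn]; ring⟩
  have hpi : (2 * Real.pi * Complex.I : ℂ) ≠ 0 := Complex.two_pi_I_ne_zero
  let r : A → ℝ := fun a => ((H a - H' a) / (2 * Real.pi * Complex.I)).re
  have hr : ContinuousOn r S :=
    Complex.continuous_re.comp_continuousOn ((hc.sub hc').div_const _)
  have key : ∀ a ∈ S, ∃ n : ℤ, r a = n := by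
    intro a ha
    obtain ⟨n, hn⟩ := hexp a ha
    refine ⟨n, ?_⟩
    simp only [r, hn]
    rw [mul_div_cancel_right₀ _ hpi]
    simp
  have hconst : r a = r b := by
    have : ContinuousOn r S ∧ Set.MapsTo r S (Set.range ((↑) : ℤ → ℝ)) :=
      ⟨hr, fun a ha => by obtain ⟨n, hn⟩ := key a ha; exact ⟨n, hn.symm⟩⟩
    exact hS.constant_of_mapsTo (Int.isClosedEmbedding_coe_real.isEmbedding.isDiscrete_range) this.1 this.2 ha hb
  obtain ⟨n, hn⟩ := hexp a ha
  obtain ⟨k, hk⟩ := hexp b hb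
  simp only [r, hn, hk, mul_div_cancel_right₀ _ hpi, Complex.intCast_re] at hconst
  rw [hn, hk]
  have : n = k := by exact_mod_cast hconst
  rw [this]

/-- `n` is the winding number around `0` of the restriction of `γ` to the unit interval. -/
def HasWinding (γ : ℝ → ℂ) (n : ℤ) : Prop :=
  ∃ H : ℝ → ℂ, Continuous H ∧ (∀ t, Complex.exp (H t) = γ t) ∧
    ∀ t, H (t + 1) - H t = n * (2 * Real.pi * Complex.I)

theorem exists_hasWinding {γ : ℝ → ℂ} (hγ : Continuous γ) (hp : Function.Periodic γ 1)
    (h0 : ∀ t, γ t ≠ 0) : ∃ n, HasWinding γ n := by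
  obtain ⟨H, hH, he⟩ := exists_log γ hγ h0
  have h1 : Complex.exp (H 1) = Complex.exp (H 0) := by
    rw [he, he]; simpa using hp 0
  obtain ⟨n, hn⟩ := Complex.exp_eq_exp_iff_exists_int.1 h1
  refine ⟨n, H, hH, he, fun t => ?_⟩
  have := log_sub_const (isPreconnected_univ (α := ℝ)) (H := fun t => H (t + 1)) (H' := H)
    (by fun_prop) (by fun_prop) (fun a _ => by rw [he, he, hp]) (Set.mem_univ t) (Set.mem_univ 0)
  simp only [zero_add] at this
  rw [this, hn]; ring

theorem HasWinding.unique {γ : ℝ → ℂ} {n k : ℤ} (h : HasWinding γ n) (h' : HasWinding γ k) :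
    n = k := by
  obtain ⟨H, hH, he, hn⟩ := h
  obtain ⟨H', hH', he', hk⟩ := h'
  have := log_sub_const (isPreconnected_univ (α := ℝ)) (H := H) (H' := H')
    (by fun_prop) (by fun_prop) (fun a _ => by rw [he, he']) (Set.mem_univ 1) (Set.mem_univ 0)
  have h1 := hn 0
  have h2 := hk 0
  simp only [zero_add] at h1 h2
  have h3 : (n : ℂ) * (2 * Real.pi * Complex.I) = k * (2 * Real.pi * Complex.I) := by
    rw [← h1, ← h2]; linear_combination this
  exact_mod_cast mul_right_cancel₀ Complex.two_pi_I_ne_zero h3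

theorem HasWinding.mul {γ δ : ℝ → ℂ} {n k : ℤ} (h : HasWinding γ n) (h' : HasWinding δ k) :
    HasWinding (fun t => γ t * δ t) (n + k) := by
  obtain ⟨H, hH, he, hn⟩ := h
  obtain ⟨H', hH', he', hk⟩ := h'
  refine ⟨fun t => H t + H' t, by fun_prop, fun t => by rw [Complex.exp_add, he, he'], fun t => ?_⟩
  push_cast
  linear_combination hn t + hk t

theorem HasWinding.inv {γ : ℝ → ℂ} {n : ℤ} (h : HasWinding γ n) :
    HasWinding (fun t => (γ t)⁻¹) (-n) := by
  obtain ⟨H, hH, he, hn⟩ := h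
  refine ⟨fun t => - H t, by fun_prop, fun t => by rw [Complex.exp_neg, he], fun t => ?_⟩
  push_cast
  linear_combination - hn t

theorem HasWinding.comp_neg {γ : ℝ → ℂ} {n : ℤ} (h : HasWinding γ n) :
    HasWinding (fun t => γ (-t)) (-n) := by
  obtain ⟨H, hH, he, hn⟩ := h
  refine ⟨fun t => H (-t), by fun_prop, fun t => by rw [he], fun t => ?_⟩
  have := hn (-(t + 1))
  simp only [neg_add_rev, neg_add_cancel_comm] at this
  simp only [neg_add_rev]
  push_cast
  linear_combination - this

/-- The winding number around `0` of a closed curve (and `0` if there is none). -/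
def winding (γ : ℝ → ℂ) : ℤ := by
  classical exact if h : ∃ n, HasWinding γ n then h.choose else 0

theorem HasWinding.winding_eq {γ : ℝ → ℂ} {n : ℤ} (h : HasWinding γ n) : winding γ = n := by
  have h' : ∃ n, HasWinding γ n := ⟨n, h⟩
  rw [winding, dif_pos h']
  exact h'.choose_spec.unique h

/-! ### Homologous families have the same total winding number -/

open CategoryTheory

/-- The variation of the logarithm of a function along a singular 1-simplex. -/
def logVariation {F : Type} [TopologicalSpace F] (m : F → ℂ)
    (σ : C(stdSimplex ℝ (Fin 2), F)) : ℂ := by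
  classical exact
    if h : ∃ H : stdSimplex ℝ (Fin 2) → ℂ, Continuous H ∧ ∀ a, Complex.exp (H a) = m (σ a) then
      h.choose (stdSimplex.vertex 1) - h.choose (stdSimplex.vertex 0) else 0

instance contractibleSpace_stdSimplex (n : ℕ) : ContractibleSpace (stdSimplex ℝ (Fin (n + 1))) :=
  (convex_stdSimplex ℝ _).contractibleSpace ⟨_, single_mem_stdSimplex ℝ 0⟩

theorem logVariation_eq {F : Type} [TopologicalSpace F] {m : F → ℂ}
    {σ : C(stdSimplex ℝ (Fin 2), F)} {H : stdSimplex ℝ (Fin 2) → ℂ} (hH : Continuous H)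
    (he : ∀ a, Complex.exp (H a) = m (σ a)) :
    logVariation m σ = H (stdSimplex.vertex 1) - H (stdSimplex.vertex 0) := by
  have h : ∃ H : stdSimplex ℝ (Fin 2) → ℂ, Continuous H ∧ ∀ a, Complex.exp (H a) = m (σ a) :=
    ⟨H, hH, he⟩
  rw [logVariation, dif_pos h]
  have := log_sub_const (isPreconnected_univ (α := stdSimplex ℝ (Fin 2))) (H := h.choose) (H' := H)
    h.choose_spec.1.continuousOn (by fun_prop) (fun a _ => by rw [h.choose_spec.2, he])
    (Set.mem_univ (stdSimplex.vertex 1)) (Set.mem_univ (stdSimplex.vertex 0))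
  linear_combination this

/-- The 1-cochain `logVariation`. -/
def logCochain {F : Type} [TopologicalSpace F] (m : F → ℂ) :
    ((Curves.sing F).chainComplex (ModuleCat.of ℤ ℤ)).X 1 ⟶ ModuleCat.of ℤ ℂ :=
  Limits.Sigma.desc (fun σ => ModuleCat.ofHom (LinearMap.toSpanSingleton ℤ ℂ
    (logVariation m (TopCat.toSSetObjEquiv (TopCat.of F) _ σ))))

theorem ι_logCochain {F : Type} [TopologicalSpace F] (m : F → ℂ)
    (σ : (Curves.sing F).obj (.op (.mk 1))) :
    (Curves.sing F).ιChainComplex (n := 1) σ ≫ logCochain m =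
      ModuleCat.ofHom (LinearMap.toSpanSingleton ℤ ℂ
        (logVariation m (TopCat.toSSetObjEquiv (TopCat.of F) _ σ))) := by
  unfold SSet.ιChainComplex logCochain
  exact Limits.Sigma.ι_desc _ _

/-- A 2-simplex is contractible, so one logarithm serves all three faces, and its variations along
them cancel in the alternating sum. -/
theorem d_logCochain {F : Type} [TopologicalSpace F] {m : F → ℂ} (hm : Continuous m)
    (h0 : ∀ x, m x ≠ 0) :
    ((Curves.sing F).chainComplex (ModuleCat.of ℤ ℤ)).d 2 1 ≫ logCochain m = 0 := by
  apply SSet.chainComplex_hom_ext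
  intro σ
  rw [SSet.ιChainComplex_d_assoc]
  obtain ⟨H, hH, he⟩ := exists_log (fun y => m (TopCat.toSSetObjEquiv (TopCat.of F) _ σ y))
    (hm.comp (TopCat.toSSetObjEquiv (TopCat.of F) _ σ).continuous) (fun _ => h0 _)
  have hv : ∀ i : Fin 3, logVariation m (TopCat.toSSetObjEquiv (TopCat.of F) _
      ((Curves.sing F).δ i σ)) =
      H (stdSimplex.vertex (i.succAbove 1)) - H (stdSimplex.vertex (i.succAbove 0)) := by
    intro i
    rw [logVariation_eq (H := fun z => H (stdSimplex.map i.succAbove z))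
      (hH.comp (stdSimplex.continuous_map _)) (fun a => he _)]
    simp
  simp only [Preadditive.sum_comp, Preadditive.zsmul_comp, ι_logCochain, Limits.comp_zero]
  ext
  simp [hv, Fin.sum_univ_succ]

namespace Curves

variable {F : Type} [TopologicalSpace F] [ChartedSpace (E 2) F]

/-- The total winding number around `0` of the image of a family of closed curves. -/
def deg (L : Curves F) (m : F → ℂ) : ℤ := ∑ i, winding (fun t => m (L.curve i t))

/-- The function is continuous and does not vanish at the points of the curves. -/
def Admissible (L : Curves F) (m : F → ℂ) : Prop :=
  ∀ x ∈ L.support, ContinuousAt m x ∧ m x ≠ 0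

theorem curve_mem_support (L : Curves F) (i : L.ι) (t : ℝ) : L.curve i t ∈ L.support :=
  Set.mem_iUnion.2 ⟨i, t, rfl⟩

theorem continuous_curve (L : Curves F) (i : L.ι) : Continuous (L.curve i) :=
  (L.smooth i).continuous

theorem Admissible.continuous_comp {L : Curves F} {m : F → ℂ} (h : L.Admissible m) (i : L.ι) :
    Continuous (fun t => m (L.curve i t)) :=
  continuous_iff_continuousAt.2 fun t =>
    (h _ (L.curve_mem_support i t)).1.comp (L.continuous_curve i).continuousAt

theorem Admissible.hasWinding {L : Curves F} {m : F → ℂ} (h : L.Admissible m) (i : L.ι) :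
    HasWinding (fun t => m (L.curve i t)) (winding (fun t => m (L.curve i t))) := by
  obtain ⟨n, hn⟩ := exists_hasWinding (h.continuous_comp i)
    (fun t => by simp only [L.periodic i t]) (fun t => (h _ (L.curve_mem_support i t)).2)
  rwa [hn.winding_eq]

theorem Admissible.mul {L : Curves F} {m m' : F → ℂ} (h : L.Admissible m) (h' : L.Admissible m') :
    L.Admissible (fun x => m x * m' x) :=
  fun x hx => ⟨(h x hx).1.mul (h' x hx).1, mul_ne_zero (h x hx).2 (h' x hx).2⟩

theorem Admissible.inv {L : Curves F} {m : F → ℂ} (h : L.Admissible m) :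
    L.Admissible (fun x => (m x)⁻¹) :=
  fun x hx => ⟨(h x hx).1.inv₀ (h x hx).2, inv_ne_zero (h x hx).2⟩

theorem deg_mul {L : Curves F} {m m' : F → ℂ} (h : L.Admissible m) (h' : L.Admissible m') :
    L.deg (fun x => m x * m' x) = L.deg m + L.deg m' := by
  rw [deg, deg, deg, ← Finset.sum_add_distrib]
  exact Finset.sum_congr rfl fun i _ => ((h.hasWinding i).mul (h'.hasWinding i)).winding_eq

theorem deg_inv {L : Curves F} {m : F → ℂ} (h : L.Admissible m) :
    L.deg (fun x => (m x)⁻¹) = - L.deg m := by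
  rw [deg, deg, ← Finset.sum_neg_distrib]
  exact Finset.sum_congr rfl fun i _ => (h.hasWinding i).inv.winding_eq

theorem deg_congr {L : Curves F} {m m' : F → ℂ} (h : ∀ x ∈ L.support, m x = m' x) :
    L.deg m = L.deg m' :=
  Finset.sum_congr rfl fun i _ => by
    congr 1; ext t; exact h _ (L.curve_mem_support i t)

/-- A logarithm defined on the surface takes the same value at the start and at the end of a closed
curve. -/
theorem deg_eq_zero_of_log {L : Curves F} {m v : F → ℂ}
    (hv : ∀ x ∈ L.support, ContinuousAt v x ∧ Complex.exp (v x) = m x) : L.deg m = 0 := by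
  refine Finset.sum_eq_zero fun i _ => HasWinding.winding_eq ⟨fun t => v (L.curve i t),
    continuous_iff_continuousAt.2 fun t => ?_, fun t => (hv _ (L.curve_mem_support i t)).2,
    fun t => ?_⟩
  · exact (hv _ (L.curve_mem_support i t)).1.comp (L.continuous_curve i).continuousAt
  · simp [L.periodic i t]

@[simp] theorem support_reverse (L : Curves F) : L.reverse.support = L.support := by
  ext x
  simp only [support, Set.mem_iUnion, Set.mem_range, reverse]
  exact exists_congr fun i => ⟨fun ⟨t, ht⟩ => ⟨-t, ht⟩, fun ⟨t, ht⟩ => ⟨-t, by rwa [neg_neg]⟩⟩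

@[simp] theorem support_union (L₁ L₂ : Curves F) :
    (L₁.union L₂).support = L₁.support ∪ L₂.support := by
  ext x
  simp only [support, Set.mem_iUnion, Set.mem_range, Set.mem_union, union]
  exact Sum.exists

theorem deg_reverse {L : Curves F} {m : F → ℂ} (h : L.Admissible m) :
    L.reverse.deg m = - L.deg m := by
  rw [deg, deg, ← Finset.sum_neg_distrib]
  exact Finset.sum_congr rfl fun i _ => (h.hasWinding i).comp_neg.winding_eq

theorem deg_union (L₁ L₂ : Curves F) (m : F → ℂ) :
    (L₁.union L₂).deg m = L₁.deg m + L₂.deg m :=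
  Fintype.sum_sum_type _

theorem cycle_logCochain (L : Curves F) {m : F → ℂ} (h : L.Admissible m) :
    L.cycle ≫ logCochain m = ModuleCat.ofHom (LinearMap.toSpanSingleton ℤ ℂ
      (L.deg m * (2 * Real.pi * Complex.I))) := by
  rw [cycle, Preadditive.sum_comp]
  simp only [ι_logCochain, Equiv.apply_symm_apply]
  have : ∀ i, logVariation m (L.simplex i) =
      winding (fun t => m (L.curve i t)) * (2 * Real.pi * Complex.I) := by
    intro i
    obtain ⟨H, hH, he, hn⟩ := h.hasWinding i
    -- The second barycentric coordinate is the curve parameter, so the vertices of the simplex are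
    -- the times `0` and `1`.
    rw [logVariation_eq (H := fun y => H (y.1 1))
      (hH.comp ((continuous_apply 1).comp continuous_subtype_val)) (fun a => he _), ← hn 0]
    simp
  simp only [this, deg]
  ext
  simp [Finset.sum_mul]

/-- Homologous families of closed curves have the same image in the homology of `ℂ \ {0}` under
every map. -/
theorem Homologous.deg_eq {L₁ L₂ : Curves F} (h : L₁.Homologous L₂) {m : F → ℂ}
    (hm : Continuous m) (h0 : ∀ x, m x ≠ 0) : L₁.deg m = L₂.deg m := by
  obtain ⟨c, hc⟩ := h
  have h1 : (L₂.cycle - L₁.cycle) ≫ logCochain m = 0 := by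
    rw [← hc, Category.assoc, d_logCochain hm h0, Limits.comp_zero]
  rw [Preadditive.sub_comp, cycle_logCochain _ fun x _ => ⟨hm.continuousAt, h0 x⟩,
    cycle_logCochain _ fun x _ => ⟨hm.continuousAt, h0 x⟩] at h1
  have h2 := congrArg (fun f => f.hom (1 : ℤ)) h1
  simp [sub_eq_zero] at h2
  exact h2.symm

end Curves

/-! ### Dipole functions -/

/-- A cutoff function, equal to `1` on the disk of radius `r` and to `0` off the disk of
radius `2 * r`. -/
def cutoff (r : ℝ) (z : ℂ) : ℝ := min 1 (max 0 (2 - ‖z‖ / r))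

/-- A function that is `(z - a) / (z - b)` on the disk of radius `r` and `1` off the disk of
radius `2 * r`. -/
def dip (r : ℝ) (a b z : ℂ) : ℂ :=
  if ‖z‖ < r then (z - a) / (z - b) else
    Complex.exp (cutoff r z * (Complex.log (1 - a / z) - Complex.log (1 - b / z)))

theorem one_sub_div_re_pos {a z : ℂ} (h : ‖a‖ < ‖z‖) : 0 < (1 - a / z).re := by
  have hz : 0 < ‖z‖ := (norm_nonneg a).trans_lt h
  have h1 : ‖a / z‖ < 1 := by rw [norm_div, div_lt_one hz]; exact h
  have h2 := Complex.re_le_norm (a / z)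
  simp only [Complex.sub_re, Complex.one_re]
  linarith

theorem one_sub_div_mem_slitPlane {a z : ℂ} (h : ‖a‖ < ‖z‖) : 1 - a / z ∈ Complex.slitPlane :=
  Or.inl (one_sub_div_re_pos h)

theorem cutoff_eq_one {r : ℝ} (hr : 0 < r) {z : ℂ} (h : ‖z‖ ≤ r) : cutoff r z = 1 := by
  have : ‖z‖ / r ≤ 1 := (div_le_one hr).2 h
  rw [cutoff, min_eq_left]
  exact le_max_of_le_right (by linarith)

theorem cutoff_eq_zero {r : ℝ} (hr : 0 < r) {z : ℂ} (h : 2 * r ≤ ‖z‖) : cutoff r z = 0 := by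
  have : 2 ≤ ‖z‖ / r := (le_div_iff₀ hr).2 h
  rw [cutoff, max_eq_left (by linarith), min_eq_right zero_le_one]

theorem cutoff_nonneg (r : ℝ) (z : ℂ) : 0 ≤ cutoff r z := le_min zero_le_one (le_max_left _ _)

theorem cutoff_le_one (r : ℝ) (z : ℂ) : cutoff r z ≤ 1 := min_le_left _ _

theorem continuous_cutoff (r : ℝ) : Continuous (cutoff r) := by
  unfold cutoff; fun_prop

variable {r : ℝ} {a b c z : ℂ}

/-- The two formulas in `dip` agree where both make sense: there the cutoff is `1`, and `(z - a) /
(z - b)` equals `(1 - a / z) / (1 - b / z)`, whose factors have positive real part and hence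
principal logarithms. -/
theorem dip_eq_exp (hr : 0 < r) (ha : ‖a‖ < ‖z‖) (hb : ‖b‖ < ‖z‖) : dip r a b z =
    Complex.exp (cutoff r z * (Complex.log (1 - a / z) - Complex.log (1 - b / z))) := by
  rw [dip]
  split_ifs with h
  · have hz : z ≠ 0 := norm_pos_iff.1 ((norm_nonneg a).trans_lt ha)
    rw [cutoff_eq_one hr h.le, Complex.ofReal_one, one_mul, Complex.exp_sub,
      Complex.exp_log (Complex.slitPlane_ne_zero (one_sub_div_mem_slitPlane ha)),
      Complex.exp_log (Complex.slitPlane_ne_zero (one_sub_div_mem_slitPlane hb))]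
    field_simp
  · rfl

theorem continuousAt_dip (hr : 0 < r) (ha : ‖a‖ < r) (hb : ‖b‖ < r) (hz : z ≠ b) :
    ContinuousAt (dip r a b) z := by
  rcases lt_or_ge ‖z‖ r with h | h
  · have : ∀ᶠ w in 𝓝 z, dip r a b w = (w - a) / (w - b) := by
      filter_upwards [continuous_norm.continuousAt.eventually_lt continuousAt_const h] with w hw
      rw [dip, if_pos hw]
    refine ContinuousAt.congr ?_ (this.mono fun _ h => h.symm)
    exact ContinuousAt.div (by fun_prop) (by fun_prop) (sub_ne_zero.2 hz)
  · have ha' := ha.trans_le h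
    have hb' := hb.trans_le h
    have : ∀ᶠ w in 𝓝 z, dip r a b w =
        Complex.exp (cutoff r w * (Complex.log (1 - a / w) - Complex.log (1 - b / w))) := by
      filter_upwards [continuousAt_const.eventually_lt continuous_norm.continuousAt ha',
        continuousAt_const.eventually_lt continuous_norm.continuousAt hb'] with w hw hw'
      exact dip_eq_exp hr hw hw'
    refine ContinuousAt.congr ?_ (this.mono fun _ h => h.symm)
    have hz0 : z ≠ 0 := norm_pos_iff.1 ((norm_nonneg a).trans_lt ha')
    have h1 := one_sub_div_mem_slitPlane ha'
    have h2 := one_sub_div_mem_slitPlane hb'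
    have hc := (continuous_cutoff r).continuousAt (x := z)
    fun_prop (disch := assumption)

theorem dip_ne_zero (h1 : z ≠ a) (h2 : z ≠ b) : dip r a b z ≠ 0 := by
  rw [dip]
  split_ifs
  · exact div_ne_zero (sub_ne_zero.2 h1) (sub_ne_zero.2 h2)
  · exact Complex.exp_ne_zero _

theorem dip_eq_one (hr : 0 < r) (h : 2 * r ≤ ‖z‖) : dip r a b z = 1 := by
  rw [dip, if_neg (by linarith), cutoff_eq_zero hr h]
  simp

theorem dip_mul_dip (hz : z ≠ b) : dip r a b z * dip r b c z = dip r a c z := by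
  unfold dip
  split_ifs
  · exact div_mul_div_cancel₀ (sub_ne_zero.2 hz)
  · rw [← Complex.exp_add]; congr 1; ring

/-- Inside the disk a nonpositive value of `(z - a) / (z - b)` puts `z` on the segment. Outside, the
argument is at most the difference of two angles of absolute value less than `π / 2`. -/
theorem dip_mem_slitPlane (ha : ‖a‖ < r) (hb : ‖b‖ < r) (hz : z ∉ segment ℝ a b) :
    dip r a b z ∈ Complex.slitPlane := by
  rw [dip]
  split_ifs with h
  · have hzb : z - b ≠ 0 := sub_ne_zero.2 fun h => hz (h ▸ right_mem_segment ℝ a b)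
    by_contra hn
    rw [Complex.mem_slitPlane_iff, not_or, not_lt, not_not] at hn
    obtain ⟨s, hs⟩ : ∃ s : ℝ, (z - a) / (z - b) = s :=
      ⟨((z - a) / (z - b)).re, Complex.ext (by simp) (by simp [hn.2])⟩
    have hs0 : s ≤ 0 := by have := hn.1; rwa [hs, Complex.ofReal_re] at this
    apply hz
    have h1 : (1 : ℝ) - s ≠ 0 := by linarith
    have h1' : (1 : ℂ) - s ≠ 0 := by exact_mod_cast h1
    -- Solving `z - a = s (z - b)` for `z` gives these barycentric coordinates, nonnegative since `s
    -- ≤ 0`.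
    refine ⟨1 / (1 - s), -s / (1 - s), by apply div_nonneg <;> linarith,
      by apply div_nonneg <;> linarith, by field_simp; ring, ?_⟩
    rw [div_eq_iff hzb] at hs
    simp only [Complex.real_smul]
    push_cast
    field_simp
    linear_combination -hs
  · push Not at h
    have h1 := Complex.abs_arg_lt_pi_div_two_iff.2 (Or.inl (one_sub_div_re_pos (ha.trans_le h)))
    have h2 := Complex.abs_arg_lt_pi_div_two_iff.2 (Or.inl (one_sub_div_re_pos (hb.trans_le h)))
    rw [Complex.mem_slitPlane_iff_arg]
    refine ⟨?_, Complex.exp_ne_zero _⟩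
    have him : ((cutoff r z : ℂ) * (Complex.log (1 - a / z) - Complex.log (1 - b / z))).im =
        cutoff r z * ((1 - a / z).arg - (1 - b / z).arg) := by
      simp [Complex.log_im]
    have hlt : |cutoff r z * ((1 - a / z).arg - (1 - b / z).arg)| < Real.pi := by
      rw [abs_mul, abs_of_nonneg (cutoff_nonneg r z)]
      have h3 : |(1 - a / z).arg - (1 - b / z).arg| < Real.pi := by
        rw [abs_lt] at *
        constructor <;> linarith
      calc _ ≤ 1 * |(1 - a / z).arg - (1 - b / z).arg| :=
            mul_le_mul_of_nonneg_right (cutoff_le_one r z) (abs_nonneg _)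
        _ < _ := by rwa [one_mul]
    rw [← him, abs_lt] at hlt
    have := Complex.log_exp hlt.1 hlt.2.le
    intro hpi
    rw [← Complex.log_im, this] at hpi
    linarith

/-! ### Disks on a surface -/

/-- A closed disk of radius `2 * radius` in the domain of a chart. -/
structure Disk (F : Type*) [TopologicalSpace F] where
  chart : OpenPartialHomeomorph F ℂ
  center : ℂ
  radius : ℝ
  radius_pos : 0 < radius
  subset : Metric.closedBall center (2 * radius) ⊆ chart.target

namespace Disk

variable {F : Type*} [TopologicalSpace F] (e : Disk F)

/-- The coordinate of a disk, centered at `0`. -/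
def coord (p : F) : ℂ := e.chart p - e.center

/-- The open concentric disk of half the radius. -/
def inner : Set F := {p | p ∈ e.chart.source ∧ ‖e.coord p‖ < e.radius}

/-- A function on the surface with a zero at `p` and a pole at `q`, equal to `1` off the disk. -/
def dipole (p q x : F) : ℂ := by
  classical exact if x ∈ e.chart.source then dip e.radius (e.coord p) (e.coord q) (e.coord x) else 1

theorem dipole_of_mem {x : F} (p q : F) (hx : x ∈ e.chart.source) :
    e.dipole p q x = dip e.radius (e.coord p) (e.coord q) (e.coord x) := if_pos hx

theorem dipole_of_notMem {x : F} (p q : F) (hx : x ∉ e.chart.source) :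
    e.dipole p q x = 1 := if_neg hx

theorem continuousAt_coord {x : F} (hx : x ∈ e.chart.source) : ContinuousAt e.coord x :=
  (e.chart.continuousAt hx).sub continuousAt_const

theorem coord_injOn : Set.InjOn e.coord e.chart.source := fun _ hx _ hy h =>
  e.chart.injOn hx hy (sub_left_injective h)

theorem isOpen_inner : IsOpen e.inner := by
  have : e.inner = e.chart.source ∩ e.chart ⁻¹' Metric.ball e.center e.radius := by
    ext p; simp [inner, coord, dist_eq_norm]
  rw [this]
  exact e.chart.isOpen_inter_preimage Metric.isOpen_ball

theorem isPreconnected_inner : IsPreconnected e.inner := by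
  have : e.inner = e.chart.symm '' Metric.ball e.center e.radius := by
    have hs : Metric.ball e.center e.radius ⊆ e.chart.target :=
      (Metric.ball_subset_closedBall.trans (Metric.closedBall_subset_closedBall
        (by linarith [e.radius_pos]))).trans e.subset
    ext p
    constructor
    · rintro ⟨hp, h⟩
      exact ⟨e.chart p, by simpa [dist_eq_norm, coord] using h, e.chart.left_inv hp⟩
    · rintro ⟨z, hz, rfl⟩
      refine ⟨e.chart.map_target (hs hz), ?_⟩
      rw [coord, e.chart.right_inv (hs hz)]
      simpa [dist_eq_norm] using hz
  rw [this]
  refine (convex_ball _ _).isPreconnected.image _ (e.chart.continuousOn_symm.mono ?_)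
  exact (Metric.ball_subset_closedBall.trans (Metric.closedBall_subset_closedBall
        (by linarith [e.radius_pos]))).trans e.subset

/-- Continuity at points outside the chart domain: the dipole differs from `1` only on the image of
a closed ball, which is compact and so closed in the surface. -/
theorem eventually_dipole_eq_one [T2Space F] {x : F} (hx : x ∉ e.chart.source) (p q : F) :
    ∀ᶠ y in 𝓝 x, e.dipole p q y = 1 := by
  have hK : IsCompact (e.chart.symm '' Metric.closedBall e.center (2 * e.radius)) :=
    (isCompact_closedBall _ _).image_of_continuousOn (e.chart.continuousOn_symm.mono e.subset)
  have hxK : x ∉ e.chart.symm '' Metric.closedBall e.center (2 * e.radius) := by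
    rintro ⟨z, hz, rfl⟩
    exact hx (e.chart.map_target (e.subset hz))
  filter_upwards [hK.isClosed.isOpen_compl.mem_nhds hxK] with y hy
  by_cases hys : y ∈ e.chart.source
  · rw [e.dipole_of_mem _ _ hys]
    apply dip_eq_one e.radius_pos
    by_contra! h
    exact hy ⟨e.chart y, by simpa [dist_eq_norm, coord] using h.le, e.chart.left_inv hys⟩
  · exact e.dipole_of_notMem _ _ hys

variable {e} {p q x : F}

theorem continuousAt_dipole [T2Space F] (hp : p ∈ e.inner) (hq : q ∈ e.inner) (hx : x ≠ q) :
    ContinuousAt (e.dipole p q) x := by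
  by_cases hs : x ∈ e.chart.source
  · have h1 : ∀ᶠ y in 𝓝 x, e.dipole p q y =
        dip e.radius (e.coord p) (e.coord q) (e.coord y) := by
      filter_upwards [e.chart.open_source.mem_nhds hs] with y hy
      exact e.dipole_of_mem _ _ hy
    refine ContinuousAt.congr ?_ (h1.mono fun _ h => h.symm)
    exact (continuousAt_dip e.radius_pos hp.2 hq.2 fun h => hx (e.coord_injOn hs hq.1 h)).comp
      (f := e.coord) (e.continuousAt_coord hs)
  · exact continuousAt_const.congr ((e.eventually_dipole_eq_one hs p q).mono fun _ h => h.symm)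

theorem dipole_ne_zero (hp : p ∈ e.inner) (hq : q ∈ e.inner) (hxp : x ≠ p) (hxq : x ≠ q) :
    e.dipole p q x ≠ 0 := by
  by_cases hs : x ∈ e.chart.source
  · rw [e.dipole_of_mem _ _ hs]
    exact dip_ne_zero (fun h => hxp (e.coord_injOn hs hp.1 h))
      (fun h => hxq (e.coord_injOn hs hq.1 h))
  · rw [e.dipole_of_notMem _ _ hs]; exact one_ne_zero

theorem dipole_mul_dipole {q' : F} (hq : q ∈ e.inner) (hxq : x ≠ q) :
    e.dipole p q x * e.dipole q q' x = e.dipole p q' x := by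
  by_cases hs : x ∈ e.chart.source
  · rw [e.dipole_of_mem _ _ hs, e.dipole_of_mem _ _ hs, e.dipole_of_mem _ _ hs]
    exact dip_mul_dip fun h => hxq (e.coord_injOn hs hq.1 h)
  · simp [e.dipole_of_notMem _ _ hs]

theorem dipole_mem_slitPlane (hp : p ∈ e.inner) (hq : q ∈ e.inner)
    (hx : x ∈ e.chart.source → e.coord x ∉ segment ℝ (e.coord p) (e.coord q)) :
    e.dipole p q x ∈ Complex.slitPlane := by
  by_cases hs : x ∈ e.chart.source
  · rw [e.dipole_of_mem _ _ hs]
    exact dip_mem_slitPlane hp.2 hq.2 (hx hs)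
  · rw [e.dipole_of_notMem _ _ hs]; exact Complex.one_mem_slitPlane

end Disk

/-! ### Crossing numbers in a disk -/

section Crossing

variable {F : Type} [TopologicalSpace F] [ChartedSpace (E 2) F] [T2Space F]
  {e : Disk F} {L : Curves F} {p q : F}

theorem Disk.admissible_dipole (hp : p ∈ e.inner) (hq : q ∈ e.inner) (hpL : p ∉ L.support)
    (hqL : q ∉ L.support) : L.Admissible (e.dipole p q) := fun _ hx =>
  ⟨continuousAt_dipole hp hq fun h => hqL (h ▸ hx),
    dipole_ne_zero hp hq (fun h => hpL (h ▸ hx)) fun h => hqL (h ▸ hx)⟩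

/-- The algebraic number of times one crosses `L`, in the normal direction, going from `p` to `q`
in a disk. -/
def Curves.crossing (L : Curves F) (e : Disk F) (p q : F) : ℤ := L.deg (e.dipole q p)

theorem Curves.crossing_add {q' : F} (hp : p ∈ e.inner) (hq : q ∈ e.inner) (hq' : q' ∈ e.inner)
    (hpL : p ∉ L.support) (hqL : q ∉ L.support) (hqL' : q' ∉ L.support) :
    L.crossing e p q + L.crossing e q q' = L.crossing e p q' := by
  rw [crossing, crossing, crossing, add_comm, ← deg_mul (Disk.admissible_dipole hq' hq hqL' hqL)
    (Disk.admissible_dipole hq hp hqL hpL)]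
  exact deg_congr fun x hx => Disk.dipole_mul_dipole hq fun h => hqL (h ▸ hx)

/-- Off the segment joining its zero and its pole the dipole stays in the slit plane, so the
principal logarithm is a continuous logarithm along the curves. -/
theorem Curves.crossing_eq_zero (hp : p ∈ e.inner) (hq : q ∈ e.inner)
    (h : ∀ x ∈ L.support, x ∈ e.chart.source → e.coord x ∉ segment ℝ (e.coord p) (e.coord q)) :
    L.crossing e p q = 0 := by
  refine deg_eq_zero_of_log (v := fun x => Complex.log (e.dipole q p x)) fun x hx => ?_
  have h1 : e.dipole q p x ∈ Complex.slitPlane :=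
    Disk.dipole_mem_slitPlane hq hp fun hs => by rw [segment_symm]; exact h x hx hs
  refine ⟨(Disk.continuousAt_dipole hq hp ?_).clog h1, Complex.exp_log
    (Complex.slitPlane_ne_zero h1)⟩
  rintro rfl
  exact h x hx hp.1 (left_mem_segment ℝ _ _)

theorem Curves.crossing_self (hp : p ∈ e.inner) (hpL : p ∉ L.support) : L.crossing e p p = 0 := by
  have := crossing_add (L := L) hp hp hp hpL hpL hpL
  linarith

end Crossing

/-! ### Complex coordinates -/

/-- The identification of the Euclidean plane with the complex plane. -/
def cplx : E 2 ≃ₗᵢ[ℝ] ℂ := Complex.orthonormalBasisOneI.repr.symm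

theorem cplx_apply (v : E 2) : cplx v = v 0 + v 1 * Complex.I := by
  have := Complex.orthonormalBasisOneI.sum_repr (cplx v)
  rw [← this]
  simp [cplx, Fin.sum_univ_two]

theorem stdDet_two (v w : E 2) : stdDet ![v, w] = v 0 * w 1 - v 1 * w 0 := by
  simp [stdDet, Module.Basis.det_apply, Matrix.det_fin_two, Module.Basis.toMatrix_apply]
  ring

theorem stdDet_eq_im (v w : E 2) :
    stdDet ![v, w] = (starRingEnd ℂ (cplx v) * cplx w).im := by
  rw [stdDet_two, cplx_apply, cplx_apply]
  simp
  ring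

/-- A chart of a surface with values in the complex plane. -/
def complexChart {F : Type*} [TopologicalSpace F] (φ : OpenPartialHomeomorph F (E 2)) :
    OpenPartialHomeomorph F ℂ := φ.transHomeomorph cplx.toHomeomorph

@[simp] theorem complexChart_source {F : Type*} [TopologicalSpace F]
    (φ : OpenPartialHomeomorph F (E 2)) : (complexChart φ).source = φ.source := rfl

theorem complexChart_apply {F : Type*} [TopologicalSpace F]
    (φ : OpenPartialHomeomorph F (E 2)) (x : F) : complexChart φ x = cplx (φ x) := rfl

theorem complexChart_symm_apply {F : Type*} [TopologicalSpace F]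
    (φ : OpenPartialHomeomorph F (E 2)) (z : ℂ) :
    (complexChart φ).symm z = φ.symm (cplx.symm z) := rfl

theorem exists_disk {F : Type*} [TopologicalSpace F] (ψ : OpenPartialHomeomorph F ℂ) {x : F}
    (hx : x ∈ ψ.source) {W : Set F} (hW : W ∈ 𝓝 x) :
    ∃ e : Disk F, e.chart = ψ ∧ e.center = ψ x ∧ x ∈ e.inner ∧ e.inner ⊆ W := by
  have h1 : ψ.target ∩ ψ.symm ⁻¹' W ∈ 𝓝 (ψ x) := by
    refine Filter.inter_mem (ψ.open_target.mem_nhds (ψ.map_source hx)) ?_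
    exact (ψ.symm.continuousAt (ψ.map_source hx)).preimage_mem_nhds (by rwa [ψ.left_inv hx])
  obtain ⟨ε, hε, hb⟩ := Metric.nhds_basis_closedBall.mem_iff.1 h1
  refine ⟨⟨ψ, ψ x, ε / 2, by positivity, fun z hz => (hb ?_).1⟩, rfl, rfl, ⟨hx, ?_⟩, ?_⟩
  · simpa [mul_div_cancel₀] using hz
  · simpa [Disk.coord] using hε
  · rintro y ⟨hy, hy'⟩
    have h2 : ψ y ∈ Metric.closedBall (ψ x) ε := by
      rw [mem_closedBall_iff_norm]
      exact (le_of_lt hy').trans (by linarith)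
    have h3 := (hb h2).2
    rwa [Set.mem_preimage, ψ.left_inv hy] at h3

theorem det_complex (A : ℂ →L[ℝ] ℂ) :
    A.det = (A 1).re * (A Complex.I).im - (A Complex.I).re * (A 1).im := by
  rw [ContinuousLinearMap.det, ← LinearMap.det_toMatrix Complex.basisOneI, Matrix.det_fin_two]
  simp [LinearMap.toMatrix_apply]

/-- A differentiable map with positive Jacobian determinant turns around a point like a
translation. -/
theorem exists_log_of_det_pos {T : ℂ → ℂ} {A : ℂ →L[ℝ] ℂ} {z : ℂ} (hT : HasFDerivAt T A z)
    (hA : 0 < A.det) : ∃ α : ℂ, α ≠ 0 ∧ ∀ᶠ w in 𝓝[≠] z,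
      (T w - T z) / (w - z) / α ∈ Complex.slitPlane := by
  rw [det_complex] at hA
  -- The decomposition `A h = α h + β h̄` has determinant `|α|² - |β|²`. Positivity makes the
  -- complex linear part dominate, so the difference quotient divided by `α` stays within distance
  -- `1` of `1`.
  set α : ℂ := (A 1 - Complex.I * A Complex.I) / 2 with hα
  set β : ℂ := (A 1 + Complex.I * A Complex.I) / 2 with hβ
  have hsq : ‖β‖ ^ 2 < ‖α‖ ^ 2 := by
    rw [← Complex.normSq_eq_norm_sq, ← Complex.normSq_eq_norm_sq, Complex.normSq_apply,
      Complex.normSq_apply, hα, hβ]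
    simp
    nlinarith
  have hlt : ‖β‖ < ‖α‖ := lt_of_pow_lt_pow_left₀ 2 (norm_nonneg _) hsq
  have hα0 : 0 < ‖α‖ := (norm_nonneg _).trans_lt hlt
  have hAh : ∀ h : ℂ, A h = α * h + β * starRingEnd ℂ h := by
    intro h
    have : h = h.re • (1 : ℂ) + h.im • Complex.I := by simp [Complex.re_add_im]
    have hc : starRingEnd ℂ h = h.re - h.im * Complex.I := by
      apply Complex.ext <;> simp
    rw [hc, hα, hβ]
    conv_lhs => rw [this, map_add, map_smul, map_smul]
    have hh : (α : ℂ) * h = α * (h.re + h.im * Complex.I) := by rw [Complex.re_add_im]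
    rw [hα] at hh
    rw [hh]
    simp only [Complex.real_smul]
    linear_combination ((h.im : ℂ) * A Complex.I) * Complex.I_sq
  refine ⟨α, norm_pos_iff.1 hα0, ?_⟩
  -- Half the gap, so that the remainder together with the antilinear part is still smaller than
  -- `‖α‖ ‖w - z‖`.
  have ho := hT.isLittleO.def (c := (‖α‖ - ‖β‖) / 2) (by linarith)
  rw [eventually_nhdsWithin_iff]
  filter_upwards [ho] with w hw hwz
  have hwz0 : w - z ≠ 0 := sub_ne_zero.2 hwz
  have hwp : 0 < ‖w - z‖ := norm_pos_iff.2 hwz0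
  have hα1 : α ≠ 0 := norm_pos_iff.1 hα0
  have key : ‖(T w - T z) / (w - z) / α - 1‖ < 1 := by
    have : (T w - T z) / (w - z) / α - 1 =
        ((T w - T z - A (w - z)) + β * starRingEnd ℂ (w - z)) / ((w - z) * α) := by
      rw [hAh]
      field_simp
      ring
    rw [this, norm_div, norm_mul, div_lt_one (by positivity)]
    refine (norm_add_le _ _).trans_lt ?_
    rw [norm_mul, Complex.norm_conj]
    nlinarith
  have h2 := Complex.abs_re_le_norm ((T w - T z) / (w - z) / α - 1)
  left
  have h3 := (abs_lt.1 (h2.trans_lt key)).1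
  simp only [Complex.sub_re, Complex.one_re] at h3
  linarith

/-! ### Orders of zeros -/

section Order

variable {F : Type} [TopologicalSpace F] [ChartedSpace (E 2) F]

/-- The function `h` looks around `x` like the `n`-th power of a complex coordinate, up to a
factor with a continuous logarithm. -/
def HasOrder (o : SurfaceOrientation F) (h : F → ℂ) (x : F) (n : ℤ) : Prop :=
  ∀ φ ∈ o.charts, x ∈ φ.source → ∃ v : F → ℂ, ∀ᶠ p in 𝓝[≠] x, ContinuousAt v p ∧
    h p = (complexChart φ p - complexChart φ x) ^ n * Complex.exp (v p)

variable {o : SurfaceOrientation F} {h h' : F → ℂ} {x : F} {n k : ℤ}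

/-- This makes the order of a zero independent of the chart. Orientation is essential: an
orientation reversing transition would turn the coordinate into its conjugate, which winds the other
way. -/
theorem exists_log_transition {φ φ' : OpenPartialHomeomorph F (E 2)} (hφ : φ ∈ o.charts)
    (hφ' : φ' ∈ o.charts) (hx : x ∈ φ.source) (hx' : x ∈ φ'.source) :
    ∃ v : F → ℂ, ∀ᶠ p in 𝓝[≠] x, ContinuousAt v p ∧
      complexChart φ' p - complexChart φ' x =
        (complexChart φ p - complexChart φ x) * Complex.exp (v p) := by
  have hdet := o.compatible φ hφ φ' hφ' x ⟨hx, hx'⟩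
  -- Otherwise `fderiv` takes its default value `0`, whose determinant in dimension two is not
  -- positive.
  have hdiff : DifferentiableAt ℝ (φ.symm.trans φ') (φ x) := by
    by_contra hn
    rw [fderiv_zero_of_not_differentiableAt hn] at hdet
    simp [ContinuousLinearMap.det] at hdet
  set ψ := complexChart φ
  set ψ' := complexChart φ'
  set B := fderiv ℝ (φ.symm.trans φ') (φ x) with hB
  have hT : HasFDerivAt (fun z => ψ' (ψ.symm z))
      ((cplx.toContinuousLinearEquiv : E 2 →L[ℝ] ℂ) ∘L B ∘L
        (cplx.symm.toContinuousLinearEquiv : ℂ →L[ℝ] E 2)) (ψ x) := by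
    have h1 : HasFDerivAt (φ.symm.trans φ') B (cplx.symm (ψ x)) := by
      have h2 : cplx.symm (ψ x) = φ x := cplx.symm_apply_apply _
      rw [h2]
      exact hdiff.hasFDerivAt
    exact (cplx.toContinuousLinearEquiv.hasFDerivAt.comp _ h1).comp (ψ x)
      (f := cplx.symm) cplx.symm.toContinuousLinearEquiv.hasFDerivAt
  have hdet' : 0 < ((cplx.toContinuousLinearEquiv : E 2 →L[ℝ] ℂ) ∘L B ∘L
        (cplx.symm.toContinuousLinearEquiv : ℂ →L[ℝ] E 2)).det := by
    have := LinearMap.det_conj (B : E 2 →ₗ[ℝ] E 2) cplx.toLinearEquiv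
    have h2 : LinearMap.det (((cplx.toContinuousLinearEquiv : E 2 →L[ℝ] ℂ) ∘L B ∘L
        (cplx.symm.toContinuousLinearEquiv : ℂ →L[ℝ] E 2) : ℂ →L[ℝ] ℂ) : ℂ →ₗ[ℝ] ℂ) =
        LinearMap.det (B : E 2 →ₗ[ℝ] E 2) := by
      rw [← this]; rfl
    rw [ContinuousLinearMap.det, h2]
    exact hdet
  obtain ⟨α, hα, hev⟩ := exists_log_of_det_pos hT hdet'
  have htend : Filter.Tendsto ψ (𝓝[≠] x) (𝓝[≠] (ψ x)) := by
    refine tendsto_nhdsWithin_iff.2 ⟨(ψ.continuousAt hx).mono_left nhdsWithin_le_nhds, ?_⟩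
    filter_upwards [self_mem_nhdsWithin, nhdsWithin_le_nhds (ψ.open_source.mem_nhds hx)]
      with p hp hps hpx
    exact hp (ψ.injOn hps hx hpx)
  refine ⟨fun p => Complex.log ((ψ' p - ψ' x) / (ψ p - ψ x) / α) + Complex.log α, ?_⟩
  filter_upwards [htend.eventually hev, self_mem_nhdsWithin,
    nhdsWithin_le_nhds (ψ.open_source.mem_nhds hx),
    nhdsWithin_le_nhds (ψ'.open_source.mem_nhds hx')] with p hp hpx hps hps'
  have hne : ψ p - ψ x ≠ 0 := sub_ne_zero.2 fun h => hpx (ψ.injOn hps hx h)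
  rw [ψ.left_inv hps, ψ.left_inv hx] at hp
  constructor
  · refine ContinuousAt.add (ContinuousAt.clog ?_ hp) continuousAt_const
    have c1 := ψ.continuousAt hps
    have c2 := ψ'.continuousAt hps'
    exact (((c2.sub continuousAt_const).div (c1.sub continuousAt_const) hne)).div_const _
  · rw [Complex.exp_add, Complex.exp_log (Complex.slitPlane_ne_zero hp), Complex.exp_log hα]
    field_simp

theorem HasOrder.of_chart {φ : OpenPartialHomeomorph F (E 2)} (hφ : φ ∈ o.charts)
    (hx : x ∈ φ.source) (hh : ∃ v : F → ℂ, ∀ᶠ p in 𝓝[≠] x, ContinuousAt v p ∧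
      h p = (complexChart φ p - complexChart φ x) ^ n * Complex.exp (v p)) :
    HasOrder o h x n := by
  intro φ' hφ' hx'
  obtain ⟨v, hv⟩ := hh
  obtain ⟨w, hw⟩ := exists_log_transition hφ' hφ hx' hx
  refine ⟨fun p => n * w p + v p, ?_⟩
  filter_upwards [hv, hw] with p hp hp'
  refine ⟨(continuousAt_const.mul hp'.1).add hp.1, ?_⟩
  rw [hp.2, hp'.2, mul_zpow, Complex.exp_add, Complex.exp_int_mul, mul_assoc]

theorem HasOrder.mul (H : HasOrder o h x n) (H' : HasOrder o h' x k) :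
    HasOrder o (fun p => h p * h' p) x (n + k) := by
  intro φ hφ hx
  obtain ⟨v, hv⟩ := H φ hφ hx
  obtain ⟨w, hw⟩ := H' φ hφ hx
  refine ⟨fun p => v p + w p, ?_⟩
  filter_upwards [hv, hw, self_mem_nhdsWithin,
    nhdsWithin_le_nhds (φ.open_source.mem_nhds hx)] with p hp hp' hpx hps
  refine ⟨hp.1.add hp'.1, ?_⟩
  rw [hp.2, hp'.2, Complex.exp_add, zpow_add₀ (sub_ne_zero.2 fun h => hpx
    ((complexChart φ).injOn hps hx h))]
  ring

theorem HasOrder.inv (H : HasOrder o h x n) : HasOrder o (fun p => (h p)⁻¹) x (-n) := by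
  intro φ hφ hx
  obtain ⟨v, hv⟩ := H φ hφ hx
  refine ⟨fun p => - v p, ?_⟩
  filter_upwards [hv] with p hp
  refine ⟨hp.1.neg, ?_⟩
  rw [hp.2, Complex.exp_neg, zpow_neg, mul_inv]

theorem HasOrder.congr (H : HasOrder o h x n) (hh : ∀ᶠ p in 𝓝[≠] x, h' p = h p) :
    HasOrder o h' x n := by
  intro φ hφ hx
  obtain ⟨v, hv⟩ := H φ hφ hx
  exact ⟨v, by filter_upwards [hv, hh] with p hp hp'; exact ⟨hp.1, hp'.trans hp.2⟩⟩

/-- Near `x` the quotient `h p / h x` is close to `1`, where the principal logarithm is continuous.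
-/
theorem hasOrder_zero (hc : ∀ᶠ p in 𝓝 x, ContinuousAt h p) (h0 : h x ≠ 0) :
    HasOrder o h x 0 := by
  intro φ hφ hx
  refine ⟨fun p => Complex.log (h p / h x) + Complex.log (h x), ?_⟩
  have hcx : ContinuousAt (fun p => h p / h x) x := hc.self_of_nhds.div_const _
  have hs : ∀ᶠ p in 𝓝 x, h p / h x ∈ Complex.slitPlane :=
    hcx.eventually_mem (Complex.isOpen_slitPlane.mem_nhds (by simp [h0]))
  filter_upwards [nhdsWithin_le_nhds hc, nhdsWithin_le_nhds hs] with p hp hp'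
  refine ⟨((hp.div_const _).clog hp').add continuousAt_const, ?_⟩
  rw [Complex.exp_add, Complex.exp_log (Complex.slitPlane_ne_zero hp'), Complex.exp_log h0]
  field_simp

theorem hasOrder_chart_sub {φ : OpenPartialHomeomorph F (E 2)} (hφ : φ ∈ o.charts)
    (hx : x ∈ φ.source) {p : F} [Decidable (x = p)] (hp : p ∈ φ.source) :
    HasOrder o (fun y => complexChart φ y - complexChart φ p) x (if x = p then 1 else 0) := by
  split_ifs with h
  · subst h
    refine HasOrder.of_chart hφ hx ⟨0, ?_⟩
    filter_upwards with y
    exact ⟨continuousAt_const, by simp⟩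
  · refine hasOrder_zero ?_ (sub_ne_zero.2 fun h' => h ((complexChart φ).injOn hx hp h'))
    filter_upwards [φ.open_source.mem_nhds hx] with y hy
    exact ((complexChart φ).continuousAt hy).sub continuousAt_const

/-- The disk is the domain of an oriented chart. -/
def Disk.IsOriented (e : Disk F) (o : SurfaceOrientation F) : Prop :=
  ∃ φ ∈ o.charts, e.chart = complexChart φ

open Classical in
theorem Disk.hasOrder_dipole [T2Space F] {e : Disk F} (he : e.IsOriented o) {p q : F}
    (hp : p ∈ e.inner) (hq : q ∈ e.inner) (x : F) :
    HasOrder o (e.dipole p q) x ((if x = p then 1 else 0) - (if x = q then 1 else 0)) := by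
  by_cases hx : x ∈ e.inner
  · obtain ⟨φ, hφ, hc⟩ := he
    have hs : ∀ y, y ∈ e.inner → y ∈ φ.source := fun y hy => by simpa [hc] using hy.1
    have h1 := hasOrder_chart_sub hφ (hs x hx) (hs p hp)
    have h2 := hasOrder_chart_sub hφ (hs x hx) (hs q hq)
    refine (h1.mul h2.inv).congr ?_
    filter_upwards [nhdsWithin_le_nhds (e.isOpen_inner.mem_nhds hx)] with y hy
    rw [e.dipole_of_mem _ _ hy.1, dip, if_pos hy.2, Disk.coord, Disk.coord, Disk.coord,
      sub_sub_sub_cancel_right, sub_sub_sub_cancel_right, hc]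
    rfl
  · have hxp : x ≠ p := fun h => hx (h ▸ hp)
    have hxq : x ≠ q := fun h => hx (h ▸ hq)
    rw [if_neg hxp, if_neg hxq, sub_zero]
    refine hasOrder_zero ?_ (Disk.dipole_ne_zero hp hq hxp hxq)
    filter_upwards [isOpen_compl_singleton.mem_nhds hxq] with y hy
    exact Disk.continuousAt_dipole hp hq hy

end Order

/-! ### Functions that are locally constant off a thin set -/

/-- A chaining argument that may pass through points of `A`, where `u` carries no information.
Points of `S` are related when `u` takes a single value off `A` on suitable neighbourhoods of both;
density of the complement of `A` supplies the intermediate point for transitivity. -/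
theorem eq_of_locally_eq {X α : Type*} [TopologicalSpace X] {S A : Set X} (hS : IsPreconnected S)
    (hA : Dense Aᶜ) {u : X → α}
    (h : ∀ x ∈ S, ∃ W ∈ 𝓝 x, ∀ y ∈ W, y ∉ A → ∀ z ∈ W, z ∉ A → u y = u z)
    {y z : X} (hy : y ∈ S) (hyA : y ∉ A) (hz : z ∈ S) (hzA : z ∉ A) : u y = u z := by
  have hne : ∀ x, ∀ W ∈ 𝓝 x, ∃ p ∈ W, p ∉ A := fun x W hW => by
    obtain ⟨p, hp, hpA⟩ := mem_closure_iff_nhds.1 (hA x) W hW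
    exact ⟨p, hp, hpA⟩
  have key := hS.induction₂ (fun x y => ∃ W ∈ 𝓝 x, ∃ W' ∈ 𝓝 y,
    ∀ p ∈ W, p ∉ A → ∀ q ∈ W', q ∉ A → u p = u q) ?_ ?_ ?_ hy hz
  · obtain ⟨W, hW, W', hW', hWW⟩ := key
    exact hWW y (mem_of_mem_nhds hW) hyA z (mem_of_mem_nhds hW') hzA
  · intro x hx
    obtain ⟨W, hW, hWW⟩ := h x hx
    filter_upwards [nhdsWithin_le_nhds (eventually_mem_nhds_iff.2 hW)] with y hy
    exact ⟨W, hW, W, hy, hWW⟩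
  · rintro x y z _ _ _ ⟨W₁, hW₁, W₂, hW₂, h12⟩ ⟨W₃, hW₃, W₄, hW₄, h34⟩
    refine ⟨W₁, hW₁, W₄, hW₄, fun p hp hpA q hq hqA => ?_⟩
    obtain ⟨t, ht, htA⟩ := hne y _ (Filter.inter_mem hW₂ hW₃)
    rw [h12 p hp hpA t ht.1 htA, h34 t ht.2 htA q hq hqA]
  · rintro x y _ _ ⟨W₁, hW₁, W₂, hW₂, h12⟩
    exact ⟨W₂, hW₂, W₁, hW₁, fun p hp hpA q hq hqA => (h12 q hq hqA p hp hpA).symm⟩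

/-- Urysohn's lemma for nested closed neighbourhoods. Vanishing near each point off `W`, not only at
it, leaves germs unchanged there, so continuity and orders are preserved. -/
theorem exists_cutoff {F : Type*} [TopologicalSpace F] [T2Space F] [CompactSpace F] {x : F} {W : Set F}
    (hW : W ∈ 𝓝 x) : ∃ f : F → ℝ, Continuous f ∧
    (∀ᶠ y in 𝓝 x, f y = 1) ∧ ∀ y ∉ W, ∀ᶠ z in 𝓝 y, f z = 0 := by
  obtain ⟨V, hV, hVc, hVW⟩ := exists_mem_nhds_isClosed_subset hW
  obtain ⟨V', hV', hVc', hVW'⟩ := exists_mem_nhds_isClosed_subset (interior_mem_nhds.2 hV)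
  obtain ⟨f, h0, h1, -⟩ := exists_continuous_zero_one_of_isClosed
    (isOpen_interior (s := V)).isClosed_compl hVc' (Set.disjoint_left.2 fun y hy hy' => hy (hVW' hy'))
  refine ⟨f, f.continuous, Filter.mem_of_superset hV' fun y hy => h1 hy, fun y hy => ?_⟩
  filter_upwards [hVc.isOpen_compl.mem_nhds fun h => hy (hVW h)] with z hz
  exact h0 fun h => hz (interior_subset h)

/-! ### Removing singularities of order zero, and the potential of a null-homologous family. -/

section Potential

variable {F : Type} [TopologicalSpace F] [ChartedSpace (E 2) F]
  {o : SurfaceOrientation F}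

/-- Induction on the bad points. Near a bad point `m = exp v` on a punctured neighbourhood, and
multiplying by `exp (-f v)` with a cutoff `f` makes the function `1` there. The support of `f`
avoids `K` and the remaining bad points. -/
theorem exists_continuous_of_hasOrder_zero_aux [T2Space F] [CompactSpace F] {K : Set F}
    (hK : IsClosed K) (S : Finset F) :
    ∀ m : F → ℂ, (∀ x ∉ S, ContinuousAt m x ∧ m x ≠ 0) → (∀ x, HasOrder o m x 0) →
      (∀ x ∈ S, x ∉ K) → ∃ m' : F → ℂ, Continuous m' ∧ (∀ x, m' x ≠ 0) ∧ ∀ x ∈ K, m' x = m x := by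
  classical
  induction S using Finset.induction with
  | empty =>
    intro m hm _ _
    exact ⟨m, continuous_iff_continuousAt.2 fun x => (hm x (by simp)).1,
      fun x => (hm x (by simp)).2, fun _ _ => rfl⟩
  | insert x T hxT ih =>
    intro m hm hord hSK
    obtain ⟨φ, hφ, hxφ⟩ := o.cover x
    obtain ⟨v, hv⟩ := hord x φ hφ hxφ
    simp only [zpow_zero, one_mul] at hv
    obtain ⟨W, hWx, hW⟩ := mem_nhdsWithin_iff_exists_mem_nhds_inter.1 hv
    have hxK : x ∉ K := hSK x (Finset.mem_insert_self x T)
    have hTx : (T : Set F)ᶜ ∈ 𝓝 x := T.finite_toSet.isClosed.isOpen_compl.mem_nhds hxT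
    obtain ⟨f, hf, hf1, hf0⟩ := exists_cutoff (Filter.inter_mem (interior_mem_nhds.2 hWx)
      (Filter.inter_mem hTx (hK.isOpen_compl.mem_nhds hxK)))
    obtain ⟨V, hVf, hVo, hxV⟩ := mem_nhds_iff.1 (Filter.inter_mem hf1 hWx)
    -- The value at `x` is prescribed separately, because `v` is controlled only on the punctured
    -- neighbourhood.
    let m' : F → ℂ := fun p => if p = x then 1 else m p * Complex.exp (- f p * v p)
    have hne : ∀ p, p ≠ x → ∀ᶠ q in 𝓝 p, m' q = m q * Complex.exp (- f q * v q) := by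
      intro p hp
      filter_upwards [isOpen_compl_singleton.mem_nhds hp] with q hq
      exact if_neg hq
    have hnear : ∀ᶠ q in 𝓝 x, m' q = 1 := by
      filter_upwards [hVo.mem_nhds hxV] with q hq
      by_cases hqx : q = x
      · exact if_pos hqx
      · have h1 := hVf hq
        have h2 := (hW ⟨h1.2, hqx⟩).2
        have h3 : f q = 1 := h1.1
        simp only [m', if_neg hqx]
        rw [h2, h3, ← Complex.exp_add]
        simp
    have hoff : ∀ p, p ∉ interior W ∩ ((T : Set F)ᶜ ∩ Kᶜ) → ∀ᶠ q in 𝓝 p, m' q = m q := by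
      intro p hp
      have hpx : p ≠ x := by
        rintro rfl
        exact hp ⟨mem_interior_iff_mem_nhds.2 hWx, hxT, hxK⟩
      filter_upwards [hne p hpx, hf0 p hp] with q hq hq'
      rw [hq, hq']; simp
    have hgood : ∀ p ∉ T, ContinuousAt m' p ∧ m' p ≠ 0 := by
      intro p hpT
      by_cases hpx : p = x
      · subst hpx
        exact ⟨continuousAt_const.congr (hnear.mono fun _ h => h.symm),
          by rw [hnear.self_of_nhds]; exact one_ne_zero⟩
      · have hmp := hm p (by simp [hpx, hpT])
        by_cases hpW : p ∈ interior W ∩ ((T : Set F)ᶜ ∩ Kᶜ)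
        · have hvp := (hW ⟨interior_subset hpW.1, hpx⟩).1
          constructor
          · refine ContinuousAt.congr ?_ ((hne p hpx).mono fun _ h => h.symm)
            have := hf.continuousAt (x := p)
            have := hmp.1
            fun_prop
          · rw [(hne p hpx).self_of_nhds]
            exact mul_ne_zero hmp.2 (Complex.exp_ne_zero _)
        · exact ⟨hmp.1.congr ((hoff p hpW).mono fun _ h => h.symm),
            by rw [(hoff p hpW).self_of_nhds]; exact hmp.2⟩
    have hord' : ∀ p, HasOrder o m' p 0 := by
      intro p
      by_cases hpT : p ∈ T
      · exact (hord p).congr (nhdsWithin_le_nhds (hoff p fun h => h.2.1 hpT))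
      · refine hasOrder_zero ?_ (hgood p hpT).2
        filter_upwards [T.finite_toSet.isClosed.isOpen_compl.mem_nhds hpT] with q hq
        exact (hgood q hq).1
    obtain ⟨m'', hc, h0, hKm⟩ :=
      ih m' hgood hord' fun y hy => hSK y (Finset.mem_insert_of_mem hy)
    refine ⟨m'', hc, h0, fun y hy => ?_⟩
    rw [hKm y hy, (hoff y fun h => h.2.2 hy).self_of_nhds]

/-- Order zero at a point allows only that point to be bad in some neighbourhood, so compactness
leaves finitely many bad points, none of them on `K`. -/
theorem exists_continuous_of_hasOrder_zero [T2Space F] [CompactSpace F] {K : Set F}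
    (hK : IsClosed K) {m : F → ℂ}
    (hm : ∀ x ∈ K, ContinuousAt m x ∧ m x ≠ 0) (hord : ∀ x, HasOrder o m x 0) :
    ∃ m' : F → ℂ, Continuous m' ∧ (∀ x, m' x ≠ 0) ∧ ∀ x ∈ K, m' x = m x := by
  have hfin : ({x | ¬ (ContinuousAt m x ∧ m x ≠ 0)} ∩ Set.univ).Finite := by
    refine isCompact_univ.induction_on
      (p := fun s => ({x | ¬ (ContinuousAt m x ∧ m x ≠ 0)} ∩ s).Finite) (by simp)
      (fun s t hst ht => ht.subset (Set.inter_subset_inter_right _ hst))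
      (fun s t hs ht => by rw [Set.inter_union_distrib_left]; exact hs.union ht) fun x _ => ?_
    obtain ⟨φ, hφ, hxφ⟩ := o.cover x
    obtain ⟨v, hv⟩ := hord x φ hφ hxφ
    simp only [zpow_zero, one_mul] at hv
    obtain ⟨W, hWx, hW⟩ := mem_nhdsWithin_iff_exists_mem_nhds_inter.1 hv
    refine ⟨interior W, nhdsWithin_le_nhds (interior_mem_nhds.2 hWx),
      (Set.finite_singleton x).subset ?_⟩
    rintro y ⟨hy, hyW⟩
    by_contra hyx
    apply hy
    have hex : ∀ᶠ q in 𝓝 y, m q = Complex.exp (v q) := by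
      filter_upwards [isOpen_interior.mem_nhds hyW, isOpen_compl_singleton.mem_nhds hyx]
        with q hq hq'
      exact (hW ⟨interior_subset hq, hq'⟩).2
    have hvy := (hW ⟨interior_subset hyW, hyx⟩).1
    exact ⟨(Complex.continuous_exp.continuousAt.comp hvy).congr (hex.mono fun _ h => h.symm),
      by rw [hex.self_of_nhds]; exact Complex.exp_ne_zero _⟩
  rw [Set.inter_univ] at hfin
  refine exists_continuous_of_hasOrder_zero_aux hK hfin.toFinset m (fun x hx => ?_) hord ?_
  · simpa using hx
  · intro x hx hxK
    rw [Set.Finite.mem_toFinset] at hx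
    exact hx (hm x hxK)

theorem Curves.support_eq_iUnion (L : Curves F) :
    L.support = ⋃ i, L.curve i '' Set.Icc 0 1 := by
  refine Set.iUnion_congr fun i => ?_
  have := (L.periodic i).image_Icc one_pos 0
  rw [zero_add] at this
  rw [this]

theorem Curves.isCompact_support (L : Curves F) : IsCompact L.support := by
  rw [support_eq_iUnion]
  exact isCompact_iUnion fun i => isCompact_Icc.image (L.continuous_curve i)

theorem Curves.isClosed_support [T2Space F] (L : Curves F) : IsClosed L.support :=
  L.isCompact_support.isClosed

open Classical in
/-- A function on the surface with a simple zero at `y`, a simple pole at `y₀`, and without zeros,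
poles and discontinuities on `L`. -/
structure IsDipole (o : SurfaceOrientation F) (L : Curves F) (h : F → ℂ) (y₀ y : F) : Prop where
  admissible : L.Admissible h
  order : ∀ x, HasOrder o h x ((if x = y then 1 else 0) - (if x = y₀ then 1 else 0))

theorem IsDipole.mul {L : Curves F} {h h' : F → ℂ} {x y z : F} (H : IsDipole o L h x y)
    (H' : IsDipole o L h' y z) : IsDipole o L (fun p => h p * h' p) x z where
  admissible := H.admissible.mul H'.admissible
  order p := by
    have := (H.order p).mul (H'.order p)
    rwa [add_comm, sub_add_sub_cancel] at this

theorem Disk.isDipole [T2Space F] {L : Curves F} {e : Disk F} (he : e.IsOriented o) {p q : F}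
    (hp : p ∈ e.inner) (hq : q ∈ e.inner) (hpL : p ∉ L.support) (hqL : q ∉ L.support) :
    IsDipole o L (e.dipole q p) p q where
  admissible := e.admissible_dipole hq hp hqL hpL
  order := e.hasOrder_dipole he hq hp

/-- The quotient of the two functions has order zero everywhere. Hence along `L` it coincides with a
nowhere vanishing continuous function, whose total winding number is zero by hypothesis. -/
theorem IsDipole.deg_eq [T2Space F] [CompactSpace F] {L : Curves F}
    (hL : ∀ m : F → ℂ, Continuous m → (∀ x, m x ≠ 0) → L.deg m = 0) {h h' : F → ℂ} {y₀ y : F}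
    (H : IsDipole o L h y₀ y) (H' : IsDipole o L h' y₀ y) : L.deg h = L.deg h' := by
  obtain ⟨m, hc, h0, hK⟩ := exists_continuous_of_hasOrder_zero (o := o) L.isClosed_support
    (H.admissible.mul H'.admissible.inv) fun x => by
      have := (H.order x).mul (H'.order x).inv
      rwa [add_neg_cancel] at this
  have h1 := hL m hc h0
  rw [Curves.deg_congr hK, Curves.deg_mul H.admissible H'.admissible.inv,
    Curves.deg_inv H'.admissible] at h1
  linarith

/-- Multiplying by a dipole of a small disk moves the zero within the disk, so existence is a
locally constant property of `y`, and the surface is connected. -/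
theorem exists_isDipole [T2Space F] [ConnectedSpace F] {L : Curves F} (hd : Dense L.supportᶜ) {y₀ y : F}
    (hy₀ : y₀ ∉ L.support) (hy : y ∉ L.support) : ∃ h, IsDipole o L h y₀ y := by
  have key : (∃ h, IsDipole o L h y₀ y) = ∃ h, IsDipole o L h y₀ y₀ := by
    refine eq_of_locally_eq (u := fun y => ∃ h, IsDipole o L h y₀ y) isPreconnected_univ hd
      (fun x _ => ?_) (Set.mem_univ _) hy (Set.mem_univ _) hy₀
    obtain ⟨φ, hφ, hxφ⟩ := o.cover x
    obtain ⟨e, hec, -, hxe, -⟩ := exists_disk (complexChart φ) hxφ Filter.univ_mem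
    have he : e.IsOriented o := ⟨φ, hφ, hec⟩
    refine ⟨e.inner, e.isOpen_inner.mem_nhds hxe, fun p hp hpL q hq hqL => propext ⟨?_, ?_⟩⟩
    · rintro ⟨h, hh⟩
      exact ⟨_, hh.mul (Disk.isDipole he hp hq hpL hqL)⟩
    · rintro ⟨h, hh⟩
      exact ⟨_, hh.mul (Disk.isDipole he hq hp hqL hpL)⟩
  rw [key]
  obtain ⟨φ, hφ, hxφ⟩ := o.cover y₀
  obtain ⟨e, hec, -, hxe, -⟩ := exists_disk (complexChart φ) hxφ Filter.univ_mem
  exact ⟨_, Disk.isDipole ⟨φ, hφ, hec⟩ hxe hxe hy₀ hy₀⟩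

/-- A null-homologous family of curves has a potential: a function whose change between the points
of a disk is the algebraic number of crossings with the curves. -/
theorem exists_potential [T2Space F] [CompactSpace F] [ConnectedSpace F]
    (o : SurfaceOrientation F) {L : Curves F}
    (hd : Dense L.supportᶜ) (hL : ∀ m : F → ℂ, Continuous m → (∀ x, m x ≠ 0) → L.deg m = 0) :
    ∃ N : F → ℤ, ∀ e : Disk F, e.IsOriented o → ∀ p ∈ e.inner, ∀ q ∈ e.inner,
      p ∉ L.support → q ∉ L.support → N q - N p = L.crossing e p q := by
  obtain ⟨y₀, hy₀⟩ := hd.nonempty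
  choose! h hh using fun y (hy : y ∉ L.support) => exists_isDipole (o := o) hd hy₀ hy
  refine ⟨fun y => L.deg (h y), fun e he p hp q hq hpL hqL => ?_⟩
  -- The product of `h p` with the local dipole and the function `h q` both have their zero at `q`
  -- and their pole at `y₀`, so their winding numbers agree.
  have h1 := Disk.isDipole he hp hq hpL hqL
  have h2 := ((hh p hpL).mul h1).deg_eq hL (hh q hqL)
  rw [Curves.deg_mul (hh p hpL).admissible h1.admissible] at h2
  simp only [Curves.crossing]
  linarith

end Potential

/-! ### Velocities in charts -/

section Velocity

variable {F : Type} [TopologicalSpace F] [ChartedSpace (E 2) F]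
  {o : SurfaceOrientation F} {φ : OpenPartialHomeomorph F (E 2)} {x : F}

theorem mdifferentiable_chart (hφ : φ ∈ o.charts) :
    φ.MDifferentiable (𝓡 2) (𝓡 2) :=
  ⟨(contMDiffOn_of_mem_maximalAtlas (o.charts_subset hφ)).mdifferentiableOn (by simp),
    (contMDiffOn_symm_of_mem_maximalAtlas (o.charts_subset hφ)).mdifferentiableOn (by simp)⟩

/-- The differential of a complex chart. -/
def chartDeriv (φ : OpenPartialHomeomorph F (E 2)) (x : F) : TangentSpace (𝓡 2) x →L[ℝ] ℂ :=
  (cplx.toContinuousLinearEquiv : E 2 →L[ℝ] ℂ) ∘L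
    (mfderiv (𝓡 2) (𝓡 2) φ x : TangentSpace (𝓡 2) x →L[ℝ] E 2)

theorem chartDeriv_injective (hφ : φ ∈ o.charts) (hx : x ∈ φ.source) :
    Function.Injective (chartDeriv φ x) :=
  cplx.injective.comp ((mdifferentiable_chart hφ).mfderiv_injective hx)

theorem HasVelocityAt.hasDerivAt {β : ℝ → F} {t : ℝ} {v : TangentSpace (𝓡 2) x}
    (h : HasVelocityAt β t x v) (hφ : φ ∈ o.charts) (hx : x ∈ φ.source) :
    HasDerivAt (fun s => complexChart φ (β s)) (chartDeriv φ x v) t := by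
  obtain ⟨rfl, hβ⟩ := h
  have h1 := ((mdifferentiable_chart hφ).mdifferentiableAt hx).hasMFDerivAt
  have h2 := (h1.comp t hβ).hasFDerivAt
  have h3 := (cplx.toContinuousLinearEquiv : E 2 →L[ℝ] ℂ).hasFDerivAt.comp t h2
  have h4 := h3.hasDerivAt
  exact h4.congr_deriv (congrArg (chartDeriv φ (β t)) (one_smul ℝ v))

/-- Straight lines in a chart realize every velocity. They serve both for surjectivity of
`chartDeriv` and as test curves for `IsEnteredAt`. -/
theorem exists_velocity (hφ : φ ∈ o.charts) (hx : x ∈ φ.source) (z : ℂ) :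
    ∃ v : TangentSpace (𝓡 2) x, chartDeriv φ x v = z ∧
      HasVelocityAt (fun t => (complexChart φ).symm (complexChart φ x + t * z)) 0 x v := by
  have h1 := ((mdifferentiable_chart hφ).mdifferentiableAt_symm
    (φ.map_source hx)).hasMFDerivAt
  have hl : HasFDerivAt (fun t : ℝ => φ x + t • cplx.symm z)
      (ContinuousLinearMap.toSpanSingleton ℝ (cplx.symm z)) 0 := by
    have := ((hasDerivAt_id (0 : ℝ)).smul_const (cplx.symm z)).const_add (φ x)
    simpa using this.hasFDerivAt
  have h2 : HasMFDerivAt 𝓘(ℝ, ℝ) (𝓡 2) (fun t : ℝ => φ x + t • cplx.symm z) (0 : ℝ)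
    (ContinuousLinearMap.toSpanSingleton ℝ (cplx.symm z)) := hl.hasMFDerivAt
  have h0 : φ x + (0 : ℝ) • cplx.symm z = φ x := by simp
  rw [← h0] at h1
  have h3 := h1.comp (0 : ℝ) h2
  let v : TangentSpace (𝓡 2) x :=
    (mfderiv (𝓡 2) (𝓡 2) φ.symm (φ x + (0 : ℝ) • cplx.symm z) : E 2 →L[ℝ] E 2) (cplx.symm z)
  have hβ : (φ.symm ∘ fun t : ℝ => φ x + t • cplx.symm z) =
      fun t : ℝ => (complexChart φ).symm (complexChart φ x + t * z) := by
    ext t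
    simp [complexChart_symm_apply, complexChart_apply, ← Complex.real_smul]
  have hv : HasVelocityAt (fun t : ℝ => (complexChart φ).symm (complexChart φ x + t * z)) 0 x v := by
    rw [← hβ]
    refine ⟨by simp [φ.left_inv hx], ?_⟩
    refine h3.congr_mfderiv (ContinuousLinearMap.ext_ring ?_)
    exact (congrArg (mfderiv (𝓡 2) (𝓡 2) φ.symm (φ x + (0 : ℝ) • cplx.symm z))
      (one_smul ℝ (cplx.symm z))).trans (one_smul ℝ v).symm
  refine ⟨v, ?_, hv⟩
  have h4 := hv.hasDerivAt hφ hx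
  have h5 : HasDerivAt (fun s : ℝ => complexChart φ x + s * z) z 0 := by
    have := ((hasDerivAt_id (0 : ℝ)).ofReal_comp.mul_const z).const_add (complexChart φ x)
    simpa using this
  refine h4.unique (h5.congr_of_eventuallyEq ?_)
  have hc : ContinuousAt (fun s : ℝ => complexChart φ x + s * z) 0 := by fun_prop
  have ht : (complexChart φ).target ∈ 𝓝 (complexChart φ x + ((0 : ℝ) : ℂ) * z) := by
    simpa using (complexChart φ).open_target.mem_nhds ((complexChart φ).map_source hx)
  filter_upwards [hc.preimage_mem_nhds ht] with s hs
  exact (complexChart φ).right_inv hs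

theorem Curves.hasVelocityAt (L : Curves F) (i : L.ι) (t : ℝ) : HasVelocityAt (L.curve i) t
    (L.curve i t) (mfderiv 𝓘(ℝ, ℝ) (𝓡 2) (L.curve i) t (1 : ℝ)) := by
  refine ⟨rfl, ?_⟩
  have h := ((L.smooth i).mdifferentiableAt (x := t) (by simp)).hasMFDerivAt
  exact h.congr_mfderiv (ContinuousLinearMap.ext_ring (one_smul ℝ _).symm)

theorem HasVelocityAt.ne_zero {L : Curves F} {i : L.ι} {t : ℝ} {v : TangentSpace (𝓡 2) x}
    (h : HasVelocityAt (L.curve i) t x v) : v ≠ 0 := by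
  rintro rfl
  apply L.immersed i t
  rw [h.2.mfderiv]
  exact ContinuousLinearMap.ext_ring (smul_zero (1 : ℝ))

theorem HasVelocityAt.hasStrictDerivAt {L : Curves F} {i : L.ι} {t : ℝ}
    {v : TangentSpace (𝓡 2) x} (h : HasVelocityAt (L.curve i) t x v) (hφ : φ ∈ o.charts)
    (hx : x ∈ φ.source) :
    HasStrictDerivAt (fun s => complexChart φ (L.curve i s)) (chartDeriv φ x v) t := by
  have h1 : ContMDiffAt (𝓡 2) (𝓡 2) ∞ φ (L.curve i t) := by
    rw [h.1]
    exact (contMDiffOn_of_mem_maximalAtlas (o.charts_subset hφ)).contMDiffAt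
      (φ.open_source.mem_nhds hx)
  have h2 : ContDiffAt ℝ ∞ (fun s => φ (L.curve i s)) t :=
    (h1.comp t (L.smooth i).contMDiffAt).contDiffAt
  have h3 : ContDiffAt ℝ ∞ (fun s => complexChart φ (L.curve i s)) t :=
    cplx.contDiff.contDiffAt.comp t h2
  have h4 := h3.hasStrictDerivAt (by simp)
  rwa [(h.hasDerivAt hφ hx).deriv] at h4

theorem isPositive_iff_of_mem {v w : TangentSpace (𝓡 2) x} :
    0 < stdDet ![(mfderiv (𝓡 2) (𝓡 2) φ x v : E 2), (mfderiv (𝓡 2) (𝓡 2) φ x w : E 2)] ↔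
      0 < (starRingEnd ℂ (chartDeriv φ x v) * chartDeriv φ x w).im := by
  exact iff_of_eq (congrArg (0 < ·) (stdDet_eq_im (mfderiv (𝓡 2) (𝓡 2) φ x v : E 2)
    (mfderiv (𝓡 2) (𝓡 2) φ x w : E 2)))

end Velocity

/-! ### The two sides of a regular level set -/

theorem eventually_lt_of_hasDerivAt {ρ : ℝ → ℝ} {d t₀ : ℝ} (h : HasDerivAt ρ d t₀) (hd : 0 < d) :
    (∀ᶠ t in 𝓝[>] t₀, ρ t₀ < ρ t) ∧ ∀ᶠ t in 𝓝[<] t₀, ρ t < ρ t₀ := by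
  have h1 := (hasDerivAt_iff_tendsto_slope.1 h).eventually_const_lt hd
  constructor
  · filter_upwards [nhdsWithin_mono _ (fun t (ht : t₀ < t) => ht.ne') h1, self_mem_nhdsWithin]
      with t ht ht'
    exact (slope_pos_iff_of_le (le_of_lt ht')).1 ht
  · filter_upwards [nhdsWithin_mono _ (fun t (ht : t < t₀) => ht.ne) h1, self_mem_nhdsWithin]
      with t ht ht'
    rw [slope_comm] at ht
    exact (slope_pos_iff_of_le (le_of_lt ht')).1 ht

/-- The implicit function theorem turns `g` into a linear coordinate; the two sides are then images
of a ball cut by open half-spaces, which are convex. -/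
theorem exists_sides {g : ℂ → ℝ} {g' : ℂ →L[ℝ] ℝ} {z : ℂ} (hg : HasStrictFDerivAt g g' z)
    (hg' : g' ≠ 0) {W : Set ℂ} (hW : W ∈ 𝓝 z) : ∃ V ∈ 𝓝 z, V ⊆ W ∧
      IsPreconnected (V ∩ {w | g z < g w}) ∧ IsPreconnected (V ∩ {w | g w < g z}) := by
  have hr : (g' : ℂ →ₗ[ℝ] ℝ).range = ⊤ :=
    LinearMap.range_eq_top.2 (LinearMap.surjective fun h => hg' (ContinuousLinearMap.coe_inj.1 h))
  set Φ := hg.implicitToOpenPartialHomeomorph g g' hr with hΦ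
  have hz : z ∈ Φ.source := hg.mem_implicitToOpenPartialHomeomorph_source hr
  have hfst : ∀ w, (Φ w).1 = g w := fun w => hg.implicitToOpenPartialHomeomorph_fst hr w
  have h1 : Φ.target ∩ Φ.symm ⁻¹' W ∈ 𝓝 (Φ z) := by
    refine Filter.inter_mem (Φ.open_target.mem_nhds (Φ.map_source hz)) ?_
    exact (Φ.symm.continuousAt (Φ.map_source hz)).preimage_mem_nhds (by rwa [Φ.left_inv hz])
  obtain ⟨ε, hε, hb⟩ := Metric.mem_nhds_iff.1 h1
  have hV : ∀ T : Set ℝ, Convex ℝ T →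
      IsPreconnected (Φ.symm '' Metric.ball (Φ z) ε ∩ {w | g w ∈ T}) := by
    intro T hT
    have : Φ.symm '' Metric.ball (Φ z) ε ∩ {w | g w ∈ T} =
        Φ.symm '' (Metric.ball (Φ z) ε ∩ Prod.fst ⁻¹' T) := by
      ext w
      constructor
      · rintro ⟨⟨y, hy, rfl⟩, hw⟩
        refine ⟨y, ⟨hy, ?_⟩, rfl⟩
        have := hfst (Φ.symm y)
        rw [Φ.right_inv (hb hy).1] at this
        rw [Set.mem_preimage, this]
        exact hw
      · rintro ⟨y, ⟨hy, hy'⟩, rfl⟩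
        refine ⟨⟨y, hy, rfl⟩, ?_⟩
        have := hfst (Φ.symm y)
        rw [Φ.right_inv (hb hy).1] at this
        rw [Set.mem_ofPred_eq, ← this]
        exact hy'
    rw [this]
    refine (((convex_ball _ _).inter (hT.linear_preimage
      (LinearMap.fst ℝ ℝ _))).isPreconnected).image _ ?_
    exact Φ.continuousOn_symm.mono fun y hy => (hb hy.1).1
  refine ⟨Φ.symm '' Metric.ball (Φ z) ε, ?_, ?_, hV _ (convex_Ioi (g z)), hV _ (convex_Iio (g z))⟩
  · have := Φ.symm.image_mem_nhds (Φ.map_source hz) (Metric.ball_mem_nhds (Φ z) hε)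
    rwa [Φ.left_inv hz] at this
  · rintro _ ⟨y, hy, rfl⟩
    exact (hb hy).2

section Sides

variable {F : Type} [TopologicalSpace F] [ChartedSpace (E 2) F]
  {o : SurfaceOrientation F} {φ : OpenPartialHomeomorph F (E 2)} {x : F} {S : Set F}
  {l : ℂ →L[ℝ] ℝ}

/-- Around `x`, the set `S` is the zero set of a function with differential `l` at `x`. -/
def IsLevelSet (φ : OpenPartialHomeomorph F (E 2)) (S : Set F) (x : F) (l : ℂ →L[ℝ] ℝ) : Prop :=
  ∃ g : ℂ → ℝ, HasStrictFDerivAt g l (complexChart φ x) ∧ g (complexChart φ x) = 0 ∧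
    ∀ᶠ z in 𝓝 (complexChart φ x), (complexChart φ).symm z ∈ S ↔ g z = 0

/-- Along any curve leaving `x` the defining function has derivative `l` of the velocity, so its
sign decides which side is entered, whichever curve represents the velocity. -/
theorem IsLevelSet.exists_sides (hS : IsLevelSet φ S x l) (hφ : φ ∈ o.charts)
    (hx : x ∈ φ.source) (hl : l ≠ 0) {W : Set F} (hW : W ∈ 𝓝 x) : ∃ P M : Set F,
      P ⊆ W ∧ M ⊆ W ∧ IsPreconnected P ∧ IsPreconnected M ∧ (∀ y ∈ P, y ∉ S) ∧ (∀ y ∈ M, y ∉ S) ∧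
      (∀ᶠ y in 𝓝 x, y ∈ S ∨ y ∈ P ∨ y ∈ M) ∧
      ∀ (β : ℝ → F) (v : TangentSpace (𝓡 2) x), HasVelocityAt β 0 x v →
        (0 < l (chartDeriv φ x v) → ∀ᶠ t in 𝓝[>] 0, β t ∈ P) ∧
        (l (chartDeriv φ x v) < 0 → ∀ᶠ t in 𝓝[>] 0, β t ∈ M) := by
  obtain ⟨g, hg, hg0, hgS⟩ := hS
  set ψ := complexChart φ with hψ
  have hxψ : x ∈ ψ.source := hx
  have hT : (ψ.target ∩ ψ.symm ⁻¹' W) ∩ {z | ψ.symm z ∈ S ↔ g z = 0} ∈ 𝓝 (ψ x) := by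
    refine Filter.inter_mem (Filter.inter_mem (ψ.open_target.mem_nhds (ψ.map_source hxψ)) ?_) hgS
    exact (ψ.symm.continuousAt (ψ.map_source hxψ)).preimage_mem_nhds (by rwa [ψ.left_inv hxψ])
  obtain ⟨V, hV, hVT, hVp, hVm⟩ := SurfaceKnot.exists_sides hg hl hT
  rw [hg0] at hVp hVm
  have hnear : ∀ᶠ y in 𝓝 x, y ∈ ψ.source ∧ ψ y ∈ V :=
    Filter.Eventually.and (ψ.open_source.mem_nhds hxψ) ((ψ.continuousAt hxψ).preimage_mem_nhds hV)
  have hcs : ContinuousOn ψ.symm V := ψ.continuousOn_symm.mono fun z hz => (hVT hz).1.1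
  refine ⟨ψ.symm '' (V ∩ {w | 0 < g w}), ψ.symm '' (V ∩ {w | g w < 0}), ?_, ?_,
    hVp.image _ (hcs.mono Set.inter_subset_left), hVm.image _ (hcs.mono Set.inter_subset_left),
    ?_, ?_, ?_, ?_⟩
  · rintro _ ⟨z, hz, rfl⟩; exact (hVT hz.1).1.2
  · rintro _ ⟨z, hz, rfl⟩; exact (hVT hz.1).1.2
  · rintro _ ⟨z, hz, rfl⟩ hS; exact hz.2.ne' ((hVT hz.1).2.1 hS)
  · rintro _ ⟨z, hz, rfl⟩ hS; exact hz.2.ne ((hVT hz.1).2.1 hS)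
  · filter_upwards [hnear] with y hy
    rcases lt_trichotomy (g (ψ y)) 0 with h | h | h
    · exact Or.inr (Or.inr ⟨ψ y, ⟨hy.2, h⟩, ψ.left_inv hy.1⟩)
    · left
      have := (hVT hy.2).2.2 h
      rwa [ψ.left_inv hy.1] at this
    · exact Or.inr (Or.inl ⟨ψ y, ⟨hy.2, h⟩, ψ.left_inv hy.1⟩)
  · intro β v hβ
    have h1 := hβ.hasDerivAt hφ hx
    have hβc : Filter.Tendsto β (𝓝[>] 0) (𝓝 x) := by
      have := hβ.2.continuousAt.tendsto
      rw [hβ.1] at this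
      exact this.mono_left nhdsWithin_le_nhds
    have hg1 : HasFDerivAt g l (ψ (β 0)) := by rw [hβ.1]; exact hg.hasFDerivAt
    have h2 : HasDerivAt (fun s => g (ψ (β s))) (l (chartDeriv φ x v)) 0 :=
      hg1.comp_hasDerivAt 0 h1
    have h0 : g (ψ (β 0)) = 0 := by rw [hβ.1, hg0]
    constructor
    · intro hpos
      filter_upwards [(eventually_lt_of_hasDerivAt h2 hpos).1, hβc.eventually hnear] with t ht ht'
      rw [h0] at ht
      exact ⟨ψ (β t), ⟨ht'.2, ht⟩, ψ.left_inv ht'.1⟩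
    · intro hneg
      filter_upwards [(eventually_lt_of_hasDerivAt h2.neg (neg_pos.2 hneg)).1,
        hβc.eventually hnear] with t ht ht'
      simp only [Pi.neg_apply, h0, neg_zero, Left.neg_pos_iff] at ht
      exact ⟨ψ (β t), ⟨ht'.2, ht⟩, ψ.left_inv ht'.1⟩

/-! ### Simple points of families of curves -/

/-- The curves of `L` pass through the point `x` only at the parameter `p`. -/
def Curves.IsSimpleAt (L : Curves F) (p : L.ι × ℝ) (x : F) : Prop :=
  L.point p = x ∧ ∀ q, L.point q = x → L.SameParam p q

/-- The parameters in `[0, 1]` with no integer translate in `O` form a compact set; its image is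
closed and misses `x`. -/
theorem Curves.eventually_params [T2Space F] (L : Curves F) (x : F) {O : L.ι → Set ℝ}
    (hO : ∀ i, IsOpen (O i)) (h : ∀ i t, L.curve i t = x → ∃ k : ℤ, t + k ∈ O i) :
    ∀ᶠ y in 𝓝 x, ∀ i t, L.curve i t = y → ∃ k : ℤ, t + k ∈ O i := by
  rw [Filter.eventually_all]
  intro i
  have hC : IsCompact (Set.Icc (0 : ℝ) 1 \ ⋃ k : ℤ, (fun t : ℝ => t + k) ⁻¹' O i) :=
    isCompact_Icc.diff (isOpen_iUnion fun k => (hO i).preimage (by fun_prop))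
  have hcl := (hC.image (L.continuous_curve i)).isClosed
  have hx : x ∉ L.curve i '' (Set.Icc (0 : ℝ) 1 \ ⋃ k : ℤ, (fun t : ℝ => t + k) ⁻¹' O i) := by
    rintro ⟨t, ⟨-, ht⟩, rfl⟩
    exact ht (Set.mem_iUnion.2 (h i t rfl))
  filter_upwards [hcl.isOpen_compl.mem_nhds hx] with y hy t ht
  by_contra hcon
  refine hy ⟨Int.fract t, ⟨⟨Int.fract_nonneg t, (Int.fract_lt_one t).le⟩, fun hmem => ?_⟩, ?_⟩
  · obtain ⟨k, hk⟩ := Set.mem_iUnion.1 hmem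
    refine hcon ⟨k - ⌊t⌋, ?_⟩
    have : t + ((k - ⌊t⌋ : ℤ) : ℝ) = Int.fract t + k := by
      rw [Int.fract]; push_cast; ring
    rwa [this]
  · rw [← ht, Int.fract]
    have := (L.periodic i).sub_zsmul_eq (x := t) ⌊t⌋
    simpa using this

theorem Curves.curve_add_int (L : Curves F) (i : L.ι) (t : ℝ) (k : ℤ) :
    L.curve i (t + k) = L.curve i t := by
  simpa using (L.periodic i).int_mul k t

theorem Curves.IsSimpleAt.eventually [T2Space F] {L : Curves F} {p : L.ι × ℝ}
    (h : L.IsSimpleAt p x) {T : Set ℝ} (hT : T ∈ 𝓝 p.2) : ∀ᶠ y in 𝓝 x, ∀ i t,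
      L.curve i t = y → i = p.1 ∧ ∃ k : ℤ, t + k ∈ T := by
  obtain ⟨T', hT', hT'o, hpT'⟩ := mem_nhds_iff.1 hT
  have := L.eventually_params x (O := fun i => {t | i = p.1 ∧ t ∈ T'})
    (fun i => by
      by_cases hi : i = p.1
      · simpa [hi] using hT'o
      · simp [hi])
    (fun i t ht => by
      obtain ⟨h1, k, hk⟩ := h.2 (i, t) ht
      refine ⟨-k, h1.symm, ?_⟩
      simp only at hk
      rw [hk]; simpa using hpT')
  filter_upwards [this] with y hy i t ht
  obtain ⟨k, hk, hk'⟩ := hy i t ht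
  exact ⟨hk, k, hT' hk'⟩

/-- The linear form `a ↦ im (a / w)`. -/
def sideForm (w : ℂ) : ℂ →L[ℝ] ℝ :=
  Complex.imCLM ∘L ((ContinuousLinearMap.mul ℝ ℂ).flip w⁻¹)

theorem sideForm_apply (w a : ℂ) : sideForm w a = (a / w).im := by
  simp [sideForm, div_eq_mul_inv]
  ring

theorem sideForm_pos_iff {w a : ℂ} (hw : w ≠ 0) :
    0 < sideForm w a ↔ 0 < (starRingEnd ℂ w * a).im := by
  have h : starRingEnd ℂ w * a = (Complex.normSq w : ℂ) * (a / w) := by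
    rw [Complex.normSq_eq_conj_mul_self]; field_simp
  rw [sideForm_apply, h, Complex.im_ofReal_mul, mul_pos_iff_of_pos_left (Complex.normSq_pos.2 hw)]

theorem sideForm_ne_zero {w : ℂ} (hw : w ≠ 0) : sideForm w ≠ 0 := by
  intro h
  have := sideForm_apply w (Complex.I * w)
  rw [h, mul_div_cancel_right₀ _ hw] at this
  simp at this

theorem HasVelocityAt.chartDeriv_ne_zero {L : Curves F} {p : L.ι × ℝ}
    {v : TangentSpace (𝓡 2) x} (h : HasVelocityAt (L.curve p.1) p.2 x v) (hφ : φ ∈ o.charts)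
    (hx : x ∈ φ.source) : chartDeriv φ x v ≠ 0 := fun h0 =>
  h.ne_zero (chartDeriv_injective hφ hx (h0.trans (map_zero _).symm))

/-- The curve is straightened by the inverse function theorem, and the imaginary part of the
straightening coordinate is the equation. Simplicity excludes other passages of the curves near `x`.
-/
theorem Curves.IsSimpleAt.isLevelSet [T2Space F] {L : Curves F} {p : L.ι × ℝ}
    (h : L.IsSimpleAt p x) {v : TangentSpace (𝓡 2) x}
    (hv : HasVelocityAt (L.curve p.1) p.2 x v) (hφ : φ ∈ o.charts) (hx : x ∈ φ.source) :
    IsLevelSet φ L.support x (sideForm (chartDeriv φ x v)) := by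
  set ψ := complexChart φ with hψ
  set w := chartDeriv φ x v with hw
  have hw0 : w ≠ 0 := hv.chartDeriv_ne_zero hφ hx
  have hxψ : x ∈ ψ.source := hx
  let Γ : ℝ → ℂ := fun t => ψ (L.curve p.1 t)
  have hΓ : HasStrictDerivAt Γ w p.2 := hv.hasStrictDerivAt hφ hx
  have hΓx : Γ p.2 = ψ x := by simp only [Γ, hv.1]
  let A : ℂ ≃L[ℝ] ℂ := (ContinuousLinearEquiv.unitsEquivAut ℂ (Units.mk0 w hw0)).restrictScalars ℝ
  have hAapp : ∀ z, A z = z * w := fun z => by simp [A]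
  -- The real part runs along the curve and the imaginary part along its normal `i w`, so the
  -- derivative at the parameter is multiplication by `w`.
  let Ψ : ℂ → ℂ := fun ζ => Γ ζ.re + (ζ.im : ℂ) * (Complex.I * w)
  have hΨ : HasStrictFDerivAt Ψ (A : ℂ →L[ℝ] ℂ) (p.2 : ℂ) := by
    have h1 : HasStrictFDerivAt (fun ζ : ℂ => Γ ζ.re)
        ((ContinuousLinearMap.toSpanSingleton ℝ w) ∘L Complex.reCLM) (p.2 : ℂ) := by
      have h2 : HasStrictFDerivAt Γ (ContinuousLinearMap.toSpanSingleton ℝ w)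
          (Complex.reCLM (p.2 : ℂ)) := by simpa using hΓ.hasStrictFDerivAt
      exact h2.comp (p.2 : ℂ) (f := Complex.reCLM) Complex.reCLM.hasStrictFDerivAt
    have h2 := ((Complex.ofRealCLM ∘L Complex.imCLM).hasStrictFDerivAt (x := (p.2 : ℂ))).mul_const
      (Complex.I * w)
    refine (h1.add h2).congr_fderiv ?_
    apply ContinuousLinearMap.ext
    intro z
    simp [hAapp]
    linear_combination w * Complex.re_add_im z
  have hΨx : Ψ (p.2 : ℂ) = ψ x := by simp [Ψ, hΓx]
  set loc := hΨ.localInverse Ψ A (p.2 : ℂ) with hloc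
  have hd := hΨ.to_localInverse
  have hc := hΨ.localInverse_tendsto
  have hl := hΨ.eventually_left_inverse
  have hr := hΨ.eventually_right_inverse
  have hi := hΨ.localInverse_apply_image
  rw [hΨx] at hd hc hr hi
  rw [← hloc] at hd hc hl hr hi
  refine ⟨fun z => (loc z).im, ?_, by change (loc (ψ x)).im = 0; rw [hi, Complex.ofReal_im], ?_⟩
  · have := (Complex.imCLM.hasStrictFDerivAt (x := loc (ψ x))).comp _ hd
    refine this.congr_fderiv ?_
    apply ContinuousLinearMap.ext
    intro a
    rw [sideForm_apply]
    have : A.symm a = a / w := by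
      rw [ContinuousLinearEquiv.symm_apply_eq, hAapp, div_mul_cancel₀ _ hw0]
    simp [this]
  · have hT : {t : ℝ | loc (Ψ t) = t} ∈ 𝓝 p.2 :=
      (Complex.continuous_ofReal.continuousAt (x := p.2)).eventually hl
    have hs : Filter.Tendsto ψ.symm (𝓝 (ψ x)) (𝓝 x) := by
      have := ψ.symm.continuousAt (ψ.map_source hxψ)
      rwa [ContinuousAt, ψ.left_inv hxψ] at this
    have hsrc : ∀ᶠ z in 𝓝 (ψ x), L.curve p.1 (loc z).re ∈ ψ.source := by
      have h1 : Filter.Tendsto (fun z => L.curve p.1 (loc z).re) (𝓝 (ψ x)) (𝓝 x) := by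
        have h2 : Filter.Tendsto (fun z => (loc z).re) (𝓝 (ψ x)) (𝓝 p.2) := by
          have := (Complex.continuous_re.tendsto _).comp hc
          simpa [Function.comp_def] using this
        have h3 := (L.continuous_curve p.1).tendsto p.2
        rw [hv.1] at h3
        exact h3.comp h2
      exact h1.eventually (ψ.open_source.mem_nhds hxψ)
    filter_upwards [hs.eventually (h.eventually hT), hr, hsrc,
      ψ.open_target.mem_nhds (ψ.map_source hxψ)] with z hz hzr hzs hzt
    constructor
    · intro hzL
      obtain ⟨i, t, hit⟩ := Set.mem_iUnion.1 hzL
      obtain ⟨rfl, k, hk⟩ := hz i t hit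
      have h1 : Ψ ((t + k : ℝ) : ℂ) = z := by
        simp only [Ψ, Γ, Complex.ofReal_re, Complex.ofReal_im, L.curve_add_int]
        rw [hit, ψ.right_inv hzt]
        simp
      have h2 : loc (Ψ ((t + k : ℝ) : ℂ)) = ((t + k : ℝ) : ℂ) := hk
      rw [h1] at h2
      rw [h2, Complex.ofReal_im]
    · intro hz0
      have h1 : ψ (L.curve p.1 (loc z).re) = z := by
        have := hzr
        simp only [Ψ, Γ, hz0] at this
        simpa using this
      rw [← h1, ψ.left_inv hzs]
      exact L.curve_mem_support _ _

end Sides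

/-! ### Multiple points are isolated -/

section Multiple

variable {F : Type} [TopologicalSpace F] [ChartedSpace (E 2) F]
  {o : SurfaceOrientation F} {φ : OpenPartialHomeomorph F (E 2)} {x : F}

theorem HasVelocityAt.tendsto {β : ℝ → F} {t : ℝ} {v : TangentSpace (𝓡 2) x}
    (h : HasVelocityAt β t x v) : Filter.Tendsto β (𝓝 t) (𝓝 x) := by
  have := h.2.continuousAt.tendsto
  rwa [h.1] at this

theorem Curves.exists_injOn (o : SurfaceOrientation F) (L : Curves F) (i : L.ι) (t : ℝ) :
    ∃ T ∈ 𝓝 t, Set.InjOn (L.curve i) T := by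
  obtain ⟨φ, hφ, hx⟩ := o.cover (L.curve i t)
  have hv := L.hasVelocityAt i t
  have h1 := hv.hasStrictDerivAt hφ hx
  have hw := HasVelocityAt.chartDeriv_ne_zero (p := (i, t)) hv hφ hx
  set w := chartDeriv φ (L.curve i t) (mfderiv 𝓘(ℝ, ℝ) (𝓡 2) (L.curve i) t (1 : ℝ))
  have h2 : HasStrictDerivAt (fun s => (complexChart φ (L.curve i s) / w).re) 1 t := by
    have := (Complex.reCLM.hasStrictFDerivAt.comp_hasStrictDerivAt t (h1.div_const w))
    simpa [div_self hw, Function.comp_def] using this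
  have h3 := h2.hasStrictFDerivAt_equiv one_ne_zero
  refine ⟨_, h3.eventually_left_inverse, fun s hs s' hs' hss => ?_⟩
  simp only [Set.mem_ofPred_eq] at hs hs'
  rw [← hs, ← hs', hss]

/-- By transversality the difference of the two branches, as a function of both parameters, has
injective derivative, so its zero is isolated. -/
theorem Curves.IsOn.eventually_eq_of_point_eq {D : Diagram F} {L : Curves F} (hL : L.IsOn D)
    {p q : L.ι × ℝ} (hpq : ¬ L.SameParam p q) (hp : L.point p = x) (hq : L.point q = x) :
    ∃ T ∈ 𝓝 p.2, ∃ T' ∈ 𝓝 q.2, ∀ s ∈ T, ∀ s' ∈ T', L.curve p.1 s = L.curve q.1 s' → s = p.2 := by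
  obtain ⟨φ, hφ, hx⟩ := D.orientation.cover x
  have hv := L.hasVelocityAt p.1 p.2
  have hv' := L.hasVelocityAt q.1 q.2
  subst hp
  have hq' : L.curve q.1 q.2 = L.curve p.1 p.2 := hq
  rw [hq'] at hv'
  obtain ⟨v, hv⟩ : ∃ v : TangentSpace (𝓡 2) (L.point p),
      HasVelocityAt (L.curve p.1) p.2 (L.point p) v := ⟨_, hv⟩
  obtain ⟨v', hv'⟩ : ∃ v' : TangentSpace (𝓡 2) (L.point p),
      HasVelocityAt (L.curve q.1) q.2 (L.point p) v' := ⟨_, hv'⟩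
  have hli := hL.transverse p q hpq _ _ _ hv hv'
  have h1 := hv.hasDerivAt hφ hx
  have h2 := hv'.hasDerivAt hφ hx
  set w := chartDeriv φ (L.point p) v
  set w' := chartDeriv φ (L.point p) v'
  have h3 : HasFDerivAt (fun s : ℝ × ℝ =>
      complexChart φ (L.curve p.1 s.1) - complexChart φ (L.curve q.1 s.2))
      ((ContinuousLinearMap.toSpanSingleton ℝ w) ∘L (ContinuousLinearMap.fst ℝ ℝ ℝ) -
        (ContinuousLinearMap.toSpanSingleton ℝ w') ∘L (ContinuousLinearMap.snd ℝ ℝ ℝ))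
      (p.2, q.2) := by
    have e1 := HasFDerivAt.comp (p.2, q.2) (f := Prod.fst) (h1.hasFDerivAt) hasFDerivAt_fst
    have e2 := HasFDerivAt.comp (p.2, q.2) (f := Prod.snd) (h2.hasFDerivAt) hasFDerivAt_snd
    exact e1.sub e2
  set A := (ContinuousLinearMap.toSpanSingleton ℝ w) ∘L (ContinuousLinearMap.fst ℝ ℝ ℝ) -
        (ContinuousLinearMap.toSpanSingleton ℝ w') ∘L (ContinuousLinearMap.snd ℝ ℝ ℝ) with hA
  have hker : (A : ℝ × ℝ →ₗ[ℝ] ℂ).ker = ⊥ := by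
    rw [LinearMap.ker_eq_bot']
    rintro ⟨a, b⟩ hab
    have hab' : a • w - b • w' = 0 := by simpa [hA] using hab
    have h0 : chartDeriv φ (L.point p) (a • v + (-b) • v') = chartDeriv φ (L.point p) 0 := by
      rw [map_add, map_smul, map_smul, map_zero, neg_smul, ← sub_eq_add_neg]
      exact hab'
    have := LinearIndependent.pair_iff.1 hli a (-b) (chartDeriv_injective hφ hx h0)
    ext
    · exact this.1
    · exact neg_eq_zero.1 this.2
  obtain ⟨C, -, hC⟩ := LinearMap.exists_antilipschitzWith (A : ℝ × ℝ →ₗ[ℝ] ℂ) hker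
  have hev := h3.eventually_ne ⟨C, hC⟩ (c := 0)
  rw [eventually_nhdsWithin_iff, nhds_prod_eq, Filter.eventually_prod_iff] at hev
  obtain ⟨P, hP, Q, hQ, hPQ⟩ := hev
  refine ⟨_, hP, _, hQ, fun s hs s' hs' hss => ?_⟩
  by_contra hne
  exact hPQ hs hs' (fun h => hne (congrArg Prod.fst h)) (by simp [hss])

theorem Curves.SameParam.symm {L : Curves F} {p q : L.ι × ℝ} (h : L.SameParam p q) :
    L.SameParam q p := by
  obtain ⟨h1, k, hk⟩ := h
  exact ⟨h1.symm, -k, by rw [hk]; simp⟩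

theorem Curves.SameParam.trans {L : Curves F} {p q r : L.ι × ℝ} (h : L.SameParam p q)
    (h' : L.SameParam q r) : L.SameParam p r := by
  obtain ⟨h1, k, hk⟩ := h
  obtain ⟨h2, k', hk'⟩ := h'
  exact ⟨h1.trans h2, k + k', by rw [hk', hk]; push_cast; ring⟩

/-- At most two branches pass through `x`. Each is locally injective, and if there are two they meet
only at `x` nearby, so any other nearby point on the curves is passed once. -/
theorem Curves.IsOn.eventually_isSimpleAt [T2Space F] {D : Diagram F} {L : Curves F}
    (hL : L.IsOn D) (x : F) : ∀ᶠ y in 𝓝[≠] x, ∀ p, L.point p = y → L.IsSimpleAt p y := by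
  by_cases hx : x ∈ L.support
  swap
  · filter_upwards [nhdsWithin_le_nhds (L.isClosed_support.isOpen_compl.mem_nhds hx)] with y hy p hp
    exact absurd (hp ▸ L.curve_mem_support p.1 p.2) hy
  obtain ⟨i, t, hit⟩ := Set.mem_iUnion.1 hx
  -- The parameter `q` is the second branch if there is one, and the first branch again otherwise.
  obtain ⟨q, hq, hcase⟩ : ∃ q : L.ι × ℝ, L.point q = x ∧
      ∀ r, L.point r = x → L.SameParam r (i, t) ∨ L.SameParam r q := by
    by_cases h : ∀ r, L.point r = x → L.SameParam r (i, t)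
    · exact ⟨(i, t), hit, fun r hr => Or.inl (h r hr)⟩
    · push Not at h
      obtain ⟨q, hq, hqn⟩ := h
      refine ⟨q, hq, fun r hr => ?_⟩
      rcases hL.double (i, t) q r (hit.trans hq.symm) (hit.trans hr.symm) with h | h | h
      · exact absurd h.symm hqn
      · exact Or.inl h.symm
      · exact Or.inr h.symm
  obtain ⟨T, hT, hTinj⟩ := L.exists_injOn D.orientation i t
  obtain ⟨T', hT', hTinj'⟩ := L.exists_injOn D.orientation q.1 q.2
  obtain ⟨U, hU, U', hU', hUU⟩ : ∃ U ∈ 𝓝 t, ∃ U' ∈ 𝓝 q.2, ¬ L.SameParam (i, t) q →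
      ∀ s ∈ U, ∀ s' ∈ U', L.curve i s = L.curve q.1 s' → s = t := by
    by_cases h : L.SameParam (i, t) q
    · exact ⟨_, Filter.univ_mem, _, Filter.univ_mem, fun h' => absurd h h'⟩
    · obtain ⟨U, hU, U', hU', hUU⟩ := hL.eventually_eq_of_point_eq (p := (i, t)) h hit hq
      exact ⟨U, hU, U', hU', fun _ => hUU⟩
  set A : Set ℝ := interior (T ∩ U) with hA
  set B : Set ℝ := interior (T' ∩ U') with hB
  have htA : t ∈ A := mem_interior_iff_mem_nhds.2 (Filter.inter_mem hT hU)
  have hqB : q.2 ∈ B := mem_interior_iff_mem_nhds.2 (Filter.inter_mem hT' hU')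
  by_cases hiq : L.SameParam (i, t) q
  · have hsimple : L.IsSimpleAt (i, t) x := ⟨hit, fun r hr =>
      (hcase r hr).elim (fun h => h.symm) fun h => hiq.trans h.symm⟩
    filter_upwards [nhdsWithin_le_nhds (hsimple.eventually hT)] with y hy p hp
    refine ⟨hp, fun r hr => ?_⟩
    obtain ⟨hpi, k, hk⟩ := hy p.1 p.2 hp
    obtain ⟨hri, l, hl⟩ := hy r.1 r.2 hr
    have := hTinj hk hl (by
      rw [L.curve_add_int, L.curve_add_int, ← hpi]
      conv_rhs => rw [hpi, ← hri]
      exact hp.trans hr.symm)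
    exact ⟨hpi.trans hri.symm, k - l, by push_cast; linarith⟩
  · have hev := L.eventually_params x
      (O := fun j => ({_s | j = i} ∩ A) ∪ ({_s | j = q.1} ∩ B))
      (fun j => (isOpen_const.inter isOpen_interior).union (isOpen_const.inter isOpen_interior))
      (fun j s hs => by
        rcases hcase (j, s) hs with ⟨h1, k, hk⟩ | ⟨h1, k, hk⟩
        · simp only at h1 hk
          exact ⟨k, Or.inl ⟨h1, hk ▸ htA⟩⟩
        · simp only at h1 hk
          exact ⟨k, Or.inr ⟨h1, hk ▸ hqB⟩⟩)
    filter_upwards [nhdsWithin_le_nhds hev, self_mem_nhdsWithin] with y hy hyx p hp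
    have hmix : ∀ s ∈ A, ∀ s' ∈ B, L.curve i s = y → L.curve q.1 s' = y → False := by
      intro s hs s' hs' h1 h2
      have := hUU hiq s (interior_subset hs).2 s' (interior_subset hs').2 (h1.trans h2.symm)
      exact hyx (by rw [Set.mem_singleton_iff, ← h1, this, hit])
    refine ⟨hp, fun r hr => ?_⟩
    obtain ⟨k, hk⟩ := hy p.1 p.2 hp
    obtain ⟨l, hl⟩ := hy r.1 r.2 hr
    have hp' : L.curve p.1 (p.2 + k) = y := (L.curve_add_int _ _ _).trans hp
    have hr' : L.curve r.1 (r.2 + l) = y := (L.curve_add_int _ _ _).trans hr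
    rcases hk with ⟨hk1, hk⟩ | ⟨hk1, hk⟩ <;> rcases hl with ⟨hl1, hl⟩ | ⟨hl1, hl⟩ <;>
      rw [hk1] at hp' <;> rw [hl1] at hr'
    · have := hTinj (interior_subset hk).1 (interior_subset hl).1 (hp'.trans hr'.symm)
      exact ⟨hk1.trans hl1.symm, k - l, by push_cast; linarith⟩
    · exact (hmix _ hk _ hl hp' hr').elim
    · exact (hmix _ hl _ hk hr' hp').elim
    · have := hTinj' (interior_subset hk).1 (interior_subset hl).1 (hp'.trans hr'.symm)
      exact ⟨hk1.trans hl1.symm, k - l, by push_cast; linarith⟩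

theorem neBot_nhdsNE (o : SurfaceOrientation F) (x : F) : (𝓝[≠] x).NeBot := by
  obtain ⟨φ, hφ, hx⟩ := o.cover x
  obtain ⟨v, -, hv⟩ := exists_velocity hφ hx 1
  have ht : Filter.Tendsto (fun t : ℝ => (complexChart φ).symm (complexChart φ x + t * 1)) (𝓝[>] 0)
      (𝓝[≠] x) := by
    refine tendsto_nhdsWithin_iff.2 ⟨?_, ?_⟩
    · exact hv.tendsto.mono_left nhdsWithin_le_nhds
    · have h1 : Filter.Tendsto (fun t : ℝ => complexChart φ x + t * 1) (𝓝[>] 0)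
          (𝓝 (complexChart φ x)) := by
        have : ContinuousAt (fun t : ℝ => complexChart φ x + t * 1) 0 := by fun_prop
        have := this.tendsto
        simp only [Complex.ofReal_zero, zero_mul, add_zero] at this
        exact this.mono_left nhdsWithin_le_nhds
      filter_upwards [h1.eventually ((complexChart φ).open_target.mem_nhds
        ((complexChart φ).map_source hx)), self_mem_nhdsWithin] with t ht ht0 h
      rw [Set.mem_singleton_iff] at h
      have h2 := (complexChart φ).right_inv ht
      rw [h] at h2
      simp only [mul_one, left_eq_add, Complex.ofReal_eq_zero] at h2
      exact (ne_of_gt ht0) h2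
  exact ht.neBot

theorem Curves.IsSimpleAt.exists_notMem_support [T2Space F] {L : Curves F} {p : L.ι × ℝ}
    (o : SurfaceOrientation F) (h : L.IsSimpleAt p x) {W : Set F} (hW : W ∈ 𝓝 x) :
    ∃ y ∈ W, y ∉ L.support := by
  obtain ⟨φ, hφ, hx⟩ := o.cover x
  have hv := L.hasVelocityAt p.1 p.2
  rw [show L.curve p.1 p.2 = x from h.1] at hv
  have hw := hv.chartDeriv_ne_zero hφ hx
  obtain ⟨P, M, hP, -, -, -, hPS, -, -, hβ⟩ :=
    (h.isLevelSet hv hφ hx).exists_sides hφ hx (sideForm_ne_zero hw) hW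
  obtain ⟨n, hn, hn'⟩ := exists_velocity hφ hx (Complex.I * chartDeriv φ x _)
  have h1 := (hβ _ n hn').1 (by
    rw [hn, sideForm_apply, mul_div_cancel_right₀ _ hw]; simp)
  obtain ⟨t, ht⟩ := h1.exists
  exact ⟨_, hP ht, hPS _ ht⟩

/-- Every neighbourhood contains a point off the curves or a simple point, and at a simple point the
curve is left along its normal. -/
theorem Curves.IsOn.dense_compl_support [T2Space F] {D : Diagram F} {L : Curves F}
    (hL : L.IsOn D) : Dense L.supportᶜ := by
  intro x
  rw [mem_closure_iff_nhds]
  intro W hW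
  have := neBot_nhdsNE D.orientation x
  have hW' : ∀ᶠ y in 𝓝[≠] x, y ∈ interior W := nhdsWithin_le_nhds (interior_mem_nhds.2 hW)
  obtain ⟨y, hyW, hy⟩ := (hW'.and (hL.eventually_isSimpleAt x)).exists
  by_cases hyL : y ∈ L.support
  · obtain ⟨i, t, hit⟩ := Set.mem_iUnion.1 hyL
    obtain ⟨z, hz, hzL⟩ := (hy (i, t) hit).exists_notMem_support D.orientation
      (isOpen_interior.mem_nhds hyW)
    exact ⟨z, interior_subset hz, hzL⟩
  · exact ⟨y, interior_subset hyW, hyL⟩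

end Multiple

/-! ### Crossing a curve at a simple point -/

/-- A closed curve that meets the negative real axis once, upwards in clockwise order, turns once
around `0`. -/
theorem HasWinding.eq_one {h : ℝ → ℂ} {t₀ : ℝ} {n : ℤ} (hn : HasWinding h n)
    (hp : Function.Periodic h 1) (h0 : h t₀ = -1)
    (hs : ∀ t ∈ Set.Ioo t₀ (t₀ + 1), h t ∈ Complex.slitPlane)
    (him : ∀ᶠ t in 𝓝[>] t₀, (h t).im < 0) (him' : ∀ᶠ t in 𝓝[<] t₀, 0 < (h t).im) : n = 1 := by
  obtain ⟨H, hH, he, hper⟩ := hn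
  have hc : Continuous h := by
    have : h = fun t => Complex.exp (H t) := funext fun t => (he t).symm
    rw [this]; fun_prop
  have hlog : ContinuousOn (fun t => Complex.log (h t)) (Set.Ioo t₀ (t₀ + 1)) :=
    hc.continuousOn.clog hs
  -- Between two passages through `-1` the lift is the principal logarithm plus the constant `c`.
  -- The one-sided limits of that logarithm are `-πi` at the start and `πi` at the end, a total of
  -- `2πi`.
  set c := H (t₀ + 1 / 2) - Complex.log (h (t₀ + 1 / 2)) with hcdef
  have hconst : ∀ t ∈ Set.Ioo t₀ (t₀ + 1), Complex.log (h t) = H t - c := by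
    intro t ht
    have := log_sub_const isPreconnected_Ioo hH.continuousOn hlog
      (fun a ha => by rw [he, Complex.exp_log (Complex.slitPlane_ne_zero (hs a ha))]) ht
      (show t₀ + 1 / 2 ∈ Set.Ioo t₀ (t₀ + 1) by constructor <;> linarith)
    rw [hcdef, ← this]; ring
  have h1 : H t₀ - c = - Real.pi * Complex.I := by
    have l1 : Filter.Tendsto (fun t => Complex.log (h t)) (𝓝[>] t₀) (𝓝 (- Real.pi * Complex.I)) := by
      have hh : Filter.Tendsto h (𝓝[>] t₀) (𝓝[{z | z.im < 0}] (-1)) :=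
        tendsto_nhdsWithin_iff.2 ⟨h0 ▸ (hc.tendsto t₀).mono_left nhdsWithin_le_nhds, him⟩
      have := (Complex.tendsto_log_nhdsWithin_im_neg_of_re_neg_of_im_zero
        (z := -1) (by simp) (by simp)).comp hh
      simpa [Function.comp_def] using this
    have l2 : Filter.Tendsto (fun t => Complex.log (h t)) (𝓝[>] t₀) (𝓝 (H t₀ - c)) := by
      refine Filter.Tendsto.congr' ?_
        (((hH.sub continuous_const).tendsto t₀).mono_left nhdsWithin_le_nhds)
      filter_upwards [Ioo_mem_nhdsGT (show t₀ < t₀ + 1 by linarith)] with t ht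
      exact (hconst t ht).symm
    exact tendsto_nhds_unique l2 l1
  have h2 : H (t₀ + 1) - c = Real.pi * Complex.I := by
    have hsh : Filter.Tendsto (fun t : ℝ => t - 1) (𝓝[<] (t₀ + 1)) (𝓝[<] t₀) := by
      refine tendsto_nhdsWithin_iff.2 ⟨?_, ?_⟩
      · have : Filter.Tendsto (fun t : ℝ => t - 1) (𝓝 (t₀ + 1)) (𝓝 (t₀ + 1 - 1)) :=
          (continuous_id.sub continuous_const).tendsto _
        rw [add_sub_cancel_right] at this
        exact this.mono_left nhdsWithin_le_nhds
      · filter_upwards [self_mem_nhdsWithin] with t ht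
        rw [Set.mem_Iio] at *
        linarith
    have hperiod : ∀ t, h (t - 1) = h t := fun t => hp.sub_eq t
    have l1 : Filter.Tendsto (fun t => Complex.log (h t)) (𝓝[<] (t₀ + 1))
        (𝓝 (Real.pi * Complex.I)) := by
      have hh : Filter.Tendsto h (𝓝[<] (t₀ + 1)) (𝓝[{z | 0 ≤ z.im}] (-1)) := by
        refine tendsto_nhdsWithin_iff.2 ⟨?_, ?_⟩
        · have h3 : h (t₀ + 1) = -1 := by rw [hp, h0]
          exact h3 ▸ (hc.tendsto (t₀ + 1)).mono_left nhdsWithin_le_nhds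
        · filter_upwards [hsh.eventually him'] with t ht
          rw [hperiod] at ht
          exact ht.le
      have := (Complex.tendsto_log_nhdsWithin_im_nonneg_of_re_neg_of_im_zero
        (z := -1) (by simp) (by simp)).comp hh
      simpa [Function.comp_def] using this
    have l2 : Filter.Tendsto (fun t => Complex.log (h t)) (𝓝[<] (t₀ + 1)) (𝓝 (H (t₀ + 1) - c)) := by
      refine Filter.Tendsto.congr' ?_
        (((hH.sub continuous_const).tendsto (t₀ + 1)).mono_left nhdsWithin_le_nhds)
      filter_upwards [Ioo_mem_nhdsLT (show t₀ < t₀ + 1 by linarith)] with t ht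
      exact (hconst t ht).symm
    exact tendsto_nhds_unique l2 l1
  have h3 := hper t₀
  have h4 : (n : ℂ) * (2 * Real.pi * Complex.I) = (1 : ℤ) * (2 * Real.pi * Complex.I) := by
    rw [← h3]; push_cast; linear_combination h2 - h1
  exact_mod_cast mul_right_cancel₀ Complex.two_pi_I_ne_zero h4

/-- The imaginary part of the quotient is `-2 ε re ζ / |ζ + iε|²`, so it changes from positive to
negative as a curve crosses the imaginary axis from left to right. -/
theorem im_dipole_quotient {ζ : ℂ} {ε : ℝ} (hε : 0 < ε) (hζ : ζ.re ≠ 0) :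
    0 < -(ζ.re * ((ζ - ε * Complex.I) / (ζ + ε * Complex.I)).im) := by
  have hne : ζ + ε * Complex.I ≠ 0 := fun h => hζ (by
    have := congrArg Complex.re h
    simpa using this)
  have hn := Complex.normSq_pos.2 hne
  have him : ((ζ - ε * Complex.I) / (ζ + ε * Complex.I)).im =
      -(2 * ε * ζ.re) / Complex.normSq (ζ + ε * Complex.I) := by
    rw [Complex.div_im]
    simp
    field_simp
    ring
  rw [him]
  have h2 : 0 < ζ.re ^ 2 := by positivity
  have : -(ζ.re * (-(2 * ε * ζ.re) / Complex.normSq (ζ + ε * Complex.I))) =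
      2 * ε * ζ.re ^ 2 / Complex.normSq (ζ + ε * Complex.I) := by ring
  rw [this]
  positivity

section Crossing

variable {F : Type} [TopologicalSpace F] [ChartedSpace (E 2) F] [T2Space F]
  {o : SurfaceOrientation F} {φ : OpenPartialHomeomorph F (E 2)} {x : F} {L : Curves F}
  {e : Disk F}

/-- In the coordinate `ζ = (ψ - ψ x) / w` the dipole near `x` is `(ζ - iε) / (ζ + iε)`. The curve
through `x` meets the segment between zero and pole once per period, at `ζ = 0`, where the value is
`-1`; all other curves miss the segment and contribute nothing. -/
theorem Curves.IsSimpleAt.eventually_crossing_eq_one {p : L.ι × ℝ} (hp : L.IsSimpleAt p x)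
    {v : TangentSpace (𝓡 2) x} (hv : HasVelocityAt (L.curve p.1) p.2 x v) (hφ : φ ∈ o.charts)
    (he : e.chart = complexChart φ) (hx : x ∈ e.inner) :
    ∀ᶠ ε : ℝ in 𝓝[>] 0, ∀ y ∈ e.inner, ∀ z ∈ e.inner,
      complexChart φ y = complexChart φ x - ε * (Complex.I * chartDeriv φ x v) →
      complexChart φ z = complexChart φ x + ε * (Complex.I * chartDeriv φ x v) →
      y ∉ L.support → z ∉ L.support → L.crossing e y z = 1 := by
  set ψ := complexChart φ with hψ
  set w := chartDeriv φ x v with hw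
  have hxs : x ∈ ψ.source := he ▸ hx.1
  have hw0 : w ≠ 0 := hv.chartDeriv_ne_zero hφ hxs
  let ζ : ℝ → ℂ := fun t => (ψ (L.curve p.1 t) - ψ x) / w
  have hζ : HasDerivAt (fun t => (ζ t).re) 1 p.2 := by
    have h1 := ((hv.hasDerivAt hφ hxs).sub_const (ψ x)).div_const w
    have := Complex.reCLM.hasFDerivAt.comp_hasDerivAt p.2 h1
    rw [← hw, div_self hw0] at this
    simpa [ζ, Function.comp_def] using this
  have hζ0 : ζ p.2 = 0 := by simp only [ζ, hv.1, sub_self, zero_div]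
  obtain ⟨hpos, hneg⟩ := eventually_lt_of_hasDerivAt hζ one_pos
  simp only [hζ0, Complex.zero_re] at hpos hneg
  have hT : ∀ᶠ t in 𝓝 p.2, (ζ t).re = 0 → t = p.2 := by
    rw [eventually_nhdsWithin_iff] at hpos hneg
    filter_upwards [hpos, hneg] with t h1 h2 h0
    rcases lt_trichotomy t p.2 with h | h | h
    · exact absurd h0 (h2 h).ne
    · exact h
    · exact absurd h0 (h1 h).ne'
  -- Within distance `ρ` of `x` the curves meet the normal line `re ζ = 0` only in `x`; the segment
  -- lies in this range once `ε ‖w‖ < ρ`.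
  obtain ⟨ρ, hρ, hball⟩ : ∃ ρ > 0, ∀ i t, L.curve i t ∈ ψ.source →
      ‖ψ (L.curve i t) - ψ x‖ < ρ → ((ψ (L.curve i t) - ψ x) / w).re = 0 →
      i = p.1 ∧ ∃ k : ℤ, t + k = p.2 := by
    have hs : Filter.Tendsto ψ.symm (𝓝 (ψ x)) (𝓝 x) := by
      have := ψ.symm.continuousAt (ψ.map_source hxs)
      rwa [ContinuousAt, ψ.left_inv hxs] at this
    obtain ⟨ρ, hρ, hb⟩ := Metric.eventually_nhds_iff.1 (hs.eventually (hp.eventually hT))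
    refine ⟨ρ, hρ, fun i t hts htρ h0 => ?_⟩
    obtain ⟨rfl, k, hk⟩ := hb (by rwa [dist_eq_norm]) i t (ψ.left_inv hts).symm
    exact ⟨rfl, k, hk (by simpa only [ζ, L.curve_add_int] using h0)⟩
  have hsmall : ∀ᶠ ε : ℝ in 𝓝[>] 0, ε * ‖w‖ < ρ := by
    have : Filter.Tendsto (fun ε : ℝ => ε * ‖w‖) (𝓝[>] 0) (𝓝 0) := by
      have h : ContinuousAt (fun ε : ℝ => ε * ‖w‖) 0 := by fun_prop
      have := h.tendsto
      rw [zero_mul] at this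
      exact this.mono_left nhdsWithin_le_nhds
    exact this.eventually_lt_const hρ
  filter_upwards [hsmall, self_mem_nhdsWithin] with ε hερ hε y hy z hz hyx hzx hyL hzL
  replace hε : 0 < ε := hε
  have hcx : ∀ u, e.coord u = ψ u - e.center := fun u => by rw [Disk.coord, he]
  have hslit : ∀ i t, (i = p.1 → ∀ k : ℤ, t + k ≠ p.2) →
      e.dipole z y (L.curve i t) ∈ Complex.slitPlane := by
    intro i t hit
    refine Disk.dipole_mem_slitPlane hz hy fun hs hseg => ?_
    rw [segment_eq_image] at hseg
    obtain ⟨θ, ⟨hθ0, hθ1⟩, hθ⟩ := hseg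
    have hd : ψ (L.curve i t) - ψ x = ((1 - 2 * θ) * ε : ℝ) * (Complex.I * w) := by
      simp only [hcx, hyx, hzx, Complex.real_smul] at hθ
      push_cast at hθ ⊢
      linear_combination -hθ
    obtain ⟨h1, k, hk⟩ := hball i t (he ▸ hs) (by
        rw [hd, norm_mul, norm_mul, Complex.norm_I, one_mul, Complex.norm_real, Real.norm_eq_abs,
          abs_mul, abs_of_pos hε]
        have : |1 - 2 * θ| ≤ 1 := abs_le.2 ⟨by linarith, by linarith⟩
        have hw' := norm_nonneg w
        calc |1 - 2 * θ| * ε * ‖w‖ ≤ 1 * ε * ‖w‖ := by gcongr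
          _ < ρ := by rwa [one_mul]) (by
        rw [hd, mul_div_assoc, mul_div_cancel_right₀ _ hw0]; simp)
    exact hit h1 k hk
  have hadm := e.admissible_dipole hz hy hzL hyL
  have hquot : ∀ t, L.curve p.1 t ∈ e.inner → e.dipole z y (L.curve p.1 t) =
      (ζ t - ε * Complex.I) / (ζ t + ε * Complex.I) := by
    intro t ht
    rw [e.dipole_of_mem _ _ ht.1, dip, if_pos ht.2, hcx, hcx, hcx, sub_sub_sub_cancel_right,
      sub_sub_sub_cancel_right, hyx, hzx]
    have hζt : ψ (L.curve p.1 t) = ψ x + ζ t * w := by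
      simp only [ζ]; field_simp; ring
    rw [hζt, ← mul_div_mul_right (ζ t - ε * Complex.I) (ζ t + ε * Complex.I) hw0]
    congr 1 <;> ring
  have hin : ∀ᶠ t in 𝓝 p.2, L.curve p.1 t ∈ e.inner :=
    hv.tendsto.eventually (e.isOpen_inner.mem_nhds hx)
  have hmain : winding (fun t => e.dipole z y (L.curve p.1 t)) = 1 := by
    refine (hadm.hasWinding p.1).eq_one (t₀ := p.2) (fun t => ?_) ?_ ?_ ?_ ?_
    · simp only [L.periodic p.1 t]
    · rw [hquot _ hin.self_of_nhds, hζ0]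
      have : (ε : ℂ) * Complex.I ≠ 0 := by simp [hε.ne']
      rw [zero_sub, zero_add, neg_div, div_self this]
    · intro t ht
      refine hslit p.1 t fun _ k hk => ?_
      have h1 : (-1 : ℝ) < k := by linarith [ht.2]
      have h2 : (k : ℝ) < 0 := by linarith [ht.1]
      have h1' : (-1 : ℤ) < k := by exact_mod_cast h1
      have h2' : k < 0 := by exact_mod_cast h2
      omega
    · filter_upwards [hpos, nhdsWithin_le_nhds hin] with t h1 h2
      have := im_dipole_quotient hε h1.ne'
      rw [hquot t h2]
      nlinarith
    · filter_upwards [hneg, nhdsWithin_le_nhds hin] with t h1 h2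
      have := im_dipole_quotient hε h1.ne
      rw [hquot t h2]
      nlinarith
  rw [Curves.crossing, Curves.deg, Finset.sum_eq_single p.1 _ (fun h => absurd (Finset.mem_univ _) h),
    hmain]
  intro i _ hi
  have hsl : ∀ t, e.dipole z y (L.curve i t) ∈ Complex.slitPlane :=
    fun t => hslit i t fun h => absurd h hi
  refine HasWinding.winding_eq ⟨fun t => Complex.log (e.dipole z y (L.curve i t)),
    (hadm.continuous_comp i).clog hsl,
    fun t => Complex.exp_log (Complex.slitPlane_ne_zero (hsl t)), fun t => ?_⟩
  simp [L.periodic i t]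

end Crossing

/-! ### Colorings and crossing numbers -/

/-- Polar coordinates exhibit the punctured disk as a continuous image of a strip. -/
theorem isPreconnected_ball_diff_center (c : ℂ) (r : ℝ) :
    IsPreconnected (Metric.ball c r \ {c}) := by
  have : Metric.ball c r \ {c} = (fun q : ℝ × ℝ => c + q.1 * Complex.exp (q.2 * Complex.I)) ''
      (Set.Ioo 0 r ×ˢ Set.univ) := by
    ext z
    simp only [Set.mem_sdiff, mem_ball_iff_norm, Set.mem_singleton_iff, Set.mem_image,
      Set.mem_prod, Set.mem_Ioo, Set.mem_univ, and_true, Prod.exists]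
    constructor
    · rintro ⟨h1, h2⟩
      refine ⟨‖z - c‖, (z - c).arg, ⟨norm_pos_iff.2 (sub_ne_zero.2 h2), h1⟩, ?_⟩
      rw [Complex.norm_mul_exp_arg_mul_I]; ring
    · rintro ⟨ρ, θ, ⟨h1, h2⟩, rfl⟩
      have h3 : ‖(ρ : ℂ) * Complex.exp (θ * Complex.I)‖ = ρ := by
        rw [norm_mul, Complex.norm_exp_ofReal_mul_I, mul_one, Complex.norm_real,
          Real.norm_of_nonneg h1.le]
      refine ⟨by rwa [add_sub_cancel_left, h3], fun h => ?_⟩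
      rw [add_eq_left] at h
      rw [h, norm_zero] at h3
      exact h1.ne h3
  rw [this]
  exact (isPreconnected_Ioo.prod isPreconnected_univ).image _ (by fun_prop)

theorem Disk.isPreconnected_inner_diff {F : Type*} [TopologicalSpace F] {e : Disk F} {x : F}
    (hx : x ∈ e.chart.source) (hc : e.center = e.chart x) : IsPreconnected (e.inner \ {x}) := by
  have hs : Metric.ball e.center e.radius ⊆ e.chart.target :=
    (Metric.ball_subset_closedBall.trans (Metric.closedBall_subset_closedBall
      (by linarith [e.radius_pos]))).trans e.subset
  have : e.inner \ {x} = e.chart.symm '' (Metric.ball e.center e.radius \ {e.center}) := by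
    ext p
    constructor
    · rintro ⟨⟨hp, h⟩, hpx⟩
      refine ⟨e.chart p, ⟨by simpa [dist_eq_norm, coord] using h, fun h' => hpx ?_⟩,
        e.chart.left_inv hp⟩
      rw [Set.mem_singleton_iff, hc] at h'
      exact e.chart.injOn hp hx h'
    · rintro ⟨z, ⟨hz, hzc⟩, rfl⟩
      refine ⟨⟨e.chart.map_target (hs hz), ?_⟩, fun h' => hzc ?_⟩
      · rw [coord, e.chart.right_inv (hs hz)]
        simpa [dist_eq_norm] using hz
      · rw [Set.mem_singleton_iff] at h'
        rw [Set.mem_singleton_iff, hc, ← h', e.chart.right_inv (hs hz)]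
  rw [this]
  exact (isPreconnected_ball_diff_center _ _).image _ (e.chart.continuousOn_symm.mono
    (Set.sdiff_subset.trans hs))

section Sheets

variable {F : Type} [TopologicalSpace F] [ChartedSpace (E 2) F]
  {D : Diagram F} {L : Curves F} {x y z : F}

theorem mem_cutSurface : x ∈ cutSurface D L ↔ x ∉ closure D.lowerDecker ∧ x ∉ L.support := by
  simp [cutSurface]

/-- The sheet that contains a given point. -/
def sheetOf (h : x ∈ cutSurface D L) : Sheet D L :=
  ⟨connectedComponentIn (cutSurface D L) x, x, h, rfl⟩

theorem mem_sheetOf (h : x ∈ cutSurface D L) : x ∈ (sheetOf h).1 := mem_connectedComponentIn h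

theorem Sheet.subset (S : Sheet D L) : S.1 ⊆ cutSurface D L := by
  obtain ⟨_, x, hx, rfl⟩ := S
  exact connectedComponentIn_subset _ _

theorem Sheet.isPreconnected (S : Sheet D L) : IsPreconnected S.1 := by
  obtain ⟨_, x, hx, rfl⟩ := S
  exact isPreconnected_connectedComponentIn

theorem Sheet.nonempty (S : Sheet D L) : S.1.Nonempty := by
  obtain ⟨_, x, hx, rfl⟩ := S
  exact ⟨x, mem_connectedComponentIn hx⟩

theorem Sheet.eq_sheetOf (S : Sheet D L) (h : x ∈ S.1) : S = sheetOf (S.subset h) := by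
  obtain ⟨_, y, hy, rfl⟩ := S
  exact Subtype.ext (connectedComponentIn_eq h)

theorem subset_sheetOf {P : Set F} (hP : IsPreconnected P) (hPc : P ⊆ cutSurface D L)
    (hx : x ∈ P) : P ⊆ (sheetOf (hPc hx)).1 :=
  hP.subset_connectedComponentIn hx hPc

theorem Sheet.subset_of_mem {P : Set F} (S : Sheet D L) (hP : IsPreconnected P)
    (hPc : P ⊆ cutSurface D L) (hx : x ∈ P) (hxS : x ∈ S.1) : P ⊆ S.1 := by
  rw [S.eq_sheetOf hxS]
  exact subset_sheetOf hP hPc hx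

theorem sheetOf_eq {P : Set F} (hP : IsPreconnected P) (hPc : P ⊆ cutSurface D L)
    (hx : x ∈ P) (hy : y ∈ P) : sheetOf (hPc hx) = sheetOf (hPc hy) :=
  Sheet.eq_sheetOf _ (subset_sheetOf hP hPc hx hy)

theorem isOpen_cutSurface [T2Space F] : IsOpen (cutSurface D L) :=
  (isClosed_closure.union L.isClosed_support).isOpen_compl

theorem Sheet.isOpen [T2Space F] (S : Sheet D L) : IsOpen S.1 := by
  have := ChartedSpace.locallyConnectedSpace (E 2) F
  obtain ⟨_, y, hy, rfl⟩ := S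
  exact isOpen_cutSurface.connectedComponentIn

theorem IsEnteredAt.mono {S T : Set F} {v : TangentSpace (𝓡 2) x} (h : IsEnteredAt S x v)
    (hST : S ⊆ T) : IsEnteredAt T x v := by
  obtain ⟨β, hβ, hS⟩ := h
  exact ⟨β, hβ, hS.mono fun _ h => hST h⟩

variable {e : Disk F}

/-- The bridge between `MeetAtCurve` and crossing numbers, used in both directions: given entering
curves are located in `P` or `M`, and conversely the sides yield sheets that meet along the curve.
-/
theorem Curves.IsSimpleAt.exists_sides_in_disk [T2Space F] {o : SurfaceOrientation F}
    {φ : OpenPartialHomeomorph F (E 2)} {p : L.ι × ℝ} (hp : L.IsSimpleAt p x)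
    {v : TangentSpace (𝓡 2) x} (hv : HasVelocityAt (L.curve p.1) p.2 x v) (hφ : φ ∈ o.charts)
    (he : e.chart = complexChart φ) (hx : x ∈ e.inner) :
    ∃ P M : Set F, P ⊆ e.inner ∧ M ⊆ e.inner ∧ IsPreconnected P ∧ IsPreconnected M ∧
      (∀ y ∈ P, y ∉ L.support) ∧ (∀ y ∈ M, y ∉ L.support) ∧
      (∀ᶠ y in 𝓝 x, y ∈ L.support ∨ y ∈ P ∨ y ∈ M) ∧
      (∀ (β : ℝ → F) (n : TangentSpace (𝓡 2) x), HasVelocityAt β 0 x n →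
        (0 < (starRingEnd ℂ (chartDeriv φ x v) * chartDeriv φ x n).im → ∀ᶠ t in 𝓝[>] 0, β t ∈ P) ∧
        ((starRingEnd ℂ (chartDeriv φ x v) * chartDeriv φ x n).im < 0 →
          ∀ᶠ t in 𝓝[>] 0, β t ∈ M)) ∧
      (∃ n : TangentSpace (𝓡 2) x,
        0 < (starRingEnd ℂ (chartDeriv φ x v) * chartDeriv φ x n).im ∧
        IsEnteredAt P x n ∧ IsEnteredAt M x (-n)) ∧
      ∃ y ∈ M, ∃ z ∈ P, L.crossing e y z = 1 := by
  set ψ := complexChart φ with hψ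
  set w := chartDeriv φ x v with hw
  have hxs : x ∈ ψ.source := he ▸ hx.1
  have hw0 : w ≠ 0 := hv.chartDeriv_ne_zero hφ hxs
  obtain ⟨P, M, hPW, hMW, hP, hM, hPL, hML, hnear, hβ⟩ :=
    (hp.isLevelSet hv hφ hxs).exists_sides hφ hxs (sideForm_ne_zero hw0)
      (e.isOpen_inner.mem_nhds hx)
  have hside : ∀ n : TangentSpace (𝓡 2) x,
      sideForm w (chartDeriv φ x (-n)) = - sideForm w (chartDeriv φ x n) := fun n => by
    rw [map_neg, map_neg]
  have hβ' : ∀ (β : ℝ → F) (n : TangentSpace (𝓡 2) x), HasVelocityAt β 0 x n →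
        (0 < (starRingEnd ℂ w * chartDeriv φ x n).im → ∀ᶠ t in 𝓝[>] 0, β t ∈ P) ∧
        ((starRingEnd ℂ w * chartDeriv φ x n).im < 0 →
          ∀ᶠ t in 𝓝[>] 0, β t ∈ M) := by
    intro β n hn
    refine ⟨fun h => (hβ β n hn).1 ((sideForm_pos_iff hw0).2 h), fun h => (hβ β n hn).2 ?_⟩
    rw [← neg_pos, ← hside, sideForm_pos_iff hw0, map_neg, mul_neg, Complex.neg_im]
    exact neg_pos.2 h
  obtain ⟨n, hn, hnv⟩ := exists_velocity hφ hxs (Complex.I * w)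
  obtain ⟨n', hn', hnv'⟩ := exists_velocity hφ hxs (-(Complex.I * w))
  obtain rfl : n' = -n := chartDeriv_injective hφ hxs (by rw [hn', map_neg, hn])
  have hpos : 0 < (starRingEnd ℂ w * chartDeriv φ x n).im := by
    rw [← sideForm_pos_iff hw0, hn, sideForm_apply, mul_div_cancel_right₀ _ hw0]
    simp
  have hneg : (starRingEnd ℂ w * chartDeriv φ x (-n)).im < 0 := by
    rw [map_neg, mul_neg, Complex.neg_im]
    exact neg_neg_of_pos hpos
  have hPev := (hβ' _ _ hnv).1 hpos
  have hMev := (hβ' _ _ hnv').2 hneg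
  refine ⟨P, M, hPW, hMW, hP, hM, hPL, hML, hnear, hβ', ⟨n, hpos, ⟨_, hnv, hPev⟩,
    ⟨_, hnv', hMev⟩⟩, ?_⟩
  have hright : ∀ a : ℂ, ∀ᶠ t : ℝ in 𝓝[>] 0, ψ (ψ.symm (ψ x + t * a)) = ψ x + t * a := by
    intro a
    have hc : ContinuousAt (fun s : ℝ => ψ x + s * a) 0 := by fun_prop
    have ht : ψ.target ∈ 𝓝 (ψ x + ((0 : ℝ) : ℂ) * a) := by
      simpa using ψ.open_target.mem_nhds (ψ.map_source hxs)
    filter_upwards [nhdsWithin_le_nhds (hc.preimage_mem_nhds ht)] with s hs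
    exact ψ.right_inv hs
  obtain ⟨t, hcr, hPt, hMt, hr1, hr2⟩ := ((hp.eventually_crossing_eq_one hv hφ he hx).and
    (hPev.and (hMev.and ((hright _).and (hright _))))).exists
  refine ⟨_, hMt, _, hPt, hcr _ (hMW hMt) _ (hPW hPt) ?_ hr1 (hML _ hMt) (hPL _ hPt)⟩
  rw [hr2]
  ring

/-- If two sheets meet along a curve, then there are points in them with crossing number `1`. -/
theorem MeetAtCurve.exists_crossing_eq_one [T2Space F] {xi xj : Sheet D L}
    (h : MeetAtCurve xi xj) : ∃ e : Disk F, e.IsOriented D.orientation ∧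
      (∀ y ∈ e.inner, y ∉ closure D.lowerDecker) ∧
      ∃ y ∈ xi.1, ∃ z ∈ xj.1, y ∈ e.inner ∧ z ∈ e.inner ∧ L.crossing e y z = 1 := by
  obtain ⟨p, x, v, n, hv, hp, hxK, ⟨φ, hφ, hx, hpos⟩, hi, hj⟩ := h
  obtain ⟨e, hec, -, hxe, heK⟩ := exists_disk (complexChart φ) hx
    (isClosed_closure.isOpen_compl.mem_nhds hxK)
  refine ⟨e, ⟨φ, hφ, hec⟩, heK, ?_⟩
  obtain ⟨P, M, hPW, hMW, hP, hM, hPL, hML, -, hβ, -, y, hy, z, hz, hcr⟩ :=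
    Curves.IsSimpleAt.exists_sides_in_disk ⟨hv.1, hp⟩ hv hφ hec hxe
  rw [isPositive_iff_of_mem] at hpos
  have hcut : ∀ T : Set F, T ⊆ e.inner → (∀ y ∈ T, y ∉ L.support) → T ⊆ cutSurface D L :=
    fun T hT hT' y hy => mem_cutSurface.2 ⟨heK (hT hy), hT' y hy⟩
  -- The curves that enter the two sheets run into `M` and `P`, so these connected sides lie
  -- entirely in the sheets.
  obtain ⟨β, hβv, hβi⟩ := hi
  obtain ⟨β', hβv', hβj⟩ := hj
  obtain ⟨t, ht, ht'⟩ := (hβi.and ((hβ β (-n) hβv).2 (by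
    rw [map_neg, mul_neg, Complex.neg_im]; exact neg_neg_of_pos hpos))).exists
  obtain ⟨s, hs, hs'⟩ := (hβj.and ((hβ β' n hβv').1 hpos)).exists
  exact ⟨y, xi.subset_of_mem hM (hcut M hMW hML) ht' ht hy,
    z, xj.subset_of_mem hP (hcut P hPW hPL) hs' hs hz, hMW hy, hPW hz, hcr⟩

/-- Disks in the same chart have coordinates that differ by a translation, so by convexity the
segment between the points stays in the smaller disk, which is free of curves. -/
theorem Curves.crossing_eq_zero_of_disk [T2Space F] {e' : Disk F} (hc : e'.chart = e.chart)
    (he' : ∀ q ∈ e'.inner, q ∉ L.support)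
    (hy : y ∈ e.inner) (hz : z ∈ e.inner) (hy' : y ∈ e'.inner) (hz' : z ∈ e'.inner) :
    L.crossing e y z = 0 := by
  refine crossing_eq_zero hy hz fun q hqL hqs hseg => he' q ⟨hc ▸ hqs, ?_⟩ hqL
  have hconv := (convex_ball (e'.center - e.center) e'.radius).segment_subset
    (x := e.coord y) (y := e.coord z) ?_ ?_ hseg
  all_goals simp only [mem_ball_iff_norm, Disk.coord, sub_sub_sub_cancel_right] at *
  · rw [hc]; exact hconv
  · rw [← hc]; exact hy'.2
  · rw [← hc]; exact hz'.2

theorem kink_zpow_neg_apply_eq {R : Type*} [Rack R] {n k : ℤ} {a b : R}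
    (h : b = (kink R ^ (n - k)) a) : (kink R ^ (-n)) b = (kink R ^ (-k)) a := by
  rw [h, ← Equiv.Perm.mul_apply, ← zpow_add]
  congr 2
  ring

/-- In a disk away from the lower preimages of the double points, the color changes by the power
of the kink map given by the crossing number. -/
theorem Coloring.color_sheetOf [T2Space F] {R : Type*} [Rack R] (hL : L.IsOn D)
    (c : Coloring D L R) (he : e.IsOriented D.orientation)
    (heK : ∀ y ∈ e.inner, y ∉ closure D.lowerDecker) (hy : y ∈ e.inner) (hz : z ∈ e.inner)
    (hyc : y ∈ cutSurface D L) (hzc : z ∈ cutSurface D L) :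
    c.color (sheetOf hzc) = (kink R ^ L.crossing e y z) (c.color (sheetOf hyc)) := by
  classical
  obtain ⟨φ, hφ, hec⟩ := he
  have hyL := (mem_cutSurface.1 hyc).2
  have hcut : ∀ q ∈ e.inner, q ∉ L.support → q ∈ cutSurface D L := fun q hq hqL =>
    mem_cutSurface.2 ⟨heK q hq, hqL⟩
  -- The color with the expected power of `ι` undone, to be shown constant on the disk; its value on
  -- the curves is irrelevant.
  let u : F → R := fun q => if h : q ∈ cutSurface D L then
    (kink R ^ (- L.crossing e y q)) (c.color (sheetOf h)) else c.color (sheetOf hyc)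
  have hu : ∀ q (h : q ∈ cutSurface D L), u q =
      (kink R ^ (- L.crossing e y q)) (c.color (sheetOf h)) := fun q h => dif_pos h
  have hstep : ∀ q ∈ e.inner, ∀ q' ∈ e.inner, ∀ (h : q ∈ cutSurface D L)
      (h' : q' ∈ cutSurface D L),
      c.color (sheetOf h') = (kink R ^ L.crossing e q q') (c.color (sheetOf h)) → u q = u q' := by
    intro q hq q' hq' h h' hcc
    rw [hu q h, hu q' h']
    refine (kink_zpow_neg_apply_eq (hcc.trans ?_)).symm
    rw [← Curves.crossing_add hy hq hq' hyL (mem_cutSurface.1 h).2 (mem_cutSurface.1 h').2]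
    congr 2
    ring
  have hoff : ∀ q ∈ e.inner, q ∉ L.support → ∃ W ∈ 𝓝 q, ∀ r ∈ W, r ∉ L.support →
      ∀ r' ∈ W, r' ∉ L.support → u r = u r' := by
    intro q hq hqL
    obtain ⟨e', hec', -, hqe', heW'⟩ := exists_disk e.chart hq.1
      (Filter.inter_mem (e.isOpen_inner.mem_nhds hq) (L.isClosed_support.isOpen_compl.mem_nhds hqL))
    have hcut' : e'.inner ⊆ cutSurface D L := fun r hr => hcut r (heW' hr).1 (heW' hr).2
    refine ⟨e'.inner, e'.isOpen_inner.mem_nhds hqe', fun r hr _ r' hr' _ => ?_⟩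
    refine hstep r (heW' hr).1 r' (heW' hr').1 (hcut' hr) (hcut' hr') ?_
    rw [Curves.crossing_eq_zero_of_disk hec' (fun q hq => (heW' hq).2) (heW' hr).1 (heW' hr').1 hr hr',
      zpow_zero, Equiv.Perm.one_apply, sheetOf_eq e'.isPreconnected_inner hcut' hr' hr]
  have hdense := hL.dense_compl_support
  have hconst : ∀ T : Set F, IsPreconnected T → T ⊆ e.inner → (∀ q ∈ T, q ∉ L.support) →
      ∀ q ∈ T, ∀ q' ∈ T, u q = u q' := fun T hT hTe hTL q hq q' hq' =>
    eq_of_locally_eq hT hdense (fun r hr => hoff r (hTe hr) (hTL r hr)) hq (hTL q hq) hq'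
      (hTL q' hq')
  -- At a simple point the coloring rule supplies one factor `ι`, matching the crossing number `1`
  -- between the sides.
  have hsimple : ∀ q ∈ e.inner, ∀ p, L.IsSimpleAt p q → ∃ W ∈ 𝓝 q, ∀ r ∈ W, r ∉ L.support →
      ∀ r' ∈ W, r' ∉ L.support → u r = u r' := by
    intro q hq p hp
    have hv := L.hasVelocityAt p.1 p.2
    rw [show L.curve p.1 p.2 = q from hp.1] at hv
    obtain ⟨P, M, hPW, hMW, hP, hM, hPL, hML, hnear, -, ⟨n, hn, hPn, hMn⟩, r, hr, r', hr', hcr⟩ :=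
      hp.exists_sides_in_disk hv hφ hec hq
    have hPc : P ⊆ cutSurface D L := fun s hs => hcut s (hPW hs) (hPL s hs)
    have hMc : M ⊆ cutSurface D L := fun s hs => hcut s (hMW hs) (hML s hs)
    have hmeet : MeetAtCurve (sheetOf (hMc hr)) (sheetOf (hPc hr')) :=
      ⟨p, q, _, n, hv, hp.2, heK q hq, ⟨φ, hφ, by have := hq.1; rwa [hec] at this, isPositive_iff_of_mem.2 hn⟩,
        hMn.mono (subset_sheetOf hM hMc hr), hPn.mono (subset_sheetOf hP hPc hr')⟩
    have hrr : u r = u r' := hstep r (hMW hr) r' (hPW hr') (hMc hr) (hPc hr') (by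
      rw [hcr, zpow_one]
      exact c.curve _ _ hmeet)
    have hall : ∀ s, s ∈ P ∨ s ∈ M → u s = u r := by
      rintro s (hs | hs)
      · rw [hrr]; exact hconst P hP hPW hPL s hs r' hr'
      · exact hconst M hM hMW hML s hs r hr
    refine ⟨_, hnear, fun s hs hsL s' hs' hsL' => ?_⟩
    rw [hall s (hs.resolve_left hsL), hall s' (hs'.resolve_left hsL')]
  have hfinal : u z = u y := by
    refine eq_of_locally_eq e.isPreconnected_inner hdense (fun q hq => ?_) hz
      (mem_cutSurface.1 hzc).2 hy hyL
    by_cases hqL : q ∈ L.support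
    swap
    · exact hoff q hq hqL
    -- If `q` is a multiple point, a small disk centered at `q` has only simple points besides `q`;
    -- since the punctured disk is connected, `u` has one value around `q`.
    have hsm := hL.eventually_isSimpleAt q
    obtain ⟨W, hW, hWs⟩ := mem_nhdsWithin_iff_exists_mem_nhds_inter.1 hsm
    obtain ⟨e', hec', hcen, hqe', heW'⟩ := exists_disk e.chart hq.1
      (Filter.inter_mem (e.isOpen_inner.mem_nhds hq) hW)
    refine ⟨e'.inner, e'.isOpen_inner.mem_nhds hqe', fun r hr hrL r' hr' hrL' => ?_⟩
    have hne : ∀ r, r ∉ L.support → r ≠ q := fun r hr h => hr (h ▸ hqL)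
    refine eq_of_locally_eq (Disk.isPreconnected_inner_diff hqe'.1 (hec' ▸ hcen)) hdense
      (fun s hs => ?_) ⟨hr, hne r hrL⟩ hrL ⟨hr', hne r' hrL'⟩ hrL'
    by_cases hsL : s ∈ L.support
    · obtain ⟨i, t, hit⟩ := Set.mem_iUnion.1 hsL
      exact hsimple s (heW' hs.1).1 (i, t) (hWs ⟨(heW' hs.1).2, hs.2⟩ (i, t) hit)
    · exact hoff s (heW' hs.1).1 hsL
  rw [hu z hzc, hu y hyc, Curves.crossing_self hy hyL, neg_zero, zpow_zero,
    Equiv.Perm.one_apply] at hfinal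
  rw [← hfinal, ← Equiv.Perm.mul_apply, ← zpow_add, add_neg_cancel, zpow_zero,
    Equiv.Perm.one_apply]

end Sheets

/-! ### Equations for the image of an immersed disk -/

section Equation

/-- The map `(z, s) ↦ f z + s w` is a local diffeomorphism since `w` is transverse to the image; `G`
and `π` are the two components of its local inverse. -/
theorem exists_left_inverse_add_equation {f : ℂ → E 3} {p : ℂ} (hf : ContDiffAt ℝ ∞ f p)
    (hinj : Function.Injective (fderiv ℝ f p)) {w : E 3} (hw : ∀ z, fderiv ℝ f p z ≠ w) :
    ∃ (G : E 3 → ℝ) (π : E 3 → ℂ), ContDiffAt ℝ ∞ G (f p) ∧ Filter.Tendsto π (𝓝 (f p)) (𝓝 p) ∧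
      (∀ᶠ z in 𝓝 p, G (f z) = 0 ∧ π (f z) = z) ∧ (∀ᶠ y in 𝓝 (f p), G y = 0 → f (π y) = y) ∧
      fderiv ℝ G (f p) w = 1 ∧
      ∀ u, fderiv ℝ G (f p) u = 0 → ∃ z, fderiv ℝ f p z = u := by
  let Ψ : ℂ × ℝ → E 3 := fun q => f q.1 + q.2 • w
  let B : ℂ × ℝ →L[ℝ] E 3 := (fderiv ℝ f p).coprod (ContinuousLinearMap.toSpanSingleton ℝ w)
  have hB : ∀ q, B q = fderiv ℝ f p q.1 + q.2 • w := fun q => by simp [B]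
  have hBinj : Function.Injective (B : ℂ × ℝ →ₗ[ℝ] E 3) := by
    rw [← LinearMap.ker_eq_bot, LinearMap.ker_eq_bot']
    rintro ⟨z, s⟩ h
    have h' : fderiv ℝ f p z + s • w = 0 := (hB (z, s)).symm.trans h
    have hs : s = 0 := by
      by_contra hs
      refine hw (-s⁻¹ • z) ?_
      rw [map_smul, eq_neg_of_add_eq_zero_left h', neg_smul, smul_neg, neg_neg, smul_smul,
        inv_mul_cancel₀ hs, one_smul]
    rw [hs, zero_smul, add_zero] at h'
    rw [hs, hinj (h'.trans (map_zero _).symm)]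
    rfl
  let A : (ℂ × ℝ) ≃L[ℝ] E 3 := (LinearMap.linearEquivOfInjective (B : ℂ × ℝ →ₗ[ℝ] E 3) hBinj
    (by simp)).toContinuousLinearEquiv
  have hA : ∀ q, A q = fderiv ℝ f p q.1 + q.2 • w := hB
  have hf1 : HasFDerivAt f (fderiv ℝ f p) p := (hf.differentiableAt (by simp)).hasFDerivAt
  have hΨ : ContDiffAt ℝ ∞ Ψ (p, 0) := by
    have h1 : ContDiffAt ℝ ∞ (fun q : ℂ × ℝ => f q.1) (p, 0) := hf.comp (p, (0 : ℝ)) contDiffAt_fst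
    exact h1.add (contDiffAt_snd.smul contDiffAt_const)
  have hΨ' : HasFDerivAt Ψ (A : ℂ × ℝ →L[ℝ] E 3) (p, 0) := by
    have h1 : HasFDerivAt (fun q : ℂ × ℝ => f q.1) _ (p, 0) :=
      HasFDerivAt.comp (p, (0 : ℝ)) (f := Prod.fst) hf1 hasFDerivAt_fst
    have h2 : HasFDerivAt (fun q : ℂ × ℝ => q.2 • w) _ (p, 0) :=
      (hasFDerivAt_snd (𝕜 := ℝ) (E := ℂ) (F := ℝ) (p := (p, (0 : ℝ)))).smul_const w
    refine (h1.add h2).congr_fderiv ?_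
    apply ContinuousLinearMap.ext
    intro q
    rw [ContinuousLinearEquiv.coe_coe, hA]
    simp
  have hne : (∞ : WithTop ℕ∞) ≠ 0 := by simp
  set Λ := hΨ.localInverse hΨ' hne with hΛ
  have hstrict := hΨ.hasStrictFDerivAt' hΨ' hne
  have hΨp : Ψ (p, 0) = f p := by simp [Ψ]
  have hΛd : ContDiffAt ℝ ∞ Λ (f p) := by
    have := hΨ.to_localInverse hΨ' hne
    rwa [hΨp] at this
  have hΛp : Λ (f p) = (p, 0) := by
    have := hΨ.localInverse_apply_image hΨ' hne
    rwa [hΨp] at this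
  have hΛ' : HasFDerivAt Λ (A.symm : E 3 →L[ℝ] ℂ × ℝ) (f p) := by
    have := hstrict.to_localInverse.hasFDerivAt
    rwa [hΨp] at this
  have hleft : ∀ᶠ q in 𝓝 (p, (0 : ℝ)), Λ (Ψ q) = q := hstrict.eventually_left_inverse
  have hright : ∀ᶠ y in 𝓝 (f p), Ψ (Λ y) = y := by
    have := hstrict.eventually_right_inverse
    rwa [hΨp] at this
  have hG' : HasFDerivAt (fun y => (Λ y).2) (ContinuousLinearMap.snd ℝ ℂ ℝ ∘L
      (A.symm : E 3 →L[ℝ] ℂ × ℝ)) (f p) := hasFDerivAt_snd.comp (f p) hΛ'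
  refine ⟨fun y => (Λ y).2, fun y => (Λ y).1, contDiffAt_snd.comp (f p) hΛd, ?_, ?_, ?_, ?_, ?_⟩
  · have := (continuous_fst.tendsto _).comp hΛd.continuousAt.tendsto
    simpa [hΛp, Function.comp_def] using this
  · have hc : Filter.Tendsto (fun z : ℂ => (z, (0 : ℝ))) (𝓝 p) (𝓝 (p, 0)) :=
      (Continuous.prodMk_left (0 : ℝ)).tendsto p
    filter_upwards [hc.eventually hleft] with z hz
    have : Ψ (z, 0) = f z := by simp [Ψ]
    rw [this] at hz
    exact ⟨congrArg Prod.snd hz, congrArg Prod.fst hz⟩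
  · filter_upwards [hright] with y hy h0
    have h1 : f (Λ y).1 + (Λ y).2 • w = y := hy
    rwa [h0, zero_smul, add_zero] at h1
  · rw [hG'.fderiv]
    have : A.symm w = (0, 1) := by rw [ContinuousLinearEquiv.symm_apply_eq, hA]; simp
    simp [this]
  · intro u hu
    rw [hG'.fderiv] at hu
    have h0 : (A.symm u).2 = 0 := hu
    refine ⟨(A.symm u).1, ?_⟩
    have := hA (A.symm u)
    rw [A.apply_symm_apply, h0, zero_smul, add_zero] at this
    exact this.symm

variable {F : Type} [TopologicalSpace F] [ChartedSpace (E 2) F]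
  {o : SurfaceOrientation F} {φ : OpenPartialHomeomorph F (E 2)} {a : F} {f : F → E 3}

theorem contDiffAt_comp_complexChart_symm (hf : ContMDiff (𝓡 2) (𝓡 3) ∞ f) (hφ : φ ∈ o.charts)
    {z : ℂ} (hz : z ∈ (complexChart φ).target) :
    ContDiffAt ℝ ∞ (fun z => f ((complexChart φ).symm z)) z := by
  have hz' : cplx.symm z ∈ φ.target := hz
  have h1 : ContMDiffAt (𝓡 2) (𝓡 2) ∞ φ.symm (cplx.symm z) :=
    (contMDiffOn_symm_of_mem_maximalAtlas (o.charts_subset hφ)).contMDiffAt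
      (φ.open_target.mem_nhds hz')
  have h2 : ContDiffAt ℝ ∞ (fun y => f (φ.symm y)) (cplx.symm z) :=
    ((hf _).comp _ h1).contDiffAt
  exact h2.comp z cplx.symm.contDiff.contDiffAt

theorem mfderiv_eq_fderiv_chartDeriv (hf : ContMDiff (𝓡 2) (𝓡 3) ∞ f) (hφ : φ ∈ o.charts)
    (ha : a ∈ φ.source) (v : TangentSpace (𝓡 2) a) :
    (mfderiv (𝓡 2) (𝓡 3) f a v : E 3) =
      fderiv ℝ (fun z => f ((complexChart φ).symm z)) (complexChart φ a) (chartDeriv φ a v) := by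
  obtain ⟨v', hv', hvel⟩ := exists_velocity hφ ha (chartDeriv φ a v)
  obtain rfl : v' = v := chartDeriv_injective hφ ha hv'
  have h1 := (hf.mdifferentiableAt (x := a) (by simp)).hasMFDerivAt
  have h1' := h1
  rw [← hvel.1] at h1'
  have h2 := ((ContinuousLinearMap.id ℝ (E 3)).hasFDerivAt.comp (0 : ℝ)
    (h1'.comp (0 : ℝ) hvel.2).hasFDerivAt).hasDerivAt
  have h3 := ((contDiffAt_comp_complexChart_symm hf hφ
    ((complexChart φ).map_source ha)).differentiableAt (by simp)).hasFDerivAt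
  have h4 : HasDerivAt (fun t : ℝ => complexChart φ a + t * chartDeriv φ a v')
      (chartDeriv φ a v') 0 := by
    have := ((hasDerivAt_id (0 : ℝ)).ofReal_comp.mul_const (chartDeriv φ a v')).const_add
      (complexChart φ a)
    simpa using this
  have h5 : complexChart φ a + ((0 : ℝ) : ℂ) * chartDeriv φ a v' = complexChart φ a := by simp
  rw [← h5] at h3
  have h6 := h3.comp_hasDerivAt (0 : ℝ) h4
  rw [h5] at h6
  have h7 := h2.unique h6
  rw [← h7]
  have h8 : ∀ b, b = a → (mfderiv (𝓡 2) (𝓡 3) f b : E 2 →L[ℝ] E 3) ((1 : ℝ) • (v' : E 2)) =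
      (mfderiv (𝓡 2) (𝓡 3) f a : E 2 →L[ℝ] E 3) v' := by
    rintro _ rfl
    rw [one_smul]
  exact (h8 _ hvel.1).symm

theorem isImmersiveAt_iff (hf : ContMDiff (𝓡 2) (𝓡 3) ∞ f) (hφ : φ ∈ o.charts)
    (ha : a ∈ φ.source) : IsImmersiveAt f a ↔
      Function.Injective (fderiv ℝ (fun z => f ((complexChart φ).symm z)) (complexChart φ a)) := by
  have hsurj : Function.Surjective (chartDeriv φ a) := fun z =>
    (exists_velocity hφ ha z).imp fun _ h => h.1
  have heq : (mfderiv (𝓡 2) (𝓡 3) f a : TangentSpace (𝓡 2) a → E 3) =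
      fderiv ℝ (fun z => f ((complexChart φ).symm z)) (complexChart φ a) ∘ chartDeriv φ a :=
    funext fun v => mfderiv_eq_fderiv_chartDeriv hf hφ ha v
  change Function.Injective (mfderiv (𝓡 2) (𝓡 3) f a : TangentSpace (𝓡 2) a → E 3) ↔ _
  rw [heq]
  exact ⟨fun h => Function.Injective.of_comp_right h hsurj,
    fun h => h.comp (chartDeriv_injective hφ ha)⟩

theorem mem_tangentImage_iff (hf : ContMDiff (𝓡 2) (𝓡 3) ∞ f) (hφ : φ ∈ o.charts)
    (ha : a ∈ φ.source) {w : E 3} : w ∈ tangentImage f a ↔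
      ∃ z, fderiv ℝ (fun z => f ((complexChart φ).symm z)) (complexChart φ a) z = w := by
  constructor
  · rintro ⟨v, rfl⟩
    exact ⟨_, (mfderiv_eq_fderiv_chartDeriv hf hφ ha v).symm⟩
  · rintro ⟨z, rfl⟩
    obtain ⟨v, rfl, -⟩ := exists_velocity hφ ha z
    exact ⟨v, mfderiv_eq_fderiv_chartDeriv hf hφ ha v⟩

/-- Around a point where `f` is an immersion, the image of `f` is the zero set of a function. -/
theorem IsImmersiveAt.exists_equation (h : IsImmersiveAt f a) (hf : ContMDiff (𝓡 2) (𝓡 3) ∞ f)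
    (o : SurfaceOrientation F) {w : E 3} (hw : w ∉ tangentImage f a) :
    ∃ (G : E 3 → ℝ) (π : E 3 → F), ContDiffAt ℝ ∞ G (f a) ∧ Filter.Tendsto π (𝓝 (f a)) (𝓝 a) ∧
      (∀ᶠ x in 𝓝 a, G (f x) = 0 ∧ π (f x) = x) ∧ (∀ᶠ y in 𝓝 (f a), G y = 0 → f (π y) = y) ∧
      fderiv ℝ G (f a) w = 1 ∧ ∀ u, fderiv ℝ G (f a) u = 0 → u ∈ tangentImage f a := by
  obtain ⟨φ, hφ, ha⟩ := o.cover a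
  have ha' : a ∈ (complexChart φ).source := ha
  have hc : Filter.Tendsto (complexChart φ).symm (𝓝 (complexChart φ a)) (𝓝 a) := by
    have := (complexChart φ).symm.continuousAt ((complexChart φ).map_source ha')
    rwa [ContinuousAt, (complexChart φ).left_inv ha'] at this
  obtain ⟨G, π, h1, h2, h3, h4, h5, h6⟩ := exists_left_inverse_add_equation
    (contDiffAt_comp_complexChart_symm hf hφ ((complexChart φ).map_source ha'))
    ((isImmersiveAt_iff hf hφ ha).1 h) (w := w)
    (fun z hz => hw ((mem_tangentImage_iff hf hφ ha).2 ⟨z, hz⟩))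
  simp only [(complexChart φ).left_inv ha'] at h1 h2 h4 h5 h6
  refine ⟨G, fun y => (complexChart φ).symm (π y), h1, hc.comp h2, ?_, h4, h5, fun u hu =>
    (mem_tangentImage_iff hf hφ ha).2 (h6 u hu)⟩
  filter_upwards [((complexChart φ).continuousAt ha').eventually h3,
    (complexChart φ).open_source.mem_nhds ha'] with x hx hx'
  rw [(complexChart φ).left_inv hx'] at hx
  exact ⟨hx.1, by rw [hx.2, (complexChart φ).left_inv hx']⟩

theorem exists_notMem_tangentImage (f : F → E 3) (a : F) : ∃ w, w ∉ tangentImage f a := by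
  by_contra! h
  have h1 : tangentImage f a = ⊤ := (Submodule.eq_top_iff').2 h
  have h2 : ∀ B : E 2 →ₗ[ℝ] E 3, LinearMap.range B ≠ ⊤ := fun B hB => by
    have h3 := LinearMap.finrank_range_le B
    rw [hB, finrank_top] at h3
    simp at h3
  exact h2 _ h1

theorem IsImmersiveAt.exists_injOn (h : IsImmersiveAt f a) (hf : ContMDiff (𝓡 2) (𝓡 3) ∞ f)
    (o : SurfaceOrientation F) : ∃ U ∈ 𝓝 a, Set.InjOn f U := by
  obtain ⟨w, hw⟩ := exists_notMem_tangentImage f a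
  obtain ⟨G, π, -, -, h3, -⟩ := h.exists_equation hf o hw
  refine ⟨_, h3, fun x hx y hy hxy => ?_⟩
  rw [← hx.2, hxy, hy.2]

/-- By compactness the points outside the interior of `U` have closed image, which misses `p`:
preimages of points near `p` stay near preimages of `p`. -/
theorem eventually_preimage_subset {X Y : Type*} [TopologicalSpace X] [CompactSpace X]
    [TopologicalSpace Y] [T2Space Y] {f : X → Y} (hf : Continuous f) {U : Set X} {p : Y} (hU : ∀ x, f x = p → U ∈ 𝓝 x) : ∀ᶠ y in 𝓝 p, ∀ x, f x = y → x ∈ U := by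
  have hcl : IsClosed (f '' (interior U)ᶜ) :=
    (isOpen_interior.isClosed_compl.isCompact.image hf).isClosed
  filter_upwards [hcl.isOpen_compl.mem_nhds (by
    rintro ⟨x, hx, rfl⟩
    exact hx (mem_interior_iff_mem_nhds.2 (hU x rfl)))] with y hy x hx
  by_contra hxU
  exact hy ⟨x, fun h => hxU (interior_subset h), hx⟩

theorem Diagram.contMDiff_map (D : Diagram F) [IsManifold (𝓡 2) ∞ F] :
    ContMDiff (𝓡 2) (𝓡 3) ∞ D.map := by
  have h1 := D.isSmoothEmbedding.contMDiff
  have h2 : ContDiff ℝ ∞ proj := by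
    rw [contDiff_euclidean]
    intro i
    fin_cases i <;> simp [proj] <;> fun_prop
  exact h2.contMDiff.comp h1

end Equation

/-! ### Moving along double point curves -/

section DoubleCurves

/-- The function takes both signs in every small punctured disk, which is connected, so the
intermediate value theorem gives a zero other than `p`. It is used to find a second point on a
double point curve. -/
theorem frequently_eq_zero {g : ℂ → ℝ} {l : ℂ →L[ℝ] ℝ} {p : ℂ}
    (hg : ∀ᶠ z in 𝓝 p, ContinuousAt g z) (hd : HasFDerivAt g l p) {u : ℂ} (hu : 0 < l u)
    (h0 : g p = 0) : ∃ᶠ z in 𝓝[≠] p, g z = 0 := by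
  intro hne
  rw [eventually_nhdsWithin_iff] at hne
  obtain ⟨r, hr, hball⟩ := Metric.eventually_nhds_iff_ball.1 (hg.and hne)
  have hline : ∀ a : ℂ, HasDerivAt (fun t : ℝ => g (p + t * a)) (l a) 0 ∧
      ∀ᶠ t : ℝ in 𝓝[>] 0, p + t * a ∈ Metric.ball p r := by
    intro a
    have h1 : HasDerivAt (fun t : ℝ => p + t * a) a 0 := by
      have := ((hasDerivAt_id (0 : ℝ)).ofReal_comp.mul_const a).const_add p
      simpa using this
    have h2 : p + ((0 : ℝ) : ℂ) * a = p := by simp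
    refine ⟨HasFDerivAt.comp_hasDerivAt (0 : ℝ) (by rwa [h2]) h1, nhdsWithin_le_nhds ?_⟩
    exact h1.continuousAt.preimage_mem_nhds (by rw [h2]; exact Metric.ball_mem_nhds p hr)
  have hpos := (eventually_lt_of_hasDerivAt (hline u).1 hu).1
  have hneg := (eventually_lt_of_hasDerivAt (hline (-u)).1.neg (by simpa using hu)).1
  simp only [Complex.ofReal_zero, zero_mul, add_zero, h0, Pi.neg_apply, neg_zero,
    Left.neg_pos_iff] at hpos hneg
  obtain ⟨t, ht1, ht2, ht3, ht4⟩ := (hpos.and (hneg.and ((hline u).2.and (hline (-u)).2))).exists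
  have hmem : ∀ z ∈ Metric.ball p r, g z ≠ 0 → z ∈ Metric.ball p r \ {p} := fun z hz hgz =>
    ⟨hz, fun h => hgz (by rw [Set.mem_singleton_iff.1 h, h0])⟩
  obtain ⟨z, hz, hgz⟩ := (isPreconnected_ball_diff_center p r).intermediate_value
    (hmem _ ht4 ht2.ne) (hmem _ ht3 ht1.ne')
    (fun z hz => (hball z hz.1).1.continuousWithinAt) ⟨ht2.le, ht1.le⟩
  exact (hball z hz.1).2 hz.2 hgz

theorem linearIndependent_of_stdDet_ne_zero {n : ℕ} {v : Fin n → E n} (h : stdDet v ≠ 0) :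
    LinearIndependent ℝ v ∧ Submodule.span ℝ (Set.range v) = ⊤ :=
  (EuclideanSpace.basisFun (Fin n) ℝ).toBasis.is_basis_iff_det.2 (isUnit_iff_ne_zero.2 h)

theorem ne_of_stdDet_ne_zero {A : ℂ →L[ℝ] E 3} {c₁ c₂ : ℂ} {w : E 3}
    (h : stdDet ![A c₁, A c₂, w] ≠ 0) (z : ℂ) : A z ≠ w := by
  rintro rfl
  have h1 := (linearIndependent_of_stdDet_ne_zero h).1
  have h2 : ![A c₁, A c₂, A z] = (A : ℂ →ₗ[ℝ] E 3) ∘ ![c₁, c₂, z] := by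
    ext i : 1
    fin_cases i <;> rfl
  rw [h2] at h1
  have h3 := (h1.of_comp _).fintype_card_le_finrank
  rw [Complex.finrank_real_complex, Fintype.card_fin] at h3
  exact absurd h3 (by norm_num)

theorem continuous_stdDet {n : ℕ} : Continuous (stdDet (n := n)) := by
  unfold stdDet
  simp only [Module.Basis.det_apply]
  refine Continuous.matrix_det (continuous_matrix fun i j => ?_)
  simp only [Module.Basis.toMatrix_apply, OrthonormalBasis.coe_toBasis_repr_apply,
    EuclideanSpace.basisFun_repr]
  fun_prop

variable {F : Type} [TopologicalSpace F] [ChartedSpace (E 2) F]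
  {D : Diagram F} {L L' : Curves F} {φ : OpenPartialHomeomorph F (E 2)} {x : F}

theorem tendsto_complexChart_symm {F : Type*} [TopologicalSpace F]
    {φ : OpenPartialHomeomorph F (E 2)} {x : F} (hx : x ∈ φ.source) :
    Filter.Tendsto (complexChart φ).symm (𝓝 (complexChart φ x)) (𝓝 x) := by
  have := (complexChart φ).symm.continuousAt ((complexChart φ).map_source hx)
  rwa [ContinuousAt, (complexChart φ).left_inv hx] at this

/-- The positive side of the double point curve is locally connected to the entering curve without
meeting any cut, so it lies in the entered sheet. -/
theorem Sheet.eventually_mem_of_isEnteredAt [T2Space F] {S : Sheet D L}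
    (hφ : φ ∈ D.orientation.charts)
    (hx : x ∈ φ.source) {g : ℂ → ℝ} {l : ℂ →L[ℝ] ℝ}
    (hg : HasStrictFDerivAt g l (complexChart φ x)) (h0 : g (complexChart φ x) = 0)
    (hK : ∀ᶠ y in 𝓝 x, y ∈ closure D.lowerDecker → g (complexChart φ y) = 0)
    (hxL : x ∉ L.support) {v : TangentSpace (𝓡 2) x} (hl : 0 < l (chartDeriv φ x v))
    (hv : IsEnteredAt S.1 x v) : ∀ᶠ y in 𝓝 x, 0 < g (complexChart φ y) → y ∈ S.1 := by
  set ψ := complexChart φ with hψ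
  have hxψ : x ∈ ψ.source := hx
  obtain ⟨V, hV, hVW, hVP, -⟩ := exists_sides hg (by rintro rfl; simp at hl)
    (((tendsto_complexChart_symm hx).eventually
      (hK.and (L.isClosed_support.isOpen_compl.mem_nhds hxL))).and
        (ψ.open_target.mem_nhds (ψ.map_source hxψ)))
  rw [h0] at hVP
  have hnear : ∀ᶠ y in 𝓝 x, y ∈ ψ.source ∧ ψ y ∈ V :=
    Filter.Eventually.and (ψ.open_source.mem_nhds hxψ) ((ψ.continuousAt hxψ).preimage_mem_nhds hV)
  have hmem : ∀ᶠ y in 𝓝 x, 0 < g (ψ y) → y ∈ ψ.symm '' (V ∩ {z | 0 < g z}) := by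
    filter_upwards [hnear] with y hy hgy
    exact ⟨ψ y, ⟨hy.2, hgy⟩, ψ.left_inv hy.1⟩
  obtain ⟨β, hβ, hβS⟩ := hv
  have h1 := hβ.hasDerivAt hφ hx
  have h2 : HasDerivAt (fun t => g (ψ (β t))) (l (chartDeriv φ x v)) 0 :=
    HasFDerivAt.comp_hasDerivAt (0 : ℝ) (by rw [hβ.1]; exact hg.hasFDerivAt) h1
  have h3 := (eventually_lt_of_hasDerivAt h2 hl).1
  rw [hβ.1, h0] at h3
  obtain ⟨t, ht1, ht2, ht3⟩ := (hβS.and (h3.and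
    ((hβ.tendsto.mono_left nhdsWithin_le_nhds).eventually hmem))).exists
  filter_upwards [hmem] with y hy hgy
  refine S.subset_of_mem (hVP.image _ (ψ.continuousOn_symm.mono fun z hz => (hVW hz.1).2)) ?_
    (ht3 ht2) ht1 (hy hgy)
  rintro _ ⟨z, ⟨hz, hz0⟩, rfl⟩
  refine mem_cutSurface.2 ⟨fun hzK => ?_, (hVW hz).1.2⟩
  have := (hVW hz).1.1 hzK
  rw [ψ.right_inv (hVW hz).2] at this
  exact hz0.ne' this

/-- A short ray lies in `S`, hence off the lower decker set, and avoids the closed set `L'`; being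
connected, it lies in a single sheet for `L'`. -/
theorem Sheet.exists_isEnteredAt_of_ray [T2Space F] (S : Sheet D L)
    (hφ : φ ∈ D.orientation.charts) (hx : x ∈ φ.source) {z : ℂ} {v : TangentSpace (𝓡 2) x}
    (hz : chartDeriv φ x v = z) (hxL' : x ∉ L'.support)
    (hS : ∀ᶠ t : ℝ in 𝓝[>] 0, (complexChart φ).symm (complexChart φ x + t * z) ∈ S.1) :
    ∃ S' : Sheet D L', IsEnteredAt S'.1 x v ∧ ∀ W ∈ 𝓝 x, (W ∩ (S.1 ∩ S'.1)).Nonempty := by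
  obtain ⟨v', hv', hvel⟩ := exists_velocity hφ hx z
  obtain rfl : v' = v := chartDeriv_injective hφ hx (hv'.trans hz.symm)
  set ψ := complexChart φ with hψ
  have hxψ : x ∈ ψ.source := hx
  have hc : ContinuousAt (fun t : ℝ => ψ x + t * z) 0 := by fun_prop
  have hlim := hvel.tendsto.mono_left (nhdsWithin_le_nhds (s := Set.Ioi 0))
  have htar : ∀ᶠ t : ℝ in 𝓝[>] 0, ψ x + t * z ∈ ψ.target := nhdsWithin_le_nhds
    (hc.preimage_mem_nhds (by simpa using ψ.open_target.mem_nhds (ψ.map_source hxψ)))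
  obtain ⟨ε, hε, hεt⟩ := mem_nhdsGT_iff_exists_Ioo_subset.1 (hS.and (htar.and
    (hlim.eventually (L'.isClosed_support.isOpen_compl.mem_nhds hxL'))))
  have hε' : (0 : ℝ) < ε := hε
  have hpre : IsPreconnected ((fun t : ℝ => ψ.symm (ψ x + t * z)) '' Set.Ioo 0 ε) :=
    isPreconnected_Ioo.image _ (ψ.continuousOn_symm.comp
      (Continuous.continuousOn (by fun_prop)) fun t ht => (hεt ht).2.1)
  have hcut : (fun t : ℝ => ψ.symm (ψ x + t * z)) '' Set.Ioo 0 ε ⊆ cutSurface D L' := by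
    rintro _ ⟨t, ht, rfl⟩
    exact mem_cutSurface.2 ⟨(mem_cutSurface.1 (S.subset (hεt ht).1)).1, (hεt ht).2.2⟩
  have hsub := subset_sheetOf hpre hcut
    (Set.mem_image_of_mem _ (show ε / 2 ∈ Set.Ioo 0 ε from ⟨by linarith, by linarith⟩))
  have hev : ∀ᶠ t : ℝ in 𝓝[>] 0, t ∈ Set.Ioo 0 ε := Ioo_mem_nhdsGT hε'
  refine ⟨_, ⟨_, hvel, hev.mono fun t ht => hsub (Set.mem_image_of_mem _ ht)⟩, fun W hW => ?_⟩
  obtain ⟨t, ht, htW⟩ := (hev.and (hlim.eventually hW)).exists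
  exact ⟨_, htW, (hεt ht).1, hsub (Set.mem_image_of_mem _ ht)⟩

theorem IsDoublePair.symm {f : F → E 3} {a b : F} (h : IsDoublePair f a b) :
    IsDoublePair f b a := by
  obtain ⟨h1, h2, h3, h4, h5⟩ := h
  have hb : b ∈ f ⁻¹' {f a} := by rw [h2]; simp
  refine ⟨h1.symm, ?_, h4, h3, by rwa [sup_comm]⟩
  rw [Set.mem_preimage, Set.mem_singleton_iff] at hb
  rw [hb, h2, Set.pair_comm]

/-- A curve meets the zero set of `G ∘ f` near `x` only at `x`, if it is transverse to it there. -/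
theorem Curves.eventually_ne_zero [T2Space F] (L : Curves F) {f : F → E 3}
    (hf : ContMDiff (𝓡 2) (𝓡 3) ∞ f) (o : SurfaceOrientation F) {G : E 3 → ℝ}
    (hG : DifferentiableAt ℝ G (f x))
    (h : ∀ (p : L.ι × ℝ) (v : TangentSpace (𝓡 2) x), HasVelocityAt (L.curve p.1) p.2 x v →
      fderiv ℝ G (f x) (mfderiv (𝓡 2) (𝓡 3) f x v : E 3) ≠ 0) :
    ∀ᶠ y in 𝓝 x, y ∈ L.support → y = x ∨ G (f y) ≠ 0 := by
  have hev := L.eventually_params x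
    (O := fun i => interior {t | L.curve i t = x ∨ G (f (L.curve i t)) ≠ 0})
    (fun i => isOpen_interior) (fun i t ht => ⟨0, ?_⟩)
  · filter_upwards [hev] with y hy hyL
    obtain ⟨i, t, rfl⟩ := Set.mem_iUnion.1 hyL
    obtain ⟨k, hk⟩ := hy i t rfl
    have := interior_subset hk
    rwa [Set.mem_ofPred_eq, L.curve_add_int] at this
  · rw [Int.cast_zero, add_zero, mem_interior_iff_mem_nhds]
    have hv := L.hasVelocityAt i t
    rw [ht] at hv
    obtain ⟨v, hv⟩ : ∃ v : TangentSpace (𝓡 2) x, HasVelocityAt (L.curve i) t x v := ⟨_, hv⟩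
    obtain ⟨φ, hφ, hx⟩ := o.cover x
    have hxψ : x ∈ (complexChart φ).source := hx
    have h1 := hv.hasDerivAt hφ hx
    have h2 := ((contDiffAt_comp_complexChart_symm hf hφ
      ((complexChart φ).map_source hx)).differentiableAt (by simp)).hasFDerivAt
    have h3 := HasFDerivAt.comp_hasDerivAt t (by rwa [hv.1]) h1
    have h4 := HasFDerivAt.comp_hasDerivAt t (f := fun s =>
      f ((complexChart φ).symm (complexChart φ (L.curve i s))))
      (l := G) (l' := fderiv ℝ G (f x))
      (by rw [hv.1, (complexChart φ).left_inv hxψ]; exact hG.hasFDerivAt) h3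
    rw [← mfderiv_eq_fderiv_chartDeriv hf hφ hx] at h4
    have h5 := h4.eventually_ne (h (i, t) v hv) (c := 0)
    rw [eventually_nhdsWithin_iff] at h5
    filter_upwards [h5, hv.tendsto.eventually ((complexChart φ).open_source.mem_nhds hxψ)]
      with s hs hs'
    by_cases hst : s = t
    · exact Or.inl (hst ▸ hv.1)
    · right
      have := hs hst
      rwa [Function.comp_apply, (complexChart φ).left_inv hs'] at this

end DoubleCurves

/-! ### Moving a meeting of sheets to a nearby point of the double point curve. -/

section DoubleCurves

variable {F : Type} [TopologicalSpace F] [ChartedSpace (E 2) F]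
  {D : Diagram F} {L L' : Curves F}

theorem continuousAt_fderiv_chart {o : SurfaceOrientation F} {φ : OpenPartialHomeomorph F (E 2)}
    {a : F} {f : F → E 3} (hf : ContMDiff (𝓡 2) (𝓡 3) ∞ f) (hφ : φ ∈ o.charts)
    (ha : a ∈ φ.source) : ContinuousAt
      (fun x => fderiv ℝ (fun z => f ((complexChart φ).symm z)) (complexChart φ x)) a := by
  have h1 := contDiffAt_comp_complexChart_symm hf hφ ((complexChart φ).map_source ha)
  have h2 := (h1.fderiv_right (m := 0) (by simp)).continuousAt
  exact ContinuousAt.comp (f := complexChart φ) h2 ((complexChart φ).continuousAt ha)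

/-- If three sheets meet along a double point curve, so do three sheets with respect to any other
family of curves, at a nearby point. -/
theorem MeetAtDoubleCurve.exists_common_points [IsManifold (𝓡 2) ∞ F] [T2Space F] [CompactSpace F]
    (hL' : L'.IsOn D) {xi xj xk : Sheet D L} (h : MeetAtDoubleCurve xi xj xk) :
    ∃ xi' xj' xk' : Sheet D L', MeetAtDoubleCurve xi' xj' xk' ∧ (xj.1 ∩ xj'.1).Nonempty ∧
      ∃ b, b ∉ L.support ∧ b ∉ L'.support ∧ ∀ W ∈ 𝓝 b,
        (W ∩ (xi.1 ∩ xi'.1)).Nonempty ∧ (W ∩ (xk.1 ∩ xk'.1)).Nonempty := by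
  obtain ⟨a, b, hab, hlt, haj, hbL, v, ⟨v₁, v₂, ⟨φ, hφ, ha, hpos⟩, hdet⟩, hei, hek⟩ := h
  have hf := D.contMDiff_map
  obtain ⟨χ, hχ, hb⟩ := D.orientation.cover b
  obtain ⟨hne, hpre, hia, hib, -⟩ := id hab
  have hfb : D.map b = D.map a := by
    have : b ∈ D.map ⁻¹' {D.map a} := by rw [hpre]; simp
    exact this
  have haψ : a ∈ (complexChart φ).source := ha
  have hbψ : b ∈ (complexChart χ).source := hb
  -- the derivatives in charts
  set A := fun x => fderiv ℝ (fun z => D.map ((complexChart φ).symm z)) (complexChart φ x) with hA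
  set B := fun x => fderiv ℝ (fun z => D.map ((complexChart χ).symm z)) (complexChart χ x) with hB
  have hAc : ContinuousAt A a := continuousAt_fderiv_chart hf hφ ha
  have hBc : ContinuousAt B b := continuousAt_fderiv_chart hf hχ hb
  have hmA : ∀ x, x ∈ φ.source → ∀ u : TangentSpace (𝓡 2) x,
      (mfderiv (𝓡 2) (𝓡 3) D.map x u : E 3) = A x (chartDeriv φ x u) := fun x hx u =>
    mfderiv_eq_fderiv_chartDeriv hf hφ hx u
  have hmB : ∀ x, x ∈ χ.source → ∀ u : TangentSpace (𝓡 2) x,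
      (mfderiv (𝓡 2) (𝓡 3) D.map x u : E 3) = B x (chartDeriv χ x u) := fun x hx u =>
    mfderiv_eq_fderiv_chartDeriv hf hχ hx u
  rw [isPositive_iff_of_mem] at hpos
  rw [hmA a ha, hmA a ha, hmB b hb] at hdet
  set c₁ := chartDeriv φ a v₁
  set c₂ := chartDeriv φ a v₂
  set ζ := chartDeriv χ b v with hζ
  -- equations for the two disks
  have hw : B b ζ ∉ tangentImage D.map a := fun hmem => by
    obtain ⟨z, hz⟩ := (mem_tangentImage_iff hf hφ ha).1 hmem
    exact ne_of_stdDet_ne_zero hdet.ne' z hz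
  obtain ⟨w', hw'⟩ := exists_notMem_tangentImage D.map b
  -- `G` is an equation of the upper disk, so near `b` the double point curve is the zero set of `G
  -- ∘ D.map`; it is normalized to have derivative `1` in the direction of `v`. Likewise `G'` is an
  -- equation of the lower disk.
  obtain ⟨G, π, hG, hπ, hGa, hGπ, hG1, hGker⟩ := hia.exists_equation hf D.orientation hw
  obtain ⟨G', π', hG', -, hGb', -, -, hGker'⟩ := hib.exists_equation hf D.orientation hw'
  -- By transversality `L'` can meet the preimages of the double point curve near `b` and `a` only
  -- at `b` and `a` themselves.
  have hLb : ∀ᶠ y in 𝓝 b, y ∈ L'.support → y = b ∨ G (D.map y) ≠ 0 :=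
    L'.eventually_ne_zero hf D.orientation (by rw [hfb]; exact hG.differentiableAt (by simp))
      fun p u hu h0 => hL'.transverse_double p b u hu a hab.symm (hGker _ (by rwa [hfb] at h0))
  have hLa : ∀ᶠ x in 𝓝 a, x ∈ L'.support → x = a ∨ G' (D.map x) ≠ 0 :=
    L'.eventually_ne_zero hf D.orientation (by rw [← hfb]; exact hG'.differentiableAt (by simp))
      fun p u hu h0 => hL'.transverse_double p a u hu b hab (hGker' _ (by rwa [← hfb] at h0))
  -- neighbourhoods of the two points
  obtain ⟨Ua, hUa, hinja⟩ := hia.exists_injOn hf D.orientation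
  obtain ⟨Ub, hUb, hinjb⟩ := hib.exists_injOn hf D.orientation
  have hheight : Continuous D.height := by
    have := D.isSmoothEmbedding.contMDiff.continuous
    unfold Diagram.height
    fun_prop
  have hprod : ∀ᶠ q in 𝓝 a ×ˢ 𝓝 b, q.1 ≠ q.2 ∧ D.height q.2 < D.height q.1 ∧
      0 < stdDet ![A q.1 c₁, A q.1 c₂, B q.2 ζ] := by
    rw [← nhds_prod_eq]
    have hA' : ContinuousAt (fun q : F × F => A q.1) (a, b) :=
      ContinuousAt.comp (f := Prod.fst) (g := A) (x := (a, b)) hAc continuousAt_fst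
    have hB' : ContinuousAt (fun q : F × F => B q.2) (a, b) :=
      ContinuousAt.comp (f := Prod.snd) (g := B) (x := (a, b)) hBc continuousAt_snd
    have h1 : ContinuousAt (fun q : F × F => stdDet ![A q.1 c₁, A q.1 c₂, B q.2 ζ]) (a, b) := by
      refine ContinuousAt.comp (g := stdDet) continuous_stdDet.continuousAt
        (continuousAt_pi.2 fun i => ?_)
      fin_cases i
      · exact hA'.clm_apply continuousAt_const
      · exact hA'.clm_apply continuousAt_const
      · exact hB'.clm_apply continuousAt_const
    have h2 : ∀ᶠ q : F × F in 𝓝 (a, b), q.1 ≠ q.2 :=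
      (isOpen_ne_fun continuous_fst continuous_snd).mem_nhds hne
    have h3 : ∀ᶠ q : F × F in 𝓝 (a, b), D.height q.2 < D.height q.1 :=
      (hheight.comp continuous_snd).continuousAt.eventually_lt
        (hheight.comp continuous_fst).continuousAt hlt
    filter_upwards [h1.tendsto.eventually_const_lt hdet, h2, h3] with q q1 q2 q3
    exact ⟨q2, q3, q1⟩
  obtain ⟨Na, hNa, Nb, hNb, hN⟩ := Filter.eventually_prod_iff.1 hprod
  have hAinj : ∀ᶠ x in 𝓝 a, Function.Injective (A x) :=
    hAc.eventually (ContinuousLinearMap.isOpen_injective.mem_nhds ((isImmersiveAt_iff hf hφ ha).1 hia))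
  have hBinj : ∀ᶠ x in 𝓝 b, Function.Injective (B x) :=
    hBc.eventually (ContinuousLinearMap.isOpen_injective.mem_nhds ((isImmersiveAt_iff hf hχ hb).1 hib))
  have hPa : ∀ᶠ x in 𝓝 a, (x ∈ Ua ∧ Na x ∧ G (D.map x) = 0 ∧ x ∈ xj.1 ∧ x ∈ φ.source) ∧
      (x ∈ L'.support → x = a ∨ G' (D.map x) ≠ 0) ∧ Function.Injective (A x) := by
    filter_upwards [hUa, hNa, hGa, xj.isOpen.mem_nhds haj, φ.open_source.mem_nhds ha, hLa, hAinj]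
      with x h1 h2 h3 h4 h5 h6 h7
    exact ⟨⟨h1, h2, h3.1, h4, h5⟩, h6, h7⟩
  have hPb : ∀ᶠ y in 𝓝 b, (y ∈ Ub ∧ Nb y ∧ G' (D.map y) = 0 ∧ y ∉ L.support ∧ y ∈ χ.source) ∧
      (y ∈ L'.support → y = b ∨ G (D.map y) ≠ 0) ∧ Function.Injective (B y) := by
    filter_upwards [hUb, hNb, hGb', L.isClosed_support.isOpen_compl.mem_nhds hbL,
      χ.open_source.mem_nhds hb, hLb, hBinj] with x h1 h2 h3 h4 h5 h6 h7
    exact ⟨⟨h1, h2, h3.1, h4, h5⟩, h6, h7⟩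
  generalize hPae : (fun x => (x ∈ Ua ∧ Na x ∧ G (D.map x) = 0 ∧ x ∈ xj.1 ∧ x ∈ φ.source) ∧
      (x ∈ L'.support → x = a ∨ G' (D.map x) ≠ 0) ∧ Function.Injective (A x)) = Pa at hPa
  generalize hPbe : (fun y => (y ∈ Ub ∧ Nb y ∧ G' (D.map y) = 0 ∧ y ∉ L.support ∧ y ∈ χ.source) ∧
      (y ∈ L'.support → y = b ∨ G (D.map y) ≠ 0) ∧ Function.Injective (B y)) = Pb at hPb
  have hfc : Filter.Tendsto D.map (𝓝 b) (𝓝 (D.map a)) := hfb ▸ hf.continuous.tendsto b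
  have hcover : ∀ᶠ y in 𝓝 b, ∀ x, D.map x = D.map y → Pa x ∨ Pb x := by
    refine hfc.eventually (eventually_preimage_subset (U := {x | Pa x ∨ Pb x}) hf.continuous ?_)
    intro x hx
    have hx' : x ∈ D.map ⁻¹' {D.map a} := hx
    rw [hpre] at hx'
    rcases hx' with rfl | rfl
    · exact hPa.mono fun y hy => Or.inl hy
    · exact hPb.mono fun y hy => Or.inr hy
  have hpart : ∀ᶠ y in 𝓝 b, G (D.map y) = 0 →
      D.map (π (D.map y)) = D.map y ∧ Pa (π (D.map y)) := by
    filter_upwards [hfc.eventually hGπ, hfc.eventually (hπ.eventually hPa)] with y h1 h2 h0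
    exact ⟨h1 h0, h2⟩
  -- Points with the same projection as `y` lie near `a` or near `b`. Near `b` injectivity leaves
  -- only `y`; near `a` they are higher than `y` and exist exactly when `G` vanishes.
  have hlow : ∀ᶠ y in 𝓝 b, y ∈ D.lowerDecker ↔ G (D.map y) = 0 := by
    filter_upwards [hcover, hPb, hpart] with y h1 h2 h3
    constructor
    · rintro ⟨x, hx, hxy⟩
      rcases h1 x hx with h | h
      · subst hPae
        rw [← hx, h.1.2.2.1]
      · subst hPbe
        rw [hinjb h.1.1 h2.1.1 hx] at hxy
        exact absurd hxy (lt_irrefl _)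
    · intro h0
      obtain ⟨h4, h5⟩ := h3 h0
      subst hPae hPbe
      exact ⟨_, h4, (hN h5.1.2.1 h2.1.2.1).2.1⟩
  have hGb1 : ContDiffAt ℝ 1 G (D.map b) := by
    rw [hfb]; exact hG.of_le (by exact_mod_cast le_top)
  have hGev := hGb1.eventually (by simp)
  have hK : ∀ᶠ y in 𝓝 b, y ∈ closure D.lowerDecker → G (D.map y) = 0 := by
    filter_upwards [eventually_eventually_nhds.2 hlow,
      (hf.continuous.tendsto b).eventually hGev] with y h1 h2 h3
    by_contra h4
    have h5 := (ContinuousAt.comp (f := D.map) h2.continuousAt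
      hf.continuous.continuousAt).eventually_ne h4
    obtain ⟨y', h6, h7, h8⟩ := ((mem_closure_iff_frequently.1 h3).and_eventually (h1.and h5)).exists
    exact h8 (h7.1 h6)
  -- the equation of the double point curve in the chart
  have hsymm := tendsto_complexChart_symm hb
  set g : ℂ → ℝ := fun z => G (D.map ((complexChart χ).symm z)) with hgdef
  have hgψ : ∀ y ∈ χ.source, g (complexChart χ y) = G (D.map y) := fun y hy => by
    simp only [g]
    rw [(complexChart χ).left_inv (show y ∈ (complexChart χ).source from hy)]
  have hg0 : g (complexChart χ b) = 0 := by rw [hgψ b hb, hfb, hGa.self_of_nhds.1]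
  have hfB : ContDiffAt ℝ 1 (fun z => D.map ((complexChart χ).symm z)) (complexChart χ b) :=
    (contDiffAt_comp_complexChart_symm hf hχ ((complexChart χ).map_source hbψ)).of_le
      (by exact_mod_cast le_top)
  have hgd : ContDiffAt ℝ 1 g (complexChart χ b) :=
    ContDiffAt.comp (complexChart χ b) (g := G) (by
      rwa [(complexChart χ).left_inv hbψ]) hfB
  have hgζ : fderiv ℝ g (complexChart χ b) ζ = 1 := by
    have h1 : HasFDerivAt G (fderiv ℝ G (D.map a))
        (D.map ((complexChart χ).symm (complexChart χ b))) := by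
      rw [(complexChart χ).left_inv hbψ, hfb]
      exact (hG.differentiableAt (by simp)).hasFDerivAt
    have h2 := h1.comp (complexChart χ b) (hfB.differentiableAt one_ne_zero).hasFDerivAt
    have h3 : fderiv ℝ g (complexChart χ b) = _ := h2.fderiv
    rw [h3]
    exact hG1
  have hgs := hgd.hasStrictFDerivAt one_ne_zero
  have hk := xk.eventually_mem_of_isEnteredAt hχ hb hgs hg0
    ((hK.and (χ.open_source.mem_nhds hb)).mono fun y hy hyK => by rw [hgψ y hy.2, hy.1 hyK]) hbL
    (v := v) (by rw [← hζ, hgζ]; exact one_pos) hek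
  have hi := xi.eventually_mem_of_isEnteredAt hχ hb hgs.neg (by rw [Pi.neg_apply, hg0, neg_zero])
    ((hK.and (χ.open_source.mem_nhds hb)).mono fun y hy hyK => by
      rw [Pi.neg_apply, hgψ y hy.2, hy.1 hyK, neg_zero]) hbL
    (v := -v) (by simp [← hζ, hgζ]) hei
  -- another point on the double point curve
  have hgpos : ∀ᶠ z in 𝓝 (complexChart χ b), 0 < fderiv ℝ g z ζ :=
    ((hgd.fderiv_right (m := 0) (by simp)).continuousAt.clm_apply
      continuousAt_const).tendsto.eventually_const_lt (by rw [hgζ]; exact one_pos)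
  have hgev := hgd.eventually (by simp)
  have hev : ∀ᶠ z in 𝓝[≠] (complexChart χ b), z ≠ complexChart χ b :=
    eventually_mem_nhdsWithin
  obtain ⟨z, hz0, hzb, hzt, ⟨hPy, hcy, hpy⟩, ⟨hky, hiy⟩, hz1, hz2⟩ :=
    ((frequently_eq_zero (hgev.mono fun z hz => hz.continuousAt) hgs.hasFDerivAt
      (by rw [hgζ]; exact one_pos) hg0).and_eventually (hev.and
        (nhdsWithin_le_nhds (((complexChart χ).open_target.eventually_mem
          ((complexChart χ).map_source hbψ)).and
          ((hsymm.eventually (hPb.and (hcover.and hpart))).and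
          ((hsymm.eventually ((eventually_eventually_nhds.2 hk).and
            (eventually_eventually_nhds.2 hi))).and (hgpos.and hgev))))))).exists
  obtain ⟨y, hy⟩ : ∃ y, (complexChart χ).symm z = y := ⟨_, rfl⟩
  have hyz : complexChart χ y = z := by rw [← hy, (complexChart χ).right_inv hzt]
  rw [hy] at hPy hcy hpy hky hiy
  have hyb : y ≠ b := fun h => hzb (by rw [← hyz, h])
  have hys : y ∈ χ.source := by
    rw [← hy]; exact (complexChart χ).map_target hzt
  rw [← hyz] at hz0 hz1 hz2
  have hG0 : G (D.map y) = 0 := by rw [← hgψ y hys, hz0]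
  obtain ⟨hfx, hPx⟩ := hpy hG0
  obtain ⟨x, hx⟩ : ∃ x, π (D.map y) = x := ⟨_, rfl⟩
  rw [hx] at hfx hPx
  have hPb' := hPb.self_of_nhds
  subst hPae hPbe
  -- The new lower and upper points lie on the preimages of the double point curve and differ from
  -- `b` and `a`, so `L'` misses both.
  have hyL' : y ∉ L'.support := fun h => (hPy.2.1 h).elim hyb fun h => h hG0
  have hxa : x ≠ a := by
    rintro rfl
    exact hyb (hinjb hPy.1.1 hPb'.1.1 (by rw [← hfx, hfb]))
  have hxL' : x ∉ L'.support := fun h => (hPx.2.1 h).elim hxa fun h => h (by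
    rw [hfx, hPy.1.2.2.1])
  obtain ⟨hxy, hhxy, hdetxy⟩ := hN hPx.1.2.1 hPy.1.2.1
  have hxs : x ∈ φ.source := hPx.1.2.2.2.2
  -- The tangent vectors keep their chart coordinates at the new points, so by continuity of the
  -- determinant the normal direction still points to the same side.
  obtain ⟨u₁, hu₁, -⟩ := exists_velocity hφ hxs c₁
  obtain ⟨u₂, hu₂, -⟩ := exists_velocity hφ hxs c₂
  obtain ⟨u, hu, -⟩ := exists_velocity hχ hys ζ
  have hdouble : IsDoublePair D.map x y := by
    refine ⟨hxy, ?_, (isImmersiveAt_iff hf hφ hxs).2 hPx.2.2,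
      (isImmersiveAt_iff hf hχ hys).2 hPy.2.2, ?_⟩
    · ext q
      simp only [Set.mem_preimage, Set.mem_singleton_iff, Set.mem_insert_iff]
      constructor
      · intro hq
        rcases hcy q (hq.trans hfx) with h | h
        · exact Or.inl (hinja h.1.1 hPx.1.1 hq)
        · exact Or.inr (hinjb h.1.1 hPy.1.1 (hq.trans hfx))
      · rintro (rfl | rfl)
        · rfl
        · exact hfx.symm
    · rw [eq_top_iff, ← (linearIndependent_of_stdDet_ne_zero hdetxy.ne').2, Submodule.span_le]
      rintro _ ⟨i, rfl⟩
      fin_cases i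
      · exact Submodule.mem_sup_left ((mem_tangentImage_iff hf hφ hxs).2 ⟨_, rfl⟩)
      · exact Submodule.mem_sup_left ((mem_tangentImage_iff hf hφ hxs).2 ⟨_, rfl⟩)
      · exact Submodule.mem_sup_right ((mem_tangentImage_iff hf hχ hys).2 ⟨_, rfl⟩)
  have hxc : x ∈ cutSurface D L' :=
    mem_cutSurface.2 ⟨(mem_cutSurface.1 (xj.subset hPx.1.2.2.2.1)).1, hxL'⟩
  have hray : ∀ c : ℂ, HasDerivAt (fun t : ℝ => complexChart χ y + t * c) c 0 := fun c => by
    have := ((hasDerivAt_id (0 : ℝ)).ofReal_comp.mul_const c).const_add (complexChart χ y)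
    simpa using this
  have hrayv : ∀ c : ℂ, Filter.Tendsto
      (fun t : ℝ => (complexChart χ).symm (complexChart χ y + t * c)) (𝓝[>] 0) (𝓝 y) := fun c => by
    obtain ⟨_, -, hvel⟩ := exists_velocity hχ hys c
    exact hvel.tendsto.mono_left nhdsWithin_le_nhds
  have hrayt : ∀ c : ℂ, ∀ᶠ t : ℝ in 𝓝[>] 0, complexChart χ ((complexChart χ).symm
      (complexChart χ y + t * c)) = complexChart χ y + t * c := fun c => by
    refine nhdsWithin_le_nhds ?_
    filter_upwards [(hray c).continuousAt.preimage_mem_nhds (by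
      simpa using (complexChart χ).open_target.mem_nhds
        ((complexChart χ).map_source (show y ∈ (complexChart χ).source from hys)))] with t ht
    exact (complexChart χ).right_inv ht
  have hz0' : complexChart χ y + ((0 : ℝ) : ℂ) * ζ = complexChart χ y := by simp
  have hgy := (hz2.differentiableAt one_ne_zero).hasFDerivAt
  have hraypos := (eventually_lt_of_hasDerivAt (HasFDerivAt.comp_hasDerivAt (0 : ℝ)
    (by simpa using hgy) (hray ζ)) hz1).1
  have hrayneg := (eventually_lt_of_hasDerivAt (HasFDerivAt.comp_hasDerivAt (0 : ℝ)
    (by simpa using hgy.neg) (hray (-ζ))) (by simpa using hz1)).1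
  simp only [Function.comp_apply, Complex.ofReal_zero, zero_mul, add_zero, hz0, Pi.neg_apply,
    neg_zero] at hraypos hrayneg
  obtain ⟨xk', hk1, hk2⟩ := xk.exists_isEnteredAt_of_ray hχ hys hu hyL' (by
    filter_upwards [hraypos, hrayt ζ, (hrayv ζ).eventually hky] with t h1 h2 h3
    exact h3 (by rwa [h2]))
  obtain ⟨xi', hi1, hi2⟩ := xi.exists_isEnteredAt_of_ray hχ hys (v := -u) (z := -ζ)
    (by rw [map_neg, hu]) hyL' (by
    filter_upwards [hrayneg, hrayt (-ζ), (hrayv (-ζ)).eventually hiy] with t h1 h2 h3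
    exact h3 (by rwa [Pi.neg_apply, h2]))
  refine ⟨xi', sheetOf hxc, xk', ⟨x, y, hdouble, hhxy, mem_sheetOf hxc, hyL', u,
    ⟨u₁, u₂, ⟨φ, hφ, hxs, ?_⟩, ?_⟩, hi1, hk1⟩, ⟨x, hPx.1.2.2.2.1, mem_sheetOf hxc⟩, y,
    hPy.1.2.2.2.1, hyL', fun W hW => ⟨hi2 W hW, hk2 W hW⟩⟩
  · rw [isPositive_iff_of_mem, hu₁, hu₂]
    exact hpos
  · rw [hmA x hxs, hmA x hxs, hmB y hys, hu₁, hu₂, hu]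
    exact hdetxy

end DoubleCurves

/-! ### Powers of the kink map -/

section Kink

variable {R : Type*} [Rack R]

/-- Since `ι(b) * b = b`, right translation by `b` is the conjugate of translation by `ι(b)` under
translation by `b` itself; hence the two coincide. -/
theorem rackOp_kink_zpow_right (a b : R) (n : ℤ) : rackOp a ((kink R ^ n) b) = rackOp a b := by
  have h : ∀ b : R, rackOp a (kink R b) = rackOp a b := fun b => Rack.self_invAct_act_eq
  have h' : ∀ b : R, rackOp a ((kink R)⁻¹ b) = rackOp a b := fun b => by
    exact (h _).symm.trans (congrArg (rackOp a) ((kink R).apply_symm_apply b))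
  induction n with
  | zero => rfl
  | succ n ih => rw [add_comm, zpow_one_add, Equiv.Perm.mul_apply, h, ih]
  | pred n ih => rw [sub_eq_add_neg, add_comm, zpow_add, zpow_neg_one, Equiv.Perm.mul_apply, h', ih]

/-- Right translations are rack automorphisms, so they commute with `a ↦ a * a` and with its inverse
`ι`. -/
theorem rackOp_kink_zpow_left (a b : R) (n : ℤ) :
    rackOp ((kink R ^ n) a) b = (kink R ^ n) (rackOp a b) := by
  have h : Commute (Rack.act' b) (Rack.selfApplyEquiv R) := by
    ext x
    exact Shelf.self_distrib
  have h' : Commute (Rack.act' b) (kink R) := h.inv_right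
  exact DFunLike.congr_fun (h'.zpow_right n).eq a

end Kink

/-! ### Transfer of colorings -/

section Transfer

variable {F : Type} [TopologicalSpace F] [ChartedSpace (E 2) F] {D : Diagram F} {L L' : Curves F}

/-- The function `N` changes along a path by the number of crossings of `L'` with the path, minus
the number of crossings of `L`. -/
def IsRelativeNumbering (D : Diagram F) (L L' : Curves F) (N : F → ℤ) : Prop :=
  ∀ e : Disk F, e.IsOriented D.orientation → ∀ p ∈ e.inner, ∀ q ∈ e.inner,
    p ∉ L.support → p ∉ L'.support → q ∉ L.support → q ∉ L'.support →
    N q - N p = L'.crossing e p q - L.crossing e p q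

theorem IsRelativeNumbering.neg {N : F → ℤ} (h : IsRelativeNumbering D L L' N) :
    IsRelativeNumbering D L' L (-N) := fun e he p hp q hq h1 h2 h3 h4 => by
  have := h e he p hp q hq h2 h1 h4 h3
  simp only [Pi.neg_apply]
  linarith

theorem exists_oriented_disk (o : SurfaceOrientation F) {x : F} {W : Set F} (hW : W ∈ 𝓝 x) :
    ∃ e : Disk F, e.IsOriented o ∧ x ∈ e.inner ∧ e.inner ⊆ W := by
  obtain ⟨φ, hφ, hx⟩ := o.cover x
  obtain ⟨e, hec, -, hxe, he⟩ := exists_disk (complexChart φ) hx hW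
  exact ⟨e, ⟨φ, hφ, hec⟩, hxe, he⟩

theorem IsRelativeNumbering.eventually_eq [T2Space F] {N : F → ℤ}
    (h : IsRelativeNumbering D L L' N) {x : F} (hx : x ∉ L.support) (hx' : x ∉ L'.support) :
    ∀ᶠ y in 𝓝 x, N y = N x := by
  obtain ⟨e, he, hxe, heW⟩ := exists_oriented_disk D.orientation (Filter.inter_mem
    (L.isClosed_support.isOpen_compl.mem_nhds hx) (L'.isClosed_support.isOpen_compl.mem_nhds hx'))
  filter_upwards [e.isOpen_inner.mem_nhds hxe] with y hy
  have h1 := h e he x hxe y hy hx hx' (heW hy).1 (heW hy).2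
  rw [Curves.crossing_eq_zero_of_disk rfl (fun q hq => (heW hq).1) hxe hy hxe hy,
    Curves.crossing_eq_zero_of_disk rfl (fun q hq => (heW hq).2) hxe hy hxe hy] at h1
  linarith

variable [T2Space F] {R : Type*} [Rack R]

/-- The sheet `S` does not meet `L'`, so within it `N` decreases by the crossing number of `L`,
while the color changes by `ι` to that number; the two effects cancel. -/
theorem Coloring.kink_zpow_eq_of_mem (hL : L.IsOn D) {N : F → ℤ}
    (hN : IsRelativeNumbering D L L' N) (c : Coloring D L R) {S : Sheet D L'} {T T' : Sheet D L}
    {z z' : F} (hz : z ∈ S.1) (hzT : z ∈ T.1) (hz' : z' ∈ S.1) (hzT' : z' ∈ T'.1) :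
    (kink R ^ N z) (c.color T) = (kink R ^ N z') (c.color T') := by
  classical
  let u : F → R := fun q => if h : q ∈ cutSurface D L then (kink R ^ N q) (c.color (sheetOf h))
    else c.color T
  have hu : ∀ q (h : q ∈ cutSurface D L), u q = (kink R ^ N q) (c.color (sheetOf h)) :=
    fun q h => dif_pos h
  have huT : ∀ (T : Sheet D L) q, q ∈ T.1 → u q = (kink R ^ N q) (c.color T) := fun T q hq => by
    rw [hu q (T.subset hq), ← T.eq_sheetOf hq]
  rw [← huT T z hzT, ← huT T' z' hzT']
  refine eq_of_locally_eq S.isPreconnected hL.dense_compl_support (fun x hx => ?_) hz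
    (mem_cutSurface.1 (T.subset hzT)).2 hz' (mem_cutSurface.1 (T'.subset hzT')).2
  obtain ⟨e, he, hxe, heS⟩ := exists_oriented_disk D.orientation (S.isOpen.mem_nhds hx)
  have hcut := fun q (hq : q ∈ e.inner) => mem_cutSurface.1 (S.subset (heS hq))
  refine ⟨e.inner, e.isOpen_inner.mem_nhds hxe, fun y hy hyL q hq hqL => ?_⟩
  have hyc : y ∈ cutSurface D L := mem_cutSurface.2 ⟨(hcut y hy).1, hyL⟩
  have hqc : q ∈ cutSurface D L := mem_cutSurface.2 ⟨(hcut q hq).1, hqL⟩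
  have h1 := hN e he y hy q hq hyL (hcut y hy).2 hqL (hcut q hq).2
  rw [Curves.crossing_eq_zero_of_disk rfl (fun q hq => (hcut q hq).2) hy hq hy hq] at h1
  rw [hu y hyc, hu q hqc, c.color_sheetOf hL he (fun q hq => (hcut q hq).1) hy hq hyc hqc,
    ← Equiv.Perm.mul_apply, ← zpow_add]
  congr 2
  linarith

theorem Sheet.exists_mem_notMem_support (hL : L.IsOn D) (S : Sheet D L') :
    ∃ z ∈ S.1, z ∉ L.support := by
  obtain ⟨z, hz⟩ := hL.dense_compl_support.inter_open_nonempty S.1 S.isOpen S.nonempty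
  exact ⟨z, hz.1, hz.2⟩

theorem Sheet.exists_mem_sheet (hL : L.IsOn D) (S : Sheet D L') :
    ∃ (z : F) (T : Sheet D L), z ∈ S.1 ∧ z ∈ T.1 := by
  obtain ⟨z, hz, hzL⟩ := S.exists_mem_notMem_support hL
  have hzc : z ∈ cutSurface D L := mem_cutSurface.2 ⟨(mem_cutSurface.1 (S.subset hz)).1, hzL⟩
  exact ⟨z, sheetOf hzc, hz, mem_sheetOf hzc⟩

theorem Sheet.exists_mem_disk (hL : L.IsOn D) (S : Sheet D L') {e : Disk F} {y : F}
    (hy : y ∈ S.1) (hye : y ∈ e.inner) :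
    ∃ z ∈ S.1, z ∈ e.inner ∧ z ∉ L.support ∧ L'.crossing e y z = 0 := by
  obtain ⟨e', hec, -, hye', he'⟩ := exists_disk e.chart hye.1
    (Filter.inter_mem (e.isOpen_inner.mem_nhds hye) (S.isOpen.mem_nhds hy))
  obtain ⟨z, hz, hzL⟩ := hL.dense_compl_support.inter_open_nonempty e'.inner e'.isOpen_inner
    ⟨y, hye'⟩
  exact ⟨z, (he' hz).2, (he' hz).1, hzL, Curves.crossing_eq_zero_of_disk hec
    (fun q hq => (mem_cutSurface.1 (S.subset (he' hq).2)).2) hye (he' hz).1 hye' hz⟩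

variable [IsManifold (𝓡 2) ∞ F] [CompactSpace F]

/-- A coloring of `(D, L)`, transferred to `(D, L')` by means of a relative numbering. -/
def Coloring.transfer (hL : L.IsOn D) {N : F → ℤ} (hN : IsRelativeNumbering D L L' N)
    (c : Coloring D L R) : Coloring D L' R :=
  have key : ∀ (S : Sheet D L') (T : Sheet D L) z, z ∈ S.1 → z ∈ T.1 →
      (kink R ^ N (S.exists_mem_sheet hL).choose)
        (c.color (S.exists_mem_sheet hL).choose_spec.choose) = (kink R ^ N z) (c.color T) :=
    fun S T z hz hzT =>
      have h := (S.exists_mem_sheet hL).choose_spec.choose_spec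
      c.kink_zpow_eq_of_mem hL hN h.1 h.2 hz hzT
  -- An arbitrary point of `S` off `L` is chosen; `key` shows that the choice is immaterial.
  { color := fun S => (kink R ^ N (S.exists_mem_sheet hL).choose)
      (c.color (S.exists_mem_sheet hL).choose_spec.choose)
    double_curve := by
      intro xi xj xk h
      obtain ⟨xi', xj', xk', h', ⟨q, hq, hq'⟩, b, hb', hb, hW⟩ := h.exists_common_points hL
      -- Both under-sheets are sampled where `N` equals `N b`. The same power of `ι` then pulls out
      -- on both sides, and the power on the over-sheet has no effect.
      obtain ⟨⟨y, hy, hyi, hyi'⟩, ⟨z, hz, hzk, hzk'⟩⟩ := hW _ (hN.eventually_eq hb hb')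
      rw [key xi xi' y hyi hyi', key xj xj' q hq hq', key xk xk' z hzk hzk',
        c.double_curve xi' xj' xk' h', rackOp_kink_zpow_right, rackOp_kink_zpow_left,
        show N y = N b from hy, show N z = N b from hz]
    curve := by
      intro xi xj h
      obtain ⟨e, he, heK, y, hy, z, hz, hye, hze, hcr⟩ := h.exists_crossing_eq_one
      -- The sample points may lie on `L`; they are moved off it inside their sheets without
      -- changing the crossing number of `L'`.
      obtain ⟨y', hy', hye', hyL, hcry⟩ := xi.exists_mem_disk hL hy hye
      obtain ⟨z', hz', hze', hzL, hcrz⟩ := xj.exists_mem_disk hL hz hze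
      have hyc : y' ∈ cutSurface D L := mem_cutSurface.2 ⟨heK _ hye', hyL⟩
      have hzc : z' ∈ cutSurface D L := mem_cutSurface.2 ⟨heK _ hze', hzL⟩
      have hoff : ∀ (S : Sheet D L') q, q ∈ S.1 → q ∉ L'.support := fun S q hq =>
        (mem_cutSurface.1 (S.subset hq)).2
      have h1 := Curves.crossing_add (L := L') hye hye' hze' (hoff xi y hy) (hoff xi y' hy')
        (hoff xj z' hz')
      have h2 := Curves.crossing_add (L := L') hye hze hze' (hoff xi y hy) (hoff xj z hz)
        (hoff xj z' hz')
      have h3 := hN e he y' hye' z' hze' hyL (hoff xi y' hy') hzL (hoff xj z' hz')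
      rw [key xi _ y' hy' (mem_sheetOf hyc), key xj _ z' hz' (mem_sheetOf hzc),
        c.color_sheetOf hL he heK hye' hze' hyc hzc, ← Equiv.Perm.mul_apply, ← zpow_add,
        ← Equiv.Perm.mul_apply, ← zpow_one_add]
      congr 2
      linarith }

theorem Coloring.transfer_color (hL : L.IsOn D) {N : F → ℤ} (hN : IsRelativeNumbering D L L' N)
    (c : Coloring D L R) {S : Sheet D L'} {T : Sheet D L} {z : F} (hz : z ∈ S.1) (hzT : z ∈ T.1) :
    (c.transfer hL hN).color S = (kink R ^ N z) (c.color T) :=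
  have h := (S.exists_mem_sheet hL).choose_spec.choose_spec
  c.kink_zpow_eq_of_mem hL hN h.1 h.2 hz hzT

theorem Coloring.transfer_transfer (hL : L.IsOn D) (hL' : L'.IsOn D) {N N' : F → ℤ}
    (hN : IsRelativeNumbering D L L' N) (hN' : IsRelativeNumbering D L' L N')
    (h : ∀ x, N' x + N x = 0) (c : Coloring D L R) : (c.transfer hL hN).transfer hL' hN' = c := by
  have hc : ((c.transfer hL hN).transfer hL' hN').color = c.color := by
    funext T
    obtain ⟨z, S, hz, hzS⟩ := T.exists_mem_sheet hL'
    rw [transfer_color hL' hN' _ hz hzS, transfer_color hL hN _ hzS hz, ← Equiv.Perm.mul_apply,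
      ← zpow_add, h, zpow_zero, Equiv.Perm.one_apply]
  generalize (c.transfer hL hN).transfer hL' hN' = d at hc
  cases c
  cases d
  simp only at hc
  subst hc
  rfl

/-- The bijection between the colorings that a relative numbering defines. -/
def Coloring.transferEquiv (hL : L.IsOn D) (hL' : L'.IsOn D) {N : F → ℤ}
    (hN : IsRelativeNumbering D L L' N) : Coloring D L R ≃ Coloring D L' R where
  toFun := Coloring.transfer hL hN
  invFun := Coloring.transfer hL' hN.neg
  left_inv := Coloring.transfer_transfer hL hL' hN hN.neg fun x => by simp
  right_inv := Coloring.transfer_transfer hL' hL hN.neg hN fun x => by simp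

end Transfer

/-! ### Numberings of homologous families of curves -/

section Numbering

variable {F : Type} [TopologicalSpace F] [ChartedSpace (E 2) F] [T2Space F] {D : Diagram F}
  {L L' : Curves F}

theorem crossing_reverse_union {e : Disk F} {p q : F} (hp : p ∈ e.inner) (hq : q ∈ e.inner)
    (hpL : p ∉ L.support) (hqL : q ∉ L.support) (hpL' : p ∉ L'.support) (hqL' : q ∉ L'.support) :
    (L.reverse.union L').crossing e p q = L'.crossing e p q - L.crossing e p q := by
  have h := Disk.admissible_dipole hq hp hqL hpL
  have h' := Disk.admissible_dipole hq hp hqL' hpL'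
  simp only [Curves.crossing]
  rw [Curves.deg_union, Curves.deg_reverse h]
  ring

/-- Homology makes the total winding number of `(-L) ∪ L'` vanish for every nowhere zero continuous
function, so this family has a potential. -/
theorem exists_isRelativeNumbering [CompactSpace F] [ConnectedSpace F] (hL : L.IsOn D)
    (hL' : L'.IsOn D) (h : L.Homologous L') : ∃ N : F → ℤ, IsRelativeNumbering D L L' N := by
  have hdense : Dense (L.reverse.union L').supportᶜ := by
    rw [Curves.support_union, Curves.support_reverse, Set.compl_union]
    exact hL.dense_compl_support.inter_of_isOpen_left hL'.dense_compl_support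
      L.isClosed_support.isOpen_compl
  obtain ⟨N, hN⟩ := exists_potential D.orientation hdense fun m hm hm0 => by
    rw [Curves.deg_union, Curves.deg_reverse fun x _ => ⟨hm.continuousAt, hm0 x⟩,
      h.deg_eq hm hm0, neg_add_cancel]
  refine ⟨N, fun e he p hp q hq h1 h2 h3 h4 => ?_⟩
  rw [← crossing_reverse_union hp hq h1 h3 h2 h4]
  exact hN e he p hp q hq (by simp [h1, h2]) (by simp [h3, h4])

/-- The relative numbering is locally constant off both families and so descends to sheets. At a
double point curve the lower point is off the curves, and both under-sheets are entered through a
neighbourhood where the numbering is constant. -/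
theorem exists_isNumbering {N : F → ℤ} (hN : IsRelativeNumbering D L L' N) :
    ∃ N' : Sheet D (L.reverse.union L') → ℤ, IsNumbering N' ∧ ∀ S, ∀ z ∈ S.1, N' S = N z := by
  have hoff : ∀ (S : Sheet D (L.reverse.union L')) z, z ∈ S.1 → z ∉ L.support ∧ z ∉ L'.support :=
    fun S z hz => by simpa using (mem_cutSurface.1 (S.subset hz)).2
  have hconst : ∀ (S : Sheet D (L.reverse.union L')) z z', z ∈ S.1 → z' ∈ S.1 → N z = N z' := by
    intro S z z' hz hz'
    refine eq_of_locally_eq (A := ∅) S.isPreconnected (by simp) (fun x hx => ?_) hz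
      (Set.notMem_empty _) hz' (Set.notMem_empty _)
    refine ⟨_, hN.eventually_eq (hoff S x hx).1 (hoff S x hx).2, fun y hy _ y' hy' _ => ?_⟩
    exact (show N y = N x from hy).trans (show N y' = N x from hy').symm
  have hval : ∀ (S : Sheet D (L.reverse.union L')), ∀ z ∈ S.1, N S.nonempty.some = N z :=
    fun S z hz => hconst S _ _ S.nonempty.some_mem hz
  refine ⟨fun S => N S.nonempty.some, ⟨fun xi xj h => ?_, fun xi xj xk h => ?_⟩, hval⟩
  · obtain ⟨e, he, -, y, hy, z, hz, hye, hze, hcr⟩ := h.exists_crossing_eq_one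
    have h1 := hN e he y hye z hze (hoff xi y hy).1 (hoff xi y hy).2 (hoff xj z hz).1
      (hoff xj z hz).2
    rw [← crossing_reverse_union hye hze (hoff xi y hy).1 (hoff xj z hz).1 (hoff xi y hy).2
      (hoff xj z hz).2, hcr] at h1
    rw [hval xi y hy, hval xj z hz]
    linarith
  · obtain ⟨a, b, -, -, -, hb, v, -, ⟨β, hβ, hi⟩, ⟨γ, hγ, hk⟩⟩ := h
    have hb' : b ∉ L.support ∧ b ∉ L'.support := by simpa using hb
    have hc := hN.eventually_eq hb'.1 hb'.2
    obtain ⟨t, ht, ht'⟩ := (hi.and ((hβ.tendsto.mono_left nhdsWithin_le_nhds).eventually hc)).exists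
    obtain ⟨s, hs, hs'⟩ := (hk.and ((hγ.tendsto.mono_left nhdsWithin_le_nhds).eventually hc)).exists
    rw [hval xi _ ht, hval xk _ hs, ht', hs']

end Numbering

end SurfaceKnot

end

/-! ### The bijection with its normalized numbering. -/

theorem proposition4p2
    (F : Type) [TopologicalSpace F] [ChartedSpace (SurfaceKnot.E 2) F] [IsManifold (𝓡 2) ∞ F]
    [T2Space F] [CompactSpace F] [ConnectedSpace F]
    (D : SurfaceKnot.Diagram F) (L₁ L₂ : SurfaceKnot.Curves F)
    (h₁ : L₁.IsOn D) (h₂ : L₂.IsOn D) (h : L₁.Homologous L₂)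
    (R : Type*) [Rack R] :
    Nonempty (SurfaceKnot.Coloring D L₁ R ≃ SurfaceKnot.Coloring D L₂ R) ∧
    ∀ y₀ : SurfaceKnot.Sheet D (L₁.reverse.union L₂),
      ∃ N : SurfaceKnot.Sheet D (L₁.reverse.union L₂) → ℤ,
        SurfaceKnot.IsNumbering N ∧ N y₀ = 0 ∧
        ∃ Φ : SurfaceKnot.Coloring D L₁ R ≃ SurfaceKnot.Coloring D L₂ R,
          ∀ (c : SurfaceKnot.Coloring D L₁ R) (x₁ : SurfaceKnot.Sheet D L₁)
            (x₂ : SurfaceKnot.Sheet D L₂) (y : SurfaceKnot.Sheet D (L₁.reverse.union L₂)),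
            y.1 ⊆ x₁.1 → y.1 ⊆ x₂.1 →
            (Φ c).color x₂ = (SurfaceKnot.kink R ^ N y) (c.color x₁) := by
  obtain ⟨N, hN⟩ := SurfaceKnot.exists_isRelativeNumbering h₁ h₂ h
  refine ⟨⟨SurfaceKnot.Coloring.transferEquiv h₁ h₂ hN⟩, fun y₀ => ?_⟩
  obtain ⟨p, hp⟩ := y₀.nonempty
  -- Subtracting a constant preserves all differences and gives the value `0` on `y₀`. The shifted
  -- function defines both the numbering and the bijection, so the exponents match.
  have hN₀ : SurfaceKnot.IsRelativeNumbering D L₁ L₂ fun x => N x - N p :=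
    fun e he q hq r hr h1 h2 h3 h4 => by
      rw [sub_sub_sub_cancel_right, hN e he q hq r hr h1 h2 h3 h4]
  obtain ⟨N', hN', hval⟩ := SurfaceKnot.exists_isNumbering hN₀
  refine ⟨N', hN', by rw [hval y₀ p hp, sub_self],
    SurfaceKnot.Coloring.transferEquiv h₁ h₂ hN₀, fun c x₁ x₂ y hy₁ hy₂ => ?_⟩
  obtain ⟨z, hz⟩ := y.nonempty
  rw [hval y z hz]
  exact c.transfer_color h₁ hN₀ (hy₂ hz) (hy₁ hz)
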